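/- **Trace formula for Bethe vectors of an open $\mathfrak{gl}_n$ spin chain.** *The chain.* Let $\rho,a,c_1,\dots,c_\ell\in\mathbb C$, $0\le r\le n$, and let $L_1,\dots,L_\ell$ be finite-dimensional irreducible $\mathfrak{gl}_n$-modules with $E_{ij}$ acting by $E^{(s)}_{ij}$ in $L_s$. On $M^{(1)}=L_1\otimes\cdots\otimes L_\ell$ (tensored with a one-dimensional boundary module) put $$T_s(w)=I-\frac{1}{w-c_s}\sum_{i,j}e_{ij}\otimes E^{(s)}_{ji},\qquad T(w)=T_1(w)\cdots T_\ell(w),\qquad K(v)=\sum_{i>r}e_{ii}-\sum_{i\le r}e_{ii}-\frac{a}{v+\rho/2}I,$$ $$B(v)=T(v)\,K(v)\,T(-v-\rho)^{-1}=\sum_{i,j=1}^n e_{ij}\otimes b_{ij}(v).$$ Let $\eta\in M^{(1)}$ be a lowest vector: $\eta\neq0$, $b_{ij}(v)\eta=0$ for $i>j$, and $\eta$ is an eigenvector of every $b_{ii}(v)$. *R-matrices.* Let $V^{(k)}=\mathrm{span}(e_k,\dots,e_n)\subseteq\mathbb C^n$. Put $R^{(1)}(x)=I-x^{-1}P$ on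 $\mathbb C^n\otimes\mathbb C^n$, with $P$ the flip, and on $V^{(k)}\otimes V^{(l)}$ $$R^{(k,l)}(x)=\frac{x}{x-1}\big(I-x^{-1}P^{(k,l)}\big),\qquad P^{(k,l)}=\sum_{i,j\ge\max(k,l)}e_{ij}\otimes e_{ji}.$$ On $\mathbb C^n\otimes\mathbb C^n$ the operator $R^{(k,l)}(x)$ is extended by zero. A product $\prod_{i=p}^{q}X_i$ is ordered from left to right, $X_pX_{p\pm1}\cdots X_q$. Put, for $c,d\ge i$, $$[\hat D^{(i)}(v)]_{cd}=b_{cd}\big(v+\tfrac{i-1}2\big)+\frac{\delta_{cd}}{2v+\rho}\sum_{l<i}b_{ll}\big(v+\tfrac{i-1}2\big),\qquad \widetilde D^{(i)}(v)=\sum_{c,d=i}^n e_{cd}\otimes[\hat D^{(i)}(v)]_{cd}.$$ *Bethe vector.* Let $m_1,\dots,m_{n-1}\ge0$, and let $u^{(i)}_j\in\mathbb C$ $(1\le i\le n-1,\ 1\le j\le m_i)$ be parameters for which no denominator in the formulas below vanishes, $B$ is defined at each $u^{(i)}_j+\frac i2$ (no denominator of $T(v),K(v),T(-v-\rho)$ vanishes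 there and $T(-v-\rho)$ is invertible), and no argument of a matrix $R^{(k,l)}$ below is $0$ or $1$. Introduce labels $a^i_j$. The level-$1$ monodromy matrix is $\hat D^{(1)}_a(v)=B_a(v)$, and for $k\ge2$ $$\hat D^{(k)}_{a\,a^{1\dots k-1}}(v)=\Big(\prod_{i=1}^{m_{k-1}}R^{(k,k)}_{a\,a^{k-1}_i}(v+u^{(k-1)}_i+\rho)\Big)\,\check D_a(v)\,\Big(\prod_{i=m_{k-1}}^{1}R^{(k,k)}_{a\,a^{k-1}_i}(v-u^{(k-1)}_i)\Big),$$ where the entries of $\check D(v)$, for $i,j\ge k$, are $$[\check D(v)]_{ij}=[\hat D^{(k-1)}_{a\,a^{1\dots k-2}}(v+\tfrac12)]_{ij}+\frac{\delta_{ij}}{2v+\rho}[\hat D^{(k-1)}_{a\,a^{1\dots k-2}}(v+\tfrac12)]_{k-1,k-1}.$$ Here a label $a^b_c$ carries the space $V^{(b+1)}$ and $a$ carries $V^{(k)}$. Let $\hat B^{(k)}_{a^k_i}$ be the row vector in $(V^{(k+1)}_{a^k_i})^*$ with entries $[\hat D^{(k)}_{a\,a^{1\dots k-1}}(u^{(k)}_i+\frac12)]_{k,l}$,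 $l>k$, and put $\mathscr B^{(k)}=\hat B^{(k)}_{a^k_1}\cdots\hat B^{(k)}_{a^k_{m_k}}$. The level-$1$ Bethe vector is $$\Phi^{(1)}=\mathscr B^{(1)}\mathscr B^{(2)}\cdots\mathscr B^{(n-1)}\cdot (e_n)^{\otimes m_{n-1}}\otimes\cdots\otimes(e_2)^{\otimes m_1}\otimes\eta .$$ **Theorem.** Under these assumptions $$\begin{aligned}\Phi^{(1)}=\mathrm{tr}_{\overline V}\Bigg[\Bigg(\prod_{i=1}^{n-1}\prod_{j=1}^{m_i}\Bigg(&\Big(\prod_{k=1}^{j-1}R^{(1)}_{a^i_ja^i_k}(u^{(i)}_j+u^{(i)}_k+\rho+1)\Big)\Big(\prod_{b=i-1}^{1}\prod_{c=1}^{m_b}R^{(i,b+1)}_{a^i_ja^b_c}\big(u^{(i)}_j+u^{(b)}_c+\rho+\tfrac{i-b}2\big)\Big)\\&\times\widetilde D^{(i)}_{a^i_j}\big(u^{(i)}_j+\tfrac12\big)\Big(\prod_{b=1}^{i-1}\prod_{c=m_b}^{1}R^{(i,b+1)}_{a^i_ja^b_c}\big(u^{(i)}_j-u^{(b)}_c+\tfrac{i-b}2\big)\Big)\Bigg)\Bigg)\\&\times(e_{n,n-1})^{\otimes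 m_{n-1}}\otimes\cdots\otimes(e_{21})^{\otimes m_1}\Bigg]\cdot\eta,\end{aligned}$$ where the trace is over $\overline V=(\mathbb C^n)^{\otimes\overline m}$, $\overline m=\sum_i m_i$, with one factor $\mathbb C^n$ for each label $a^i_j$. -/

import Mathlib

open scoped TensorProduct

attribute [local instance 100] LieRing.ofAssociativeRing

noncomputable section

/-! Levels are counted from `1`, as usual; an index `i : Fin n` stands for the basis vector
`e_{i+1}` of `ℂⁿ`.  A matrix operator with values in an algebra `A` is a matrix over `A`:
an element of `End(ℂ^{N₁} ⊗ ⋯ ⊗ ℂ^{N_s}) ⊗ A` is a matrix over `A` whose rows and columns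
are indexed by the standard basis of the tensor product. -/

namespace OpenChain

section TensorSpaces

/-- The basis `e_k, …, e_n` of the reduced space `V^{(k)} ≅ ℂ^{n-k+1}`. -/
abbrev Idx (n k : ℕ) : Type := {i : Fin n // k ≤ (i : ℕ) + 1}

/-- The inclusion `V^{(k+1)} ⊆ V^{(k)}` on basis vectors. -/
def Idx.up {n k : ℕ} (i : Idx n (k + 1)) : Idx n k := ⟨i.1, by have := i.2; omega⟩

/-- The first basis vector `e_{d+1}` of `V^{(d+1)}`; the argument only witnesses that this
space is nonzero. -/
def Idx.head {n d : ℕ} (i : Idx n (d + 2)) : Idx n (d + 1) :=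
  ⟨⟨d, by have := i.2; have := i.1.2; omega⟩, le_rfl⟩

/-- The labels `a^b_c` of the levels `1 ≤ b ≤ d`, where `1 ≤ c ≤ m_b`. -/
abbrev Lab (m : ℕ → ℕ) (d : ℕ) : Type := (b : {b : ℕ // b ∈ Finset.Icc 1 d}) × Fin (m b)

/-- The label `a^b_c`. -/
def lab {m : ℕ → ℕ} {d : ℕ} (b : ℕ) (hb : 1 ≤ b ∧ b ≤ d) (c : Fin (m b)) : Lab m d :=
  ⟨⟨b, Finset.mem_Icc.2 hb⟩, c⟩

/-- The standard basis of `⨂_x V^{(k x)}`, the tensor product over a family of labels. -/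
abbrev Conf (n : ℕ) {ι : Type} (k : ι → ℕ) : Type := (x : ι) → Idx n (k x)

variable {n : ℕ} {ι : Type} [Fintype ι] [DecidableEq ι] {k : ι → ℕ}
  {A : Type*} [Ring A] [Algebra ℂ A]

/-- The operator `e_{ij} ⊗ α` with `α ∈ A` and `e_{ij}` acting in the tensor factor `x`
(it is zero unless `e_i` and `e_j` both lie in that factor). -/
def siteElt (x : ι) (i j : Fin n) (α : A) : Matrix (Conf n k) (Conf n k) A :=
  Matrix.of fun s t =>
    if (s x).1 = i ∧ (t x).1 = j ∧ ∀ y, y ≠ x → s y = t y then α else 0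

/-- The elementary tensor `⨂_x X_x ⊗ 1`. -/
def tensorOp (X : ι → Matrix (Fin n) (Fin n) ℂ) : Matrix (Conf n k) (Conf n k) A :=
  Matrix.of fun s t => algebraMap ℂ A (∏ x, X x (s x).1 (t x).1)

/-- The matrix unit `e_{b+1,b}`. -/
def lowering (n b : ℕ) : Matrix (Fin n) (Fin n) ℂ :=
  Matrix.of fun i j => if (i : ℕ) + 1 = b + 1 ∧ (j : ℕ) + 1 = b then 1 else 0

/-- A matrix operator over `End M` applied to a vector with components in `M`. -/
def act {S T : Type} [Fintype T] {M : Type*} [AddCommGroup M] [Module ℂ M]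
    (X : Matrix S T (Module.End ℂ M)) (f : T → M) : S → M :=
  fun s => ∑ t, X s t (f t)

end TensorSpaces

section BetheVector

variable {n : ℕ} {A : Type*} [Ring A] [Algebra ℂ A]
variable (B : ℂ → Matrix (Fin n) (Fin n) A) (ρ : ℂ) (m : ℕ → ℕ) (u : (k : ℕ) → Fin (m k) → ℂ)

/-- The standard basis of `W^{(d+1)}_{a^d} ⊗ ⋯ ⊗ W^{(2)}_{a^1}`: a label of level `b` carries
the space `V^{(b+1)}`. -/
abbrev WConf (n : ℕ) (m : ℕ → ℕ) (d : ℕ) : Type :=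
  Conf n (fun p : Lab m d => (p.1 : ℕ) + 1)

/-- The components of a basis vector at the labels of levels `1, …, d`. -/
def WConf.lower {m : ℕ → ℕ} {d : ℕ} (s : WConf n m (d + 1)) : WConf n m d :=
  fun p => s ⟨⟨p.1, Finset.Icc_subset_Icc_right (Nat.le_succ d) p.1.2⟩, p.2⟩

/-- The components of a basis vector at the labels of level `d + 1`. -/
def WConf.top {m : ℕ → ℕ} {d : ℕ} (s : WConf n m (d + 1)) (c : Fin (m (d + 1))) :
    Idx n (d + 2) :=
  s (lab (d + 1) ⟨by omega, le_rfl⟩ c)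

/-- The unique basis vector of the empty tensor product. -/
def WConf.empty (n : ℕ) (m : ℕ → ℕ) : WConf n m 0 :=
  fun p => absurd (Finset.mem_Icc.1 p.1.2) (by omega)

/-- An operator on `W^{(d+1)}_{a^d} ⊗ ⋯ ⊗ W^{(2)}_{a^1}`, extended by the identity on
`W^{(d+2)}_{a^{d+1}}`. -/
def extend {m : ℕ → ℕ} {d : ℕ} (X : Matrix (WConf n m d) (WConf n m d) A) :
    Matrix (WConf n m (d + 1)) (WConf n m (d + 1)) A :=
  Matrix.of fun s t => if s.top = t.top then X s.lower t.lower else 0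

/-- The normalised reduced `R`-matrix `R^{(k,b+1)}_{a p}(x) = x/(x-1) (I - x⁻¹ P)` on
`V^{(k)}_a ⊗ V^{(b+1)}_p`, for an auxiliary space `a` and a label `p` of level `b`,
as a matrix with respect to `a`: the `(i,j)` entry of `P = ∑ e_{ij} ⊗ e_{ji}` is `e_{ji}`. -/
def Raux {m : ℕ → ℕ} {d : ℕ} (k : ℕ) (p : Lab m d) (x : ℂ) :
    Matrix (Idx n k) (Idx n k) (Matrix (WConf n m d) (WConf n m d) A) :=
  (x / (x - 1)) • (1 - x⁻¹ • Matrix.of fun i j => siteElt p j.1 i.1 (1 : A))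

/-- `monodromy B ρ m u d v` is the level-`(d+1)` monodromy matrix
`D̂^{(d+1)}_{a a^{1…d}}(v; u^{(1…d)})`, as a matrix with respect to `V^{(d+1)}_a` whose entries
are operators on `W^{(d+1)}_{a^d} ⊗ ⋯ ⊗ W^{(2)}_{a^1}` with coefficients in `A`. -/
def monodromy : (d : ℕ) → ℂ →
    Matrix (Idx n (d + 1)) (Idx n (d + 1)) (Matrix (WConf n m d) (WConf n m d) A)
  | 0, v => Matrix.of fun i j => Matrix.diagonal fun _ => B v i.1 j.1
  | d + 1, v =>
    (List.ofFn fun c : Fin (m (d + 1)) =>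
        Raux (d + 2) (lab (d + 1) ⟨by omega, le_rfl⟩ c) (v + u (d + 1) c + ρ)).prod
      * (Matrix.of fun i j : Idx n (d + 2) => extend
          (monodromy d (v + 1 / 2) i.up j.up
            + if i = j then (2 * v + ρ)⁻¹ • monodromy d (v + 1 / 2) i.head i.head else 0))
      * (List.ofFn fun c : Fin (m (d + 1)) =>
        Raux (d + 2) (lab (d + 1) ⟨by omega, le_rfl⟩ c) (v - u (d + 1) c)).reverse.prod

/-- The level-`(d+1)` creation operator
`B̂^{(d+1)}_{a_1}(u_1) ⋯ B̂^{(d+1)}_{a_m}(u_m)`, a row vector with respect to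
`W^{(d+2)}_{a^{d+1}}`; here `B̂^{(d+1)}_a(u)` is the first row, without its first entry,
of the level-`(d+1)` monodromy matrix at `u + 1/2`. -/
def creation (d : ℕ) : Matrix (WConf n m d) (WConf n m (d + 1)) A :=
  Matrix.of fun s t =>
    (List.ofFn fun c : Fin (m (d + 1)) =>
      monodromy B ρ m u d (u (d + 1) c + 1 / 2) (t.top c).head (t.top c).up).prod s t.lower

/-- The vector `(e_{d+1})^{⊗ m_d} ⊗ ⋯ ⊗ (e_2)^{⊗ m_1} ⊗ η`; a label of level `b` carries
`e_{b+1}`, the first basis vector of `V^{(b+1)}`. -/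
def vacuum {M : Type*} [AddCommGroup M] (m : ℕ → ℕ) (η : M) (d : ℕ) : WConf n m d → M :=
  fun t => if ∀ p : Lab m d, ((t p).1 : ℕ) + 1 = (p.1 : ℕ) + 1 then η else 0

variable {M : Type*} [AddCommGroup M] [Module ℂ M]

/-- `betheLevel B ρ m u η j d` is `𝓑^{(d+1)} 𝓑^{(d+2)} ⋯ 𝓑^{(d+j)}` applied to the vacuum vector
`η^{(d+j+1)}`.  For `d + j + 1 = n` this is the level-`(d+1)` Bethe vector. -/
def betheLevel (B : ℂ → Matrix (Fin n) (Fin n) (Module.End ℂ M)) (ρ : ℂ) (m : ℕ → ℕ)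
    (u : (k : ℕ) → Fin (m k) → ℂ) (η : M) : ℕ → (d : ℕ) → WConf n m d → M
  | 0, d => vacuum m η d
  | j + 1, d => act (creation B ρ m u d) (betheLevel B ρ m u η j (d + 1))

/-- The level-`1` Bethe vector `Φ^{(1)}(u^{(1…n-1)})`. -/
def betheVector (B : ℂ → Matrix (Fin n) (Fin n) (Module.End ℂ M)) (ρ : ℂ) (m : ℕ → ℕ)
    (u : (k : ℕ) → Fin (m k) → ℂ) (η : M) : M :=
  betheLevel B ρ m u η (n - 1) 0 (WConf.empty n m)

end BetheVector

section TraceFormula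

variable {n : ℕ} {A : Type*} [Ring A] [Algebra ℂ A]

/-- The standard basis of `V̄ = (ℂⁿ)^{⊗ m̄}`, with one factor `ℂⁿ` for each label. -/
abbrev VConf (n : ℕ) (m : ℕ → ℕ) : Type := Conf n (fun _ : Lab m (n - 1) => 1)

variable {m : ℕ → ℕ}

/-- Yang's `R`-matrix `R^{(1)}_{pq}(x) = I - x⁻¹ P` on `ℂⁿ_p ⊗ ℂⁿ_q`. -/
def yangR (p q : Lab m (n - 1)) (x : ℂ) : Matrix (VConf n m) (VConf n m) A :=
  1 - x⁻¹ • ∑ i : Fin n, ∑ j : Fin n, siteElt p i j 1 * siteElt q j i 1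

/-- The normalised reduced `R`-matrix `R^{(k,l)}_{pq}(x) = x/(x-1) (I^{(k,l)} - x⁻¹ P^{(k,l)})`
as an operator on `ℂⁿ_p ⊗ ℂⁿ_q`, where
`I^{(k,l)} = ∑_{i ≥ k, j ≥ l} e_{ii} ⊗ e_{jj}` and
`P^{(k,l)} = ∑_{i,j ≥ max(k,l)} e_{ij} ⊗ e_{ji}`. -/
def reducedR (k l : ℕ) (p q : Lab m (n - 1)) (x : ℂ) : Matrix (VConf n m) (VConf n m) A :=
  (x / (x - 1)) •
    ((∑ i : Idx n k, ∑ j : Idx n l, siteElt p i.1 i.1 1 * siteElt q j.1 j.1 1)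
      - x⁻¹ • ∑ i : Idx n (max k l), ∑ j : Idx n (max k l),
          siteElt p i.1 j.1 1 * siteElt q j.1 i.1 1)

variable (B : ℂ → Matrix (Fin n) (Fin n) A) (ρ : ℂ)

/-- The matrix
`D̂^{(i)}(v) = D^{(i)}(v + (i-1)/2) + (2v+ρ)⁻¹ ∑_{l < i} b_{ll}(v + (i-1)/2) I^{(i)}`,
where `D^{(i)}` is the submatrix of `B` with rows and columns `i, …, n`. -/
def Dhat (i : ℕ) (v : ℂ) : Matrix (Idx n i) (Idx n i) A :=
  Matrix.of fun c d => B (v + ((i : ℂ) - 1) / 2) c.1 d.1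
    + if c = d then
        (2 * v + ρ)⁻¹ • ∑ l : {l : Fin n // (l : ℕ) + 1 < i}, B (v + ((i : ℂ) - 1) / 2) l.1 l.1
      else 0

/-- `D̃^{(i)}_p(v) = ∑_{c,d=i}^n e_{cd} ⊗ [D̂^{(i)}(v)]_{cd}`, with `e_{cd}` acting in `ℂⁿ_p`. -/
def Dtilde (i : ℕ) (p : Lab m (n - 1)) (v : ℂ) : Matrix (VConf n m) (VConf n m) A :=
  ∑ c : Idx n i, ∑ d : Idx n i, siteElt p c.1 d.1 (Dhat B ρ i v c d)

/-- The factor of the ordered product that belongs to the label `a^i_j`, `1 ≤ i ≤ n-1`.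
An element `b : Fin (i-1)` stands for the level `b + 1`. -/
def traceFactor (m : ℕ → ℕ) (u : (k : ℕ) → Fin (m k) → ℂ) (i : ℕ) (hi : 1 ≤ i ∧ i ≤ n - 1) (j : Fin (m i)) :
    Matrix (VConf n m) (VConf n m) A :=
  (List.ofFn fun k : Fin j =>
      yangR (lab i hi j) (lab i hi (k.castLE j.2.le))
        (u i j + u i (k.castLE j.2.le) + ρ + 1)).prod
    * (List.ofFn fun b : Fin (i - 1) => (List.ofFn fun c : Fin (m (b + 1)) =>
        reducedR i (b + 1 + 1) (lab i hi j) (lab (b + 1) (by omega) c)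
          (u i j + u (b + 1) c + ρ + ((i : ℂ) - ((b + 1 : ℕ) : ℂ)) / 2)).prod).reverse.prod
    * Dtilde B ρ i (lab i hi j) (u i j + 1 / 2)
    * (List.ofFn fun b : Fin (i - 1) => (List.ofFn fun c : Fin (m (b + 1)) =>
        reducedR i (b + 1 + 1) (lab i hi j) (lab (b + 1) (by omega) c)
          (u i j - u (b + 1) c + ((i : ℂ) - ((b + 1 : ℕ) : ℂ)) / 2)).reverse.prod).prod

/-- The operator under the trace: the product of the factors of the labels `a^i_j`, ordered by
`i = 1, …, n-1` and then by `j = 1, …, m_i`, times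
`(e_{n,n-1})^{⊗ m_{n-1}} ⊗ ⋯ ⊗ (e_{21})^{⊗ m_1}`. -/
def traceOperator (m : ℕ → ℕ) (u : (k : ℕ) → Fin (m k) → ℂ) :
    Matrix (VConf n m) (VConf n m) A :=
  (List.ofFn fun i : Fin (n - 1) => (List.ofFn fun j : Fin (m (i + 1)) =>
      traceFactor B ρ m u (i + 1) (by omega) j).prod).prod
    * tensorOp fun p : Lab m (n - 1) => lowering n p.1

end TraceFormula

section QuantumSpace

variable (n : ℕ) {ℓ : ℕ} (L : Fin ℓ → Type*) [∀ s, AddCommGroup (L s)] [∀ s, Module ℂ (L s)]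
  [∀ s, LieRingModule (Matrix (Fin n) (Fin n) ℂ) (L s)]
  [∀ s, LieModule ℂ (Matrix (Fin n) (Fin n) ℂ) (L s)]

/-- The action of `X ∈ 𝔤𝔩_n` in the `s`-th factor of `L_1 ⊗ ⋯ ⊗ L_ℓ`. -/
def siteAction (s : Fin ℓ) (X : Matrix (Fin n) (Fin n) ℂ) : Module.End ℂ (⨂[ℂ] s, L s) :=
  PiTensorProduct.map (Function.update (fun _ => LinearMap.id) s
    (LieModule.toEnd ℂ (Matrix (Fin n) (Fin n) ℂ) (L s) X))

/-- The generating matrix of the Yangian `Y(𝔤𝔩_n)` in the `s`-th factor, through the evaluation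
map `t_{ij}(w) ↦ δ_{ij} - E_{ji} (w - c_s)⁻¹`. -/
def siteT (c : Fin ℓ → ℂ) (s : Fin ℓ) (w : ℂ) :
    Matrix (Fin n) (Fin n) (Module.End ℂ (⨂[ℂ] s, L s)) :=
  1 - (w - c s)⁻¹ • Matrix.of fun i j => siteAction n L s (Matrix.single j i 1)

/-- The action of the generating matrix `T°(w)` of `Y(𝔤𝔩_n)` on `L_1 ⊗ ⋯ ⊗ L_ℓ`, through the
coproduct `t_{ij}(w) ↦ ∑_k t_{ik}(w) ⊗ t_{kj}(w)`. -/
def bulkT (c : Fin ℓ → ℂ) (w : ℂ) : Matrix (Fin n) (Fin n) (Module.End ℂ (⨂[ℂ] s, L s)) :=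
  (List.ofFn fun s => siteT n L c s w).prod

/-- The diagonal entries of `K°(v) = G° - a/(v + ρ/2) I`, `G° = ∑_{i>r} e_{ii} - ∑_{i≤r} e_{ii}`,
which defines the one-dimensional module `V(μ°)`. -/
def boundaryK {n : ℕ} (r : ℕ) (ρ a v : ℂ) (i : Fin n) : ℂ :=
  (if (i : ℕ) + 1 ≤ r then -1 else 1) - a / (v + ρ / 2)

/-- The action of the generating matrix `B°(v)` on `M° = L_1 ⊗ ⋯ ⊗ L_ℓ ⊗ V(μ°)`, which is
identified with `L_1 ⊗ ⋯ ⊗ L_ℓ`: it is `T°(v) K°(v) T°(-v-ρ)⁻¹`. -/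
def chainB (c : Fin ℓ → ℂ) (r : ℕ) (ρ a v : ℂ) :
    Matrix (Fin n) (Fin n) (Module.End ℂ (⨂[ℂ] s, L s)) :=
  bulkT n L c v * Matrix.diagonal (fun i => algebraMap ℂ _ (boundaryK r ρ a v i))
    * Ring.inverse (bulkT n L c (-v - ρ))

/-- The rational function `B°` has a value at `v`: none of the denominators of
`T°(v)`, `K°(v)`, `T°(-v-ρ)` vanishes and `T°(-v-ρ)` is invertible. -/
structure Regular (c : Fin ℓ → ℂ) (ρ v : ℂ) : Prop where
  bulk : ∀ s, v ≠ c s ∧ -v - ρ ≠ c s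
  boundary : v + ρ / 2 ≠ 0
  inverse : IsUnit (bulkT n L c (-v - ρ))

/-- A lowest vector of `M°`: a nonzero vector that is annihilated by the entries of `B°(v)` below
the diagonal and is an eigenvector of the diagonal entries. -/
structure IsLowestVector (c : Fin ℓ → ℂ) (r : ℕ) (ρ a : ℂ) (η : ⨂[ℂ] s, L s) : Prop where
  ne_zero : η ≠ 0
  annihilated : ∀ v, Regular n L c ρ v → ∀ i j : Fin n, j < i →
    chainB n L c r ρ a v i j η = 0
  eigen : ∃ μ : Fin n → ℂ → ℂ, ∀ v, Regular n L c ρ v → ∀ i : Fin n,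
    chainB n L c r ρ a v i i η = μ i v • η

/-- The parameters avoid the zeros of the denominators in the definition of the Bethe vector and
in the trace formula. -/
structure Generic (c : Fin ℓ → ℂ) (ρ : ℂ) (m : ℕ → ℕ) (u : (k : ℕ) → Fin (m k) → ℂ) :
    Prop where
  regular : ∀ i, 1 ≤ i → i ≤ n - 1 → ∀ j : Fin (m i), Regular n L c ρ (u i j + i / 2)
  shift : ∀ i, 1 ≤ i → i ≤ n - 1 → ∀ j : Fin (m i), ∀ q : ℕ, 1 ≤ q → q < i →
    2 * u i j + q + ρ ≠ 0
  plus : ∀ i b, 1 ≤ b → b < i → i ≤ n - 1 → ∀ (j : Fin (m i)) (e : Fin (m b)),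
    u i j + u b e + ρ + ((i : ℂ) - b) / 2 ≠ 0 ∧ u i j + u b e + ρ + ((i : ℂ) - b) / 2 ≠ 1
  minus : ∀ i b, 1 ≤ b → b < i → i ≤ n - 1 → ∀ (j : Fin (m i)) (e : Fin (m b)),
    u i j - u b e + ((i : ℂ) - b) / 2 ≠ 0 ∧ u i j - u b e + ((i : ℂ) - b) / 2 ≠ 1
  same : ∀ i, 1 ≤ i → i ≤ n - 1 → ∀ j k : Fin (m i), k < j → u i j + u i k + ρ + 1 ≠ 0

end QuantumSpace

end OpenChain

end

/-! The trace against the product of the matrix units e_{b+1,b} is a single matrix element: the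
ordered product acts on the vacuum, which has e_{b+1} at every label of level b, and the component
with e_b at every label of level b is read off (`trace_mul_lowering`). The Bethe vector is also made
from the vacuum, by creation operators that are first rows of the nested monodromy matrices. The two
agree level by level once the recursion for these matrices has been solved.

The recursion collapses on vectors whose labels of the levels below d are in the vacuum state
(`zext_monodromy`): there the level-(d+1) monodromy matrix is `Dhat`, times an explicit scalar,
dressed by the R-matrices of level d alone. The reason is `dressed_vacuum`. Let h be the first
index. If D_{xh} kills the vector for all x ≠ h, then dressing D by R-matrices at vacuum sites
replaces D_{ij}, for i, j ≠ h, by βD_{ij} + δ_{ij}(β-1)t⁻¹D_{hh} with t = 2v+ρ. The summand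
δ_{ij}t⁻¹D_{hh} in the recursion completes this to β(D_{ij} + δ_{ij}t⁻¹D_{hh}), which is β times the
next `Dhat`.

The vanishing of D_{xh} is needed not only on η but on every vector that the inner levels produce.
Let N_d be the common kernel, over all regular v and all κ ≤ d, of the entries of B(v) in rows ≥ κ
and columns < κ (indices from 0). The reflection equation shows that entries of B with both indices
on the same side of κ preserve the κ-th kernel (`reflection_blockKer`), so the entries used at level
d+1 preserve N_d. The argument divides by u-v, by y = u+v+ρ and by 1-κ/y; the excluded points are
recovered by continuity of B, as the quantum space is finite-dimensional. The reflection equation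
itself is Sklyanin's: RTT for T and a diagonal solution K.

On the trace side, consider the factor of a label p of level d+1. Its reduced R-matrices with the
levels below d act by scalars, since those labels are in the vacuum state; those with level d are
the dressing of the monodromy matrix, with p as auxiliary space (`realizes_coreOp`). The scalars are
exactly those of the collapsed recursion. Reading off e_{d+1} at p selects the first row, that is, a
creation operator; the Yang R-matrices inside level d+1 drop out of this component
(`slice_factorOp`). Factors still to be applied do not touch labels already read off, so the reading
can be done label by label.

To compare operators on different reduced tensor products, everything is transported to M-valued
functions of configurations of all labels, through extension by zero. -/

noncomputable section

set_option linter.unusedSectionVars false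

namespace OpenChain

/-! ### RTT and reflection equations for matrices over a noncommutative algebra -/

section Reflection

variable {N : Type*} [Fintype N] [DecidableEq N] {A : Type*} [Ring A] [Algebra ℂ A]

/-- The embedding of a matrix into the first factor of a twofold tensor product. -/
def leg₁ (X : Matrix N N A) : Matrix (N × N) (N × N) A :=
  Matrix.of fun p q => if p.2 = q.2 then X p.1 q.1 else 0

/-- The embedding of a matrix into the second factor of a twofold tensor product. -/
def leg₂ (X : Matrix N N A) : Matrix (N × N) (N × N) A :=
  Matrix.of fun p q => if p.1 = q.1 then X p.2 q.2 else 0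

/-- The flip operator on a twofold tensor product. -/
def flip (N A : Type*) [DecidableEq N] [Ring A] : Matrix (N × N) (N × N) A :=
  Matrix.of fun p q => if p.1 = q.2 ∧ p.2 = q.1 then 1 else 0

/-- Yang's `R`-matrix `1 - x⁻¹ P`. -/
def yang (N A : Type*) [DecidableEq N] [Ring A] [Algebra ℂ A] (x : ℂ) :
    Matrix (N × N) (N × N) A :=
  1 - x⁻¹ • flip N A

theorem leg₁_mul (X Y : Matrix N N A) : leg₁ (X * Y) = leg₁ X * leg₁ Y := by
  ext ⟨i, k⟩ ⟨j, l⟩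
  simp only [leg₁, Matrix.mul_apply, Matrix.of_apply, Fintype.sum_prod_type]
  simp

theorem leg₂_mul (X Y : Matrix N N A) : leg₂ (X * Y) = leg₂ X * leg₂ Y := by
  ext ⟨i, k⟩ ⟨j, l⟩
  simp only [leg₂, Matrix.mul_apply, Matrix.of_apply, Fintype.sum_prod_type_right]
  simp

theorem leg₁_one : leg₁ (1 : Matrix N N A) = 1 := by
  ext ⟨i, k⟩ ⟨j, l⟩
  simp only [leg₁, Matrix.one_apply, Matrix.of_apply, Prod.mk.injEq]
  split_ifs <;> simp_all

theorem leg₂_one : leg₂ (1 : Matrix N N A) = 1 := by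
  ext ⟨i, k⟩ ⟨j, l⟩
  simp only [leg₂, Matrix.one_apply, Matrix.of_apply, Prod.mk.injEq]
  split_ifs <;> simp_all

theorem flip_mul_apply (Z : Matrix (N × N) (N × N) A) (i k : N) (q : N × N) :
    (flip N A * Z) (i, k) q = Z (k, i) q := by
  simp only [flip, Matrix.mul_apply, Matrix.of_apply, Fintype.sum_prod_type]
  rw [Finset.sum_eq_single k, Finset.sum_eq_single i] <;> simp +contextual [eq_comm]

theorem mul_flip_apply (Z : Matrix (N × N) (N × N) A) (p : N × N) (j l : N) :
    (Z * flip N A) p (j, l) = Z p (l, j) := by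
  simp only [flip, Matrix.mul_apply, Matrix.of_apply, Fintype.sum_prod_type]
  rw [Finset.sum_eq_single l, Finset.sum_eq_single j] <;> simp +contextual [eq_comm]

theorem leg₁_mul_leg₂_apply (X Y : Matrix N N A) (i k j l : N) :
    (leg₁ X * leg₂ Y) (i, k) (j, l) = X i j * Y k l := by
  simp only [leg₁, leg₂, Matrix.mul_apply, Matrix.of_apply, Fintype.sum_prod_type]
  rw [Finset.sum_eq_single j, Finset.sum_eq_single k] <;> simp +contextual [eq_comm]

theorem leg₂_mul_leg₁_apply (X Y : Matrix N N A) (i k j l : N) :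
    (leg₂ Y * leg₁ X) (i, k) (j, l) = Y k l * X i j := by
  simp only [leg₁, leg₂, Matrix.mul_apply, Matrix.of_apply, Fintype.sum_prod_type]
  rw [Finset.sum_eq_single i, Finset.sum_eq_single l] <;> simp +contextual [eq_comm]

theorem flip_mul_leg₁ (X : Matrix N N A) : flip N A * leg₁ X = leg₂ X * flip N A := by
  ext ⟨i, k⟩ ⟨j, l⟩
  rw [flip_mul_apply, mul_flip_apply]; rfl

theorem flip_mul_leg₂ (X : Matrix N N A) : flip N A * leg₂ X = leg₁ X * flip N A := by
  ext ⟨i, k⟩ ⟨j, l⟩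
  rw [flip_mul_apply, mul_flip_apply]; rfl

theorem flip_mul_flip : flip N A * flip N A = 1 := by
  ext ⟨i, k⟩ ⟨j, l⟩
  rw [flip_mul_apply]
  simp only [flip, Matrix.of_apply, Matrix.one_apply, Prod.mk.injEq, and_comm]

theorem commute_flip_yang (x : ℂ) : Commute (flip N A) (yang N A x) :=
  (Commute.one_right _).sub_right ((Commute.refl _).smul_right _)

/-- The `RTT`-relation. -/
def RTT (x : ℂ) (T S : Matrix N N A) : Prop :=
  yang N A x * (leg₁ T * leg₂ S) = leg₂ S * leg₁ T * yang N A x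

/-- Conjugation by the flip swaps the two legs and fixes the R-matrix. -/
theorem RTT.flip {x : ℂ} {T S : Matrix N N A} (h : RTT x T S) :
    yang N A x * (leg₂ T * leg₁ S) = leg₁ S * leg₂ T * yang N A x := by
  have h' : OpenChain.flip N A * (yang N A x * (leg₁ T * leg₂ S)) * OpenChain.flip N A
    = OpenChain.flip N A * (leg₂ S * leg₁ T * yang N A x) * OpenChain.flip N A := by rw [h]
  have e : ∀ Z : Matrix (N × N) (N × N) A, Z * OpenChain.flip N A * OpenChain.flip N A = Z := by
    intro Z; rw [mul_assoc, flip_mul_flip, mul_one]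
  have h1 : OpenChain.flip N A * (yang N A x * (leg₁ T * leg₂ S)) * OpenChain.flip N A
      = yang N A x * (leg₂ T * leg₁ S) := by
    rw [← mul_assoc, (commute_flip_yang x).eq, mul_assoc (yang N A x), ← mul_assoc _ (leg₁ T),
      flip_mul_leg₁, mul_assoc (leg₂ T), flip_mul_leg₂, ← mul_assoc (leg₂ T), ← mul_assoc (yang N A x),
      e]
  have h2 : OpenChain.flip N A * (leg₂ S * leg₁ T * yang N A x) * OpenChain.flip N A
      = leg₁ S * leg₂ T * yang N A x := by
    rw [← mul_assoc, ← mul_assoc, flip_mul_leg₂, mul_assoc (leg₁ S), flip_mul_leg₁,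
      mul_assoc, mul_assoc, ← (commute_flip_yang x).eq, ← mul_assoc _ _ (yang N A x), ← mul_assoc]
    congr 1
    simp only [mul_assoc, flip_mul_flip, mul_one]
  rw [← h1, ← h2, h']

theorem RTT.one (x : ℂ) : RTT x (1 : Matrix N N A) 1 := by
  simp [RTT, leg₁_one, leg₂_one]

theorem commute_legs {X Y : Matrix N N A} (h : ∀ i j k l, Commute (X i j) (Y k l)) :
    leg₁ X * leg₂ Y = leg₂ Y * leg₁ X := by
  ext ⟨i, k⟩ ⟨j, l⟩
  rw [leg₁_mul_leg₂_apply, leg₂_mul_leg₁_apply, (h i j k l).eq]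

/-- The coproduct argument: as the entries from different sites commute, the R-matrix can be carried
through one site after the other. -/
theorem RTT.mul {x : ℂ} {T S T' S' : Matrix N N A} (h : RTT x T S) (h' : RTT x T' S')
    (h₁ : ∀ i j k l, Commute (T' i j) (S k l)) (h₂ : ∀ i j k l, Commute (T i j) (S' k l)) :
    RTT x (T * T') (S * S') := by
  have e₁ := commute_legs h₁
  have e₂ := commute_legs h₂
  unfold RTT at *
  rw [leg₁_mul, leg₂_mul]
  calc yang N A x * (leg₁ T * leg₁ T' * (leg₂ S * leg₂ S'))
      = yang N A x * (leg₁ T * (leg₁ T' * leg₂ S) * leg₂ S') := by noncomm_ring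
    _ = yang N A x * (leg₁ T * leg₂ S) * (leg₁ T' * leg₂ S') := by rw [e₁]; noncomm_ring
    _ = leg₂ S * leg₁ T * (yang N A x * (leg₁ T' * leg₂ S')) := by rw [h]; noncomm_ring
    _ = leg₂ S * (leg₁ T * leg₂ S') * leg₁ T' * yang N A x := by rw [h']; noncomm_ring
    _ = leg₂ S * leg₂ S' * (leg₁ T * leg₁ T') * yang N A x := by rw [e₂]; noncomm_ring

/-- The reflection equation, for the values `X` and `Y` of a matrix at two points with
difference `x` and shifted sum `y`. -/
def ReflectionEq (x y : ℂ) (X Y : Matrix N N A) : Prop :=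
  yang N A x * leg₁ X * yang N A y * leg₂ Y = leg₂ Y * yang N A y * leg₁ X * yang N A x

theorem reflectionEq_left (x y : ℂ) (X Y : Matrix N N A) :
    yang N A x * leg₁ X * yang N A y * leg₂ Y
      = leg₁ X * leg₂ Y - y⁻¹ • (flip N A * leg₂ (X * Y)) - x⁻¹ • (flip N A * (leg₁ X * leg₂ Y))
        + (x⁻¹ * y⁻¹) • leg₂ (X * Y) := by
  have e1 : leg₁ X * flip N A = flip N A * leg₂ X := (flip_mul_leg₂ X).symm
  have e2 : leg₁ X * flip N A * leg₂ Y = flip N A * leg₂ (X * Y) := by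
    rw [e1, leg₂_mul, mul_assoc]
  have e3 : flip N A * leg₁ X * flip N A * leg₂ Y = leg₂ (X * Y) := by
    rw [mul_assoc, mul_assoc, ← mul_assoc (leg₁ X), e2, ← mul_assoc, flip_mul_flip, one_mul]
  simp only [yang, sub_mul, mul_sub, one_mul, mul_one, smul_mul_assoc, mul_smul_comm, e2, e3,
    smul_sub, smul_smul]
  rw [mul_assoc (flip N A), mul_comm y⁻¹]
  abel

theorem reflectionEq_right (x y : ℂ) (X Y : Matrix N N A) :
    leg₂ Y * yang N A y * leg₁ X * yang N A x
      = leg₂ Y * leg₁ X - y⁻¹ • (leg₂ (Y * X) * flip N A) - x⁻¹ • (leg₂ Y * leg₁ X * flip N A)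
        + (x⁻¹ * y⁻¹) • leg₂ (Y * X) := by
  have e2 : leg₂ Y * flip N A * leg₁ X = leg₂ (Y * X) * flip N A := by
    rw [mul_assoc, flip_mul_leg₁, leg₂_mul, mul_assoc]
  have e3 : leg₂ (Y * X) * flip N A * flip N A = leg₂ (Y * X) := by
    rw [mul_assoc, flip_mul_flip, mul_one]
  simp only [yang, sub_mul, mul_sub, mul_one, smul_mul_assoc, mul_smul_comm, e2, e3,
    smul_sub, smul_smul]
  abel

/-- The entrywise form serves twice: to verify the boundary solution, and to evaluate the equation
on vectors killed by some of the entries. -/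
theorem reflectionEq_iff (x y : ℂ) (X Y : Matrix N N A) :
    ReflectionEq x y X Y ↔ ∀ i j k l : N,
    X i j * Y k l - y⁻¹ • (if k = j then (X * Y) i l else 0) - x⁻¹ • (X k j * Y i l)
        + (x⁻¹ * y⁻¹) • (if i = j then (X * Y) k l else 0)
      = Y k l * X i j - y⁻¹ • (if i = l then (Y * X) k j else 0) - x⁻¹ • (Y k j * X i l)
        + (x⁻¹ * y⁻¹) • (if i = j then (Y * X) k l else 0) := by
  have h : ReflectionEq x y X Y ↔ ∀ i j k l : N,
      (yang N A x * leg₁ X * yang N A y * leg₂ Y) (i, k) (j, l)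
        = (leg₂ Y * yang N A y * leg₁ X * yang N A x) (i, k) (j, l) := by
    constructor
    · intro h i j k l
      exact congrFun (congrFun h _) _
    · intro h
      ext ⟨i, k⟩ ⟨j, l⟩
      exact h i j k l
  rw [h]
  simp only [reflectionEq_left, reflectionEq_right, Matrix.add_apply, Matrix.sub_apply,
    Matrix.smul_apply, flip_mul_apply, mul_flip_apply, leg₁_mul_leg₂_apply, leg₂_mul_leg₁_apply]
  rfl

/-- Sklyanin's construction of solutions of the reflection equation. -/
theorem ReflectionEq.dress {x y : ℂ} {T S T' S' T'' S'' K L : Matrix N N A}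
    (h₁ : RTT x T S) (h₂ : RTT y S T') (h₃ : RTT y T S') (h₄ : RTT x S' T')
    (hT : T' * T'' = 1 ∧ T'' * T' = 1) (hS : S' * S'' = 1 ∧ S'' * S' = 1)
    (hKS : ∀ (Z : Matrix N N A) i j k l, Commute (K i j) (Z k l))
    (hLT : ∀ (Z : Matrix N N A) i j k l, Commute (Z i j) (L k l))
    (h : ReflectionEq x y K L) :
    ReflectionEq x y (T * K * T'') (S * L * S'') := by
  have a1 : leg₁ T' * leg₁ T'' = 1 := by rw [← leg₁_mul, hT.1, leg₁_one]
  have a2 : leg₁ T'' * leg₁ T' = 1 := by rw [← leg₁_mul, hT.2, leg₁_one]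
  have b1 : leg₂ S' * leg₂ S'' = 1 := by rw [← leg₂_mul, hS.1, leg₂_one]
  have b2 : leg₂ S'' * leg₂ S' = 1 := by rw [← leg₂_mul, hS.2, leg₂_one]
  -- The three exchange relations for the inverses `T''`, `S''` come from RTT for `T'`, `S'`,
  -- multiplied by the inverse on both sides.
  have r2 : leg₁ T'' * yang N A y * leg₂ S = leg₂ S * yang N A y * leg₁ T'' := by
    calc leg₁ T'' * yang N A y * leg₂ S
        = leg₁ T'' * (yang N A y * (leg₂ S * leg₁ T')) * leg₁ T'' := by
          simp only [mul_assoc, a1, mul_one]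
      _ = leg₁ T'' * leg₁ T' * leg₂ S * yang N A y * leg₁ T'' := by
          rw [h₂.flip]; noncomm_ring
      _ = _ := by rw [a2, one_mul]
  have r3 : leg₂ S'' * yang N A y * leg₁ T = leg₁ T * yang N A y * leg₂ S'' := by
    calc leg₂ S'' * yang N A y * leg₁ T
        = leg₂ S'' * (yang N A y * (leg₁ T * leg₂ S')) * leg₂ S'' := by
          simp only [mul_assoc, b1, mul_one]
      _ = leg₂ S'' * leg₂ S' * leg₁ T * yang N A y * leg₂ S'' := by
          rw [h₃]; noncomm_ring
      _ = _ := by rw [b2, one_mul]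
  have r4 : yang N A x * (leg₁ T'' * leg₂ S'') = leg₂ S'' * leg₁ T'' * yang N A x := by
    calc yang N A x * (leg₁ T'' * leg₂ S'')
        = leg₂ S'' * (leg₁ T'' * leg₁ T') * leg₂ S' * yang N A x * (leg₁ T'' * leg₂ S'') := by
          rw [a2, mul_one, b2, one_mul]
      _ = leg₂ S'' * leg₁ T'' * (leg₁ T' * leg₂ S' * yang N A x) * (leg₁ T'' * leg₂ S'') := by
          noncomm_ring
      _ = leg₂ S'' * leg₁ T'' * yang N A x * leg₂ S' * (leg₁ T' * leg₁ T'') * leg₂ S'' := by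
          rw [← h₄.flip]; noncomm_ring
      _ = _ := by rw [a1, mul_one, mul_assoc _ (leg₂ S'), b1, mul_one]
  have k1 := fun Z => commute_legs (hKS Z)
  have k2 := fun Z => commute_legs (hLT Z)
  unfold ReflectionEq RTT at *
  simp only [leg₁_mul, leg₂_mul]
  calc yang N A x * (leg₁ T * leg₁ K * leg₁ T'') * yang N A y * (leg₂ S * leg₂ L * leg₂ S'')
      = yang N A x * leg₁ T * leg₁ K * (leg₁ T'' * yang N A y * leg₂ S) * leg₂ L * leg₂ S'' := by
        noncomm_ring
    _ = yang N A x * leg₁ T * (leg₁ K * leg₂ S) * yang N A y * (leg₁ T'' * leg₂ L) * leg₂ S'' := by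
        rw [r2]; noncomm_ring
    _ = (yang N A x * (leg₁ T * leg₂ S)) * leg₁ K * yang N A y * leg₂ L * leg₁ T'' * leg₂ S'' := by
        rw [k1, k2]; noncomm_ring
    _ = leg₂ S * leg₁ T * (yang N A x * leg₁ K * yang N A y * leg₂ L) * leg₁ T'' * leg₂ S'' := by
        rw [h₁]; noncomm_ring
    _ = leg₂ S * leg₁ T * leg₂ L * yang N A y * leg₁ K * (yang N A x * (leg₁ T'' * leg₂ S'')) := by
        rw [h]; noncomm_ring
    _ = leg₂ S * (leg₁ T * leg₂ L) * yang N A y * (leg₁ K * leg₂ S'') * leg₁ T'' * yang N A x := by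
        rw [r4]; noncomm_ring
    _ = leg₂ S * leg₂ L * (leg₁ T * yang N A y * leg₂ S'') * leg₁ K * leg₁ T'' * yang N A x := by
        rw [k1, k2]; noncomm_ring
    _ = _ := by rw [← r3]; noncomm_ring

end Reflection

/-! ### The reflection equation for the bulk and the boundary of the chain -/

section Chain

variable (n : ℕ) {ℓ : ℕ} (L : Fin ℓ → Type*) [∀ s, AddCommGroup (L s)] [∀ s, Module ℂ (L s)]
  [∀ s, LieRingModule (Matrix (Fin n) (Fin n) ℂ) (L s)]
  [∀ s, LieModule ℂ (Matrix (Fin n) (Fin n) ℂ) (L s)]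

theorem siteAction_mul (s : Fin ℓ) (X Y : Matrix (Fin n) (Fin n) ℂ) :
    siteAction n L s X * siteAction n L s Y
      = PiTensorProduct.map (Function.update (fun _ => LinearMap.id) s
        (LieModule.toEnd ℂ (Matrix (Fin n) (Fin n) ℂ) (L s) X
          * LieModule.toEnd ℂ (Matrix (Fin n) (Fin n) ℂ) (L s) Y)) := by
  rw [siteAction, siteAction, ← PiTensorProduct.map_mul]
  congr 1
  funext t
  rcases eq_or_ne t s with rfl | h
  · simp
  · simp only [Function.update_of_ne h]; rfl

theorem siteAction_lie (s : Fin ℓ) (X Y : Matrix (Fin n) (Fin n) ℂ) :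
    siteAction n L s X * siteAction n L s Y - siteAction n L s Y * siteAction n L s X
      = siteAction n L s (X * Y) - siteAction n L s (Y * X) := by
  have hl : ∀ f g : Module.End ℂ (L s),
      PiTensorProduct.map (R := ℂ) (Function.update (fun i => (LinearMap.id : L i →ₗ[ℂ] L i)) s (f - g))
        = PiTensorProduct.map (R := ℂ) (Function.update (fun i => (LinearMap.id : L i →ₗ[ℂ] L i)) s f)
          - PiTensorProduct.map (R := ℂ)
            (Function.update (fun i => (LinearMap.id : L i →ₗ[ℂ] L i)) s g) := by
    intro f g
    rw [eq_sub_iff_add_eq, ← PiTensorProduct.map_update_add, sub_add_cancel]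
  rw [siteAction_mul, siteAction_mul, ← hl]
  unfold siteAction
  rw [← hl, ← map_sub]
  congr 2
  rw [← Ring.lie_def, ← LieHom.map_lie, Ring.lie_def]

theorem siteAction_commute {s t : Fin ℓ} (h : s ≠ t) (X Y : Matrix (Fin n) (Fin n) ℂ) :
    Commute (siteAction n L s X) (siteAction n L t Y) := by
  rw [Commute, SemiconjBy, siteAction, siteAction, ← PiTensorProduct.map_mul,
    ← PiTensorProduct.map_mul]
  congr 1
  funext r
  rcases eq_or_ne r s with rfl | hs
  · simp only [Function.update_self, Function.update_of_ne h]; rfl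
  · rcases eq_or_ne r t with rfl | ht
    · simp only [Function.update_self, Function.update_of_ne hs]; rfl
    · simp only [Function.update_of_ne hs, Function.update_of_ne ht]

theorem siteAction_zero (s : Fin ℓ) : siteAction n L s 0 = 0 := by
  have := siteAction_mul n L s 0 0
  have h := PiTensorProduct.map_update_smul (R := ℂ) (fun i => (LinearMap.id : L i →ₗ[ℂ] L i)) s
    (0 : ℂ) (LieModule.toEnd ℂ (Matrix (Fin n) (Fin n) ℂ) (L s) 0)
  rw [zero_smul, zero_smul] at h
  rw [siteAction, ← h, map_zero]

/-- Evaluation representation of the Yangian: the relation reduces to the commutator of two matrix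
units and one partial fraction identity. -/
theorem siteT_rtt (c : Fin ℓ → ℂ) (s : Fin ℓ) {u v : ℂ} (hu : u ≠ c s) (hv : v ≠ c s)
    (huv : u ≠ v) : RTT (u - v) (siteT n L c s u) (siteT n L c s v) := by
  have hu' : u - c s ≠ 0 := sub_ne_zero.2 hu
  have hv' : v - c s ≠ 0 := sub_ne_zero.2 hv
  have huv' : u - v ≠ 0 := sub_ne_zero.2 huv
  unfold RTT
  ext1 ⟨i, k⟩ ⟨j, l⟩
  simp only [yang, sub_mul, mul_sub, one_mul, mul_one, smul_mul_assoc, mul_smul_comm,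
    Matrix.sub_apply, Matrix.smul_apply, flip_mul_apply, mul_flip_apply,
    leg₁_mul_leg₂_apply, leg₂_mul_leg₁_apply]
  simp only [siteT, Matrix.sub_apply, Matrix.smul_apply, Matrix.of_apply, sub_mul, mul_sub,
    smul_mul_assoc, mul_smul_comm]
  have key := siteAction_lie n L s (Matrix.single j i 1) (Matrix.single l k 1)
  have hδ : ∀ a b c' d : Fin n, siteAction n L s (Matrix.single a b 1 * Matrix.single c' d 1)
      = (if b = c' then (1 : ℂ) else 0) • siteAction n L s (Matrix.single a d 1) := by
    intro a b c' d
    split_ifs with h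
    · subst h; simp
    · simp [h, siteAction_zero]
  have h1 : ∀ a b : Fin n, (1 : Matrix (Fin n) (Fin n) (Module.End ℂ (⨂[ℂ] s, L s))) a b
      = (if a = b then (1 : ℂ) else 0) • (1 : Module.End ℂ (⨂[ℂ] s, L s)) := by
    intro a b
    rw [Matrix.one_apply]; split_ifs <;> simp
  rw [hδ, hδ] at key
  simp only [h1, smul_mul_assoc, mul_smul_comm, one_mul, mul_one]
  have e2 : (u - v)⁻¹ * ((v - c s)⁻¹ - (u - c s)⁻¹) = (u - c s)⁻¹ * (v - c s)⁻¹ := by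
    field_simp; ring
  generalize (u - v)⁻¹ = γ at *
  -- From here on only the commutator `key` and the partial fraction `e2` are remembered, and the
  -- claim is linear in them.
  generalize (u - c s)⁻¹ = α at *
  generalize (v - c s)⁻¹ = β at *
  generalize siteAction n L s (Matrix.single j i 1) = x at *
  generalize siteAction n L s (Matrix.single l k 1) = y at *
  generalize siteAction n L s (Matrix.single l i 1) = z at *
  generalize siteAction n L s (Matrix.single j k 1) = w at *
  generalize (if i = j then (1 : ℂ) else 0) = d1 at *
  generalize (if k = l then (1 : ℂ) else 0) = d2 at *
  generalize (if i = l then (1 : ℂ) else 0) = d3 at *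
  simp only [eq_comm (a := k) (b := j)] at *
  generalize (if j = k then (1 : ℂ) else 0) = d4 at *
  linear_combination (norm := module) (α * β) • key - e2 • (d3 • w - d4 • z)

theorem siteT_commute (c : Fin ℓ → ℂ) {s t : Fin ℓ} (h : s ≠ t) (u v : ℂ) (i j k l : Fin n) :
    Commute (siteT n L c s u i j) (siteT n L c t v k l) := by
  have hc : ∀ (A : Type _) [Ring A] [Algebra ℂ A] (a b : A) (x y : Fin n) , Commute a b →
      Commute ((1 : Matrix (Fin n) (Fin n) A) x y) b := by
    intro A _ _ a b x y _
    rw [Matrix.one_apply]; split_ifs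
    · exact Commute.one_left _
    · exact Commute.zero_left _
  have h' := siteAction_commute n L h (Matrix.single j i 1) (Matrix.single l k 1)
  simp only [siteT, Matrix.sub_apply, Matrix.smul_apply, Matrix.of_apply]
  refine Commute.sub_left (Commute.sub_right ?_ ?_) (Commute.sub_right ?_ ?_)
  · exact hc _ 1 _ _ _ (Commute.one_left _)
  · exact hc _ 1 _ _ _ (Commute.one_left _)
  · exact (hc _ 1 _ _ _ (Commute.one_left _)).symm
  · exact (h'.smul_left _).smul_right _

/-- The entries of `T` commute with those of a product if they commute with those of the factors. -/
theorem commute_list_prod {N A ι : Type*} [Fintype N] [DecidableEq N] [Ring A] (T : Matrix N N A)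
    (f : ι → Matrix N N A) (l : List ι) (h : ∀ s ∈ l, ∀ i j k l, Commute (T i j) (f s k l)) :
    ∀ i j k l', Commute (T i j) ((l.map f).prod k l') := by
  induction l with
  | nil =>
    intro i j k l'
    simp only [List.map_nil, List.prod_nil, Matrix.one_apply]
    split_ifs
    · exact Commute.one_right _
    · exact Commute.zero_right _
  | cons a l ih =>
    intro i j k l'
    simp only [List.map_cons, List.prod_cons, Matrix.mul_apply]
    refine Commute.sum_right _ _ _ fun x _ => Commute.mul_right (h a (by simp) _ _ _ _) ?_
    exact ih (fun s hs => h s (by simp [hs])) _ _ _ _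

theorem bulkT_rtt (c : Fin ℓ → ℂ) {u v : ℂ} (hu : ∀ s, u ≠ c s) (hv : ∀ s, v ≠ c s)
    (huv : u ≠ v) : RTT (u - v) (bulkT n L c u) (bulkT n L c v) := by
  unfold bulkT
  rw [List.ofFn_eq_map, List.ofFn_eq_map]
  have hnd := List.nodup_finRange ℓ
  generalize List.finRange ℓ = q at hnd ⊢
  induction q with
  | nil => exact RTT.one _
  | cons s l ih =>
    rw [List.nodup_cons] at hnd
    simp only [List.map_cons, List.prod_cons]
    have hne : ∀ t ∈ l, s ≠ t := fun t ht => by rintro rfl; exact hnd.1 ht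
    refine (siteT_rtt n L c s (hu s) (hv s) huv).mul (ih hnd.2) ?_ ?_
    · intro i j k l'
      exact (commute_list_prod _ _ l (fun t ht => siteT_commute n L c (hne t ht) v u) _ _ _ _).symm
    · intro i j k l'
      exact commute_list_prod _ _ l (fun t ht => siteT_commute n L c (hne t ht) u v) _ _ _ _

/-- For diagonal matrices the only nontrivial entries are those with i = l, k = j, i ≠ j, and there
the equation is `key`. In the variables u+ρ/2 and v+ρ/2, whose sum and difference are y and x, the
entries are ±1 - a/(u+ρ/2) and ±1 - a/(v+ρ/2); `key` is checked for each choice of the two signs. -/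
theorem boundaryK_reflection {A : Type*} [Ring A] [Algebra ℂ A] (r : ℕ) (ρ a u v : ℂ)
    (hu : u + ρ / 2 ≠ 0) (hv : v + ρ / 2 ≠ 0) (huv : u ≠ v) (huv' : u + v + ρ ≠ 0) :
    ReflectionEq (A := A) (u - v) (u + v + ρ)
      (Matrix.diagonal (fun i : Fin n => algebraMap ℂ A (boundaryK r ρ a u i)))
      (Matrix.diagonal (fun i : Fin n => algebraMap ℂ A (boundaryK r ρ a v i))) := by
  have hx : u - v ≠ 0 := sub_ne_zero.2 huv
  have hyy : u + v + ρ = (u + ρ / 2) + (v + ρ / 2) := by ring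
  have hxx : u - v = (u + ρ / 2) - (v + ρ / 2) := by ring
  have key : ∀ i k : Fin n,
      (u + v + ρ)⁻¹ * (boundaryK r ρ a u i * boundaryK r ρ a v i
          - boundaryK r ρ a v k * boundaryK r ρ a u k)
        + (u - v)⁻¹ * (boundaryK r ρ a u k * boundaryK r ρ a v i
          - boundaryK r ρ a v k * boundaryK r ρ a u i) = 0 := by
    intro i k
    unfold boundaryK
    rw [hyy] at huv' ⊢
    rw [hxx] at hx ⊢
    generalize u + ρ / 2 = x at *
    generalize v + ρ / 2 = y at *
    split_ifs <;> field_simp <;> ring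
  rw [reflectionEq_iff]
  intro i j k l
  simp only [Matrix.diagonal_mul_diagonal, Matrix.diagonal_apply, ← map_mul, ← ite_and]
  simp only [ite_mul, mul_ite, zero_mul, mul_zero, ← map_mul, Algebra.smul_def, ← map_sub,
    ← map_add, ← ite_and, ← apply_ite (algebraMap ℂ A), ← map_zero (algebraMap ℂ A)]
  congr 1
  have hk := key i k
  clear key
  generalize boundaryK r ρ a u = K at *
  generalize boundaryK r ρ a v = K' at *
  by_cases h1 : i = j
  · subst h1
    by_cases h2 : k = l
    · subst h2
      by_cases h3 : i = k
      · subst h3; simp; ring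
      · simp [h3, Ne.symm h3]; ring
    · by_cases h3 : i = k
      · subst h3; simp [h2]
      · simp [h2, Ne.symm h3]
  · by_cases h3 : i = l
    · subst h3
      by_cases h4 : k = j
      · subst h4
        simp [h1, Ne.symm h1]
        linear_combination (-1 : ℂ) * hk
      · by_cases h5 : i = k
        · subst h5; simp [h1]
        · simp [h1, h4]
    · by_cases h4 : k = j
      · subst h4
        simp [h1, h3]
      · simp [h1, h3, h4]

end Chain

/-! ### Invariance of the kernels of lower-left blocks under the reflection equation -/

section Preservation

variable {n : ℕ} {M : Type*} [AddCommGroup M] [Module ℂ M]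

/-- The vectors that are annihilated by the entries of `X` in the rows `≥ κ` and columns `< κ`. -/
def blockKer (κ : ℕ) (X : Matrix (Fin n) (Fin n) (Module.End ℂ M)) : Submodule ℂ M where
  carrier := {ζ | ∀ i j : Fin n, (j : ℕ) < κ → κ ≤ i → X i j ζ = 0}
  add_mem' h h' i j hj hi := by rw [map_add, h i j hj hi, h' i j hj hi, add_zero]
  zero_mem' i j _ _ := map_zero _
  smul_mem' c ζ h i j hj hi := by rw [map_smul, h i j hj hi, smul_zero]

variable {x y : ℂ} {X Y : Matrix (Fin n) (Fin n) (Module.End ℂ M)} {κ : ℕ} {ζ : M}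

theorem mul_apply_vec (X Y : Matrix (Fin n) (Fin n) (Module.End ℂ M)) (i j : Fin n) (ζ : M) :
    (X * Y) i j ζ = ∑ k, X i k (Y k j ζ) := by
  simp [Matrix.mul_apply, LinearMap.sum_apply]

/-- In the entry (i, a; b, l) of the reflection equation every term but two begins by applying a
lower-left entry to ζ or carries a vanishing Kronecker symbol. -/
theorem reflection_lower_diag (h : ReflectionEq x y X Y)
    (hX : ζ ∈ blockKer κ X) (hY : ζ ∈ blockKer κ Y) {i a b l : Fin n} (hi : κ ≤ i)
    (ha : (a : ℕ) < κ) (hl : (l : ℕ) < κ) :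
    X i a (Y b l ζ) = if b = a then y⁻¹ • (X * Y) i l ζ else 0 := by
  have e := LinearMap.congr_fun ((reflectionEq_iff x y X Y).1 h i a b l) ζ
  have h1 : i ≠ a := by rintro rfl; omega
  have h2 : i ≠ l := by rintro rfl; omega
  simp only [h1, h2, if_false, smul_zero, add_zero, sub_zero, LinearMap.sub_apply,
    Module.End.mul_apply, LinearMap.smul_apply, hX i l hl hi, hX i a ha hi, hY i l hl hi,
    map_zero] at e
  rw [sub_eq_zero] at e
  rw [e]
  split_ifs <;> simp

/-- In the sum of X_{ic}Y_{cl}ζ over c, each c < κ contributes the same vector y⁻¹(XY)_{il}ζ, by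
`reflection_lower_diag`, and each c ≥ κ contributes zero. So (XY)_{il}ζ is K/y times itself, where K
is the number of indices below κ. -/
theorem reflection_lower_sum (h : ReflectionEq x y X Y) (hy : y ≠ 0)
    (hyc : y ≠ (Finset.univ.filter fun c : Fin n => (c : ℕ) < κ).card)
    (hX : ζ ∈ blockKer κ X) (hY : ζ ∈ blockKer κ Y) {i l : Fin n} (hi : κ ≤ i)
    (hl : (l : ℕ) < κ) : (X * Y) i l ζ = 0 := by
  have e : (X * Y) i l ζ = ((Finset.univ.filter fun c : Fin n => (c : ℕ) < κ).card * y⁻¹ : ℂ)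
      • (X * Y) i l ζ := by
    conv_lhs => rw [mul_apply_vec]
    rw [← Finset.sum_filter_add_sum_filter_not _ (fun c : Fin n => (c : ℕ) < κ),
      Finset.sum_eq_zero (s := Finset.univ.filter fun c : Fin n => ¬ (c : ℕ) < κ), add_zero,
      Finset.sum_congr rfl (g := fun _ => y⁻¹ • (X * Y) i l ζ), Finset.sum_const, mul_smul,
      Nat.cast_smul_eq_nsmul]
    · intro c hc
      rw [reflection_lower_diag h hX hY hi (by simpa using hc) hl, if_pos rfl]
    · intro c hc
      rw [hY c l hl (by simpa using hc), map_zero]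
  by_contra hne
  have : (1 - (Finset.univ.filter fun c : Fin n => (c : ℕ) < κ).card * y⁻¹ : ℂ)
      • (X * Y) i l ζ = 0 := by
    rw [sub_smul, one_smul, ← e, sub_self]
  rcases smul_eq_zero.1 this with h0 | h0
  · apply hyc
    field_simp at h0
    linear_combination h0
  · exact hne h0

/-- If i, j < κ, the claim is `reflection_lower_diag` with X and Y interchanged, its right-hand side
being zero by `reflection_lower_sum`. If i, j ≥ κ, all terms of the entry (i, j; k, l) other than
Y_{kl}X_{ij}ζ vanish; the products XY and YX in it are again handled by `reflection_lower_sum`. -/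
theorem reflection_blockKer (h : ReflectionEq x y X Y) (h' : ReflectionEq (-x) y Y X) (hy : y ≠ 0)
    (hyc : y ≠ (Finset.univ.filter fun c : Fin n => (c : ℕ) < κ).card)
    (hX : ζ ∈ blockKer κ X) (hY : ζ ∈ blockKer κ Y) {i j : Fin n}
    (hij : (i : ℕ) < κ ↔ (j : ℕ) < κ) : X i j ζ ∈ blockKer κ Y := by
  intro k l hl hk
  by_cases hi : (i : ℕ) < κ
  · rw [reflection_lower_diag h' hY hX hk hl (hij.1 hi),
      reflection_lower_sum h' hy hyc hY hX hk (hij.1 hi)]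
    simp
  · have hj : κ ≤ j := by omega
    have hi : κ ≤ i := by omega
    have e := LinearMap.congr_fun ((reflectionEq_iff x y X Y).1 h i j k l) ζ
    have h2 : i ≠ l := by rintro rfl; omega
    have e3 := reflection_lower_sum h hy hyc hX hY hi hl
    have e4 := reflection_lower_sum h hy hyc hX hY hk hl
    have e5 := reflection_lower_sum h' hy hyc hY hX hk hl
    simp only [h2, if_false, smul_zero, sub_zero, LinearMap.sub_apply, LinearMap.add_apply,
      Module.End.mul_apply, LinearMap.smul_apply, hX i l hl hi, hY i l hl hi, hY k l hl hk,
      map_zero, apply_ite (fun f : Module.End ℂ M => f ζ), LinearMap.zero_apply, e3, e4, e5,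
      ite_self, add_zero] at e
    exact e.symm

end Preservation

/-! ### Removing exceptional spectral parameters by continuity -/

section Density

variable (n : ℕ) {ℓ : ℕ} (L : Fin ℓ → Type*) [∀ s, AddCommGroup (L s)] [∀ s, Module ℂ (L s)]
  [∀ s, LieRingModule (Matrix (Fin n) (Fin n) ℂ) (L s)]
  [∀ s, LieModule ℂ (Matrix (Fin n) (Fin n) ℂ) (L s)]

/-- In `ReflectionEq.dress` the shifted sum u+v+ρ is the difference of v and -u-ρ, and also of u and
-v-ρ; the difference u-v is also that of -v-ρ and -u-ρ. So all four RTT hypotheses are instances of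
`bulkT_rtt`. -/
theorem chainB_reflection (c : Fin ℓ → ℂ) (r : ℕ) (ρ a : ℂ) {u v : ℂ} (hu : Regular n L c ρ u)
    (hv : Regular n L c ρ v) (huv : u ≠ v) (huv' : u + v + ρ ≠ 0) :
    ReflectionEq (u - v) (u + v + ρ) (chainB n L c r ρ a u) (chainB n L c r ρ a v) := by
  have hc : ∀ (f : Fin n → ℂ) (Z : Matrix (Fin n) (Fin n) (Module.End ℂ (⨂[ℂ] s, L s)))
      (i j k l : Fin n), Commute ((Matrix.diagonal fun i =>
        algebraMap ℂ (Module.End ℂ (⨂[ℂ] s, L s)) (f i)) i j) (Z k l) := by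
    intro f Z i j k l
    rw [Matrix.diagonal_apply]
    split_ifs
    · exact Algebra.commutes _ _
    · exact Commute.zero_left _
  unfold chainB
  refine ReflectionEq.dress (T' := bulkT n L c (-u - ρ)) (S' := bulkT n L c (-v - ρ))
    (bulkT_rtt n L c (fun s => (hu.bulk s).1) (fun s => (hv.bulk s).1) huv) ?_ ?_ ?_
    ⟨Ring.mul_inverse_cancel _ hu.inverse, Ring.inverse_mul_cancel _ hu.inverse⟩
    ⟨Ring.mul_inverse_cancel _ hv.inverse, Ring.inverse_mul_cancel _ hv.inverse⟩
    (fun Z i j k l => hc _ _ _ _ _ _) (fun Z i j k l => (hc _ _ _ _ _ _).symm)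
    (boundaryK_reflection n r ρ a u v hu.boundary hv.boundary huv huv')
  · have h : u + v + ρ = v - (-u - ρ) := by ring
    rw [h]
    refine bulkT_rtt n L c (fun s => (hv.bulk s).1) (fun s => (hu.bulk s).2) fun h' => huv' ?_
    rw [h, h', sub_self]
  · have h : u + v + ρ = u - (-v - ρ) := by ring
    rw [h]
    refine bulkT_rtt n L c (fun s => (hu.bulk s).1) (fun s => (hv.bulk s).2) fun h' => huv' ?_
    rw [h, h', sub_self]
  · have h : u - v = (-v - ρ) - (-u - ρ) := by ring
    rw [h]
    refine bulkT_rtt n L c (fun s => (hv.bulk s).2) (fun s => (hu.bulk s).2) fun h' => huv ?_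
    linear_combination h'

variable [∀ s, FiniteDimensional ℂ (L s)]

open Filter Topology

/-- Matrices over the endomorphisms of the quantum space, as complex matrices. -/
def toComplexMatrix : Matrix (Fin n) (Fin n) (Module.End ℂ (⨂[ℂ] s, L s)) ≃ₐ[ℂ]
    Matrix (Fin n × Fin (Module.finrank ℂ (⨂[ℂ] s, L s)))
      (Fin n × Fin (Module.finrank ℂ (⨂[ℂ] s, L s))) ℂ :=
  (LinearMap.toMatrixAlgEquiv (Module.finBasis ℂ (⨂[ℂ] s, L s))).mapMatrix.trans
    (Matrix.compAlgEquiv _ _ ℂ ℂ)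

theorem continuousAt_bulkT (c : Fin ℓ → ℂ) {w : ℂ} (hw : ∀ s, w ≠ c s) :
    ContinuousAt (fun w => toComplexMatrix n L (bulkT n L c w)) w := by
  unfold bulkT
  simp only [List.ofFn_eq_map, map_list_prod, List.map_map]
  refine tendsto_list_prod _ fun s _ => ?_
  simp only [Function.comp_apply, siteT, map_sub, map_smul]
  refine tendsto_const_nhds.sub (Tendsto.smul ?_ tendsto_const_nhds)
  exact ((continuousAt_id.sub continuousAt_const).inv₀ (sub_ne_zero.2 (hw s))).tendsto

theorem isUnit_bulkT_iff (c : Fin ℓ → ℂ) (w : ℂ) :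
    IsUnit (bulkT n L c w) ↔ (toComplexMatrix n L (bulkT n L c w)).det ≠ 0 := by
  rw [← isUnit_iff_ne_zero, ← Matrix.isUnit_iff_isUnit_det,
    MulEquiv.isUnit_map]

theorem eventually_regular (c : Fin ℓ → ℂ) {ρ v : ℂ} (hv : Regular n L c ρ v) :
    ∀ᶠ w in 𝓝 v, Regular n L c ρ w := by
  have hc : ContinuousAt (fun w : ℂ => -w - ρ) v := by fun_prop
  have h1 : ∀ s, ∀ᶠ w in 𝓝 v, w ≠ c s ∧ -w - ρ ≠ c s := fun s =>
    (eventually_ne_nhds (hv.bulk s).1).and (hc.eventually_ne (hv.bulk s).2)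
  have h2 : ∀ᶠ w in 𝓝 v, w + ρ / 2 ≠ 0 :=
    ContinuousAt.eventually_ne (g := fun w => w + ρ / 2) (by fun_prop) hv.boundary
  have h3 : ContinuousAt (fun w : ℂ => (toComplexMatrix n L (bulkT n L c (-w - ρ))).det) v := by
    have h := continuousAt_bulkT n L c (w := -v - ρ) fun s => (hv.bulk s).2
    exact Continuous.continuousAt (f := fun A : Matrix (Fin n × _) (Fin n × _) ℂ => A.det)
      (continuous_id.matrix_det) |>.comp (ContinuousAt.comp (f := fun w : ℂ => -w - ρ) h hc)
  filter_upwards [eventually_all.2 h1, h2,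
    h3.eventually_ne ((isUnit_bulkT_iff n L c _).1 hv.inverse)] with w w1 w2 w3
  exact ⟨w1, w2, (isUnit_bulkT_iff n L c _).2 w3⟩

theorem continuousAt_chainB (c : Fin ℓ → ℂ) (r : ℕ) (ρ a : ℂ) {v : ℂ}
    (hv : Regular n L c ρ v) :
    ContinuousAt (fun w => toComplexMatrix n L (chainB n L c r ρ a w)) v := by
  have hc : ContinuousAt (fun w : ℂ => -w - ρ) v := by fun_prop
  -- `Ring.inverse` is tied to the matrix inverse only where T(-w-ρ) is invertible, hence only an
  -- equality near v. Continuity of the inverse then follows from the adjugate formula.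
  have e : (fun w => toComplexMatrix n L (chainB n L c r ρ a w)) =ᶠ[𝓝 v] fun w =>
      toComplexMatrix n L (bulkT n L c w) * toComplexMatrix n L (Matrix.diagonal
        (fun i => algebraMap ℂ _ (boundaryK r ρ a w i)))
      * (toComplexMatrix n L (bulkT n L c (-w - ρ)))⁻¹ := by
    filter_upwards [eventually_regular n L c hv] with w hw
    rw [chainB, map_mul, map_mul]
    congr 1
    symm
    apply Matrix.inv_eq_right_inv
    rw [← map_mul, Ring.mul_inverse_cancel _ hw.inverse, map_one]
  refine ContinuousAt.congr ?_ e.symm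
  refine ((continuousAt_bulkT n L c fun s => (hv.bulk s).1).mul ?_).mul ?_
  · have hd : ∀ w, (Matrix.diagonal (fun i => algebraMap ℂ (Module.End ℂ (⨂[ℂ] s, L s))
        (boundaryK r ρ a w i)) : Matrix (Fin n) (Fin n) _)
        = ∑ i, boundaryK r ρ a w i • Matrix.single i i 1 := by
      intro w
      rw [← Matrix.sum_single_eq_diagonal]
      refine Finset.sum_congr rfl fun i _ => ?_
      rw [Matrix.smul_single, Algebra.algebraMap_eq_smul_one]
    simp only [hd, map_sum, map_smul]
    refine tendsto_finsetSum _ fun i _ => Tendsto.smul ?_ tendsto_const_nhds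
    have : ContinuousAt (fun w => boundaryK r ρ a w i) v := by
      unfold boundaryK
      have := hv.boundary
      fun_prop (disch := assumption)
    exact this
  · have h : ContinuousAt (fun w : ℂ => toComplexMatrix n L (bulkT n L c (-w - ρ))) v :=
      ContinuousAt.comp (f := fun w : ℂ => -w - ρ)
        (continuousAt_bulkT n L c (w := -v - ρ) fun s => (hv.bulk s).2) hc
    have h1 : ContinuousAt
        (fun w : ℂ => Ring.inverse (toComplexMatrix n L (bulkT n L c (-w - ρ))).det) v := by
      simp only [Ring.inverse_eq_inv']
      refine ContinuousAt.inv₀ ?_ ((isUnit_bulkT_iff n L c _).1 hv.inverse)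
      exact (Continuous.continuousAt (f := fun A : Matrix (Fin n × _) (Fin n × _) ℂ => A.det)
        continuous_id.matrix_det).comp h
    have h2 : ContinuousAt
        (fun w : ℂ => (toComplexMatrix n L (bulkT n L c (-w - ρ))).adjugate) v :=
      (Continuous.continuousAt (f := fun A : Matrix (Fin n × _) (Fin n × _) ℂ => A.adjugate)
        continuous_id.matrix_adjugate).comp h
    simp only [Matrix.inv_def]
    exact h1.smul h2

/-- Each linear functional of B(w)_{ij}ζ is continuous at the regular point v and vanishes on a
punctured neighbourhood, so it vanishes at v. -/
theorem chainB_apply_eq_zero (c : Fin ℓ → ℂ) (r : ℕ) (ρ a : ℂ) {v : ℂ}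
    (hv : Regular n L c ρ v) (i j : Fin n) (ζ : ⨂[ℂ] s, L s) {p : ℂ → Prop}
    (hp : ∀ᶠ w in 𝓝[≠] v, p w)
    (h : ∀ w, Regular n L c ρ w → p w → chainB n L c r ρ a w i j ζ = 0) :
    chainB n L c r ρ a v i j ζ = 0 := by
  rw [← Module.forall_dual_apply_eq_zero_iff ℂ]
  intro φ
  let ψ : Matrix (Fin n) (Fin n) (Module.End ℂ (⨂[ℂ] s, L s)) →ₗ[ℂ] ℂ :=
    { toFun := fun X => φ (X i j ζ)
      map_add' := fun X Y => by simp
      map_smul' := fun c X => by simp }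
  let χ := ψ ∘ₗ (toComplexMatrix n L).symm.toLinearMap
  have hχ : Continuous χ := LinearMap.continuous_of_finiteDimensional χ
  have hcont : ContinuousAt (fun w => φ (chainB n L c r ρ a w i j ζ)) v := by
    have := hχ.continuousAt.comp (continuousAt_chainB n L c r ρ a hv)
    simpa [Function.comp_def, χ, ψ] using this
  have hev : (fun w => φ (chainB n L c r ρ a w i j ζ)) =ᶠ[𝓝[≠] v] fun _ => 0 := by
    filter_upwards [hp, (eventually_regular n L c hv).filter_mono nhdsWithin_le_nhds] with w h1 h2
    rw [h w h2 h1, map_zero]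
  exact tendsto_nhds_unique (hcont.tendsto.mono_left nhdsWithin_le_nhds)
    (tendsto_const_nhds.congr' hev.symm)

/-- The vectors annihilated by the entries of `B(v)` in the rows `≥ κ` and columns `< κ`, for
all `v`. -/
def lowerKer (c : Fin ℓ → ℂ) (r : ℕ) (ρ a : ℂ) (κ : ℕ) : Submodule ℂ (⨂[ℂ] s, L s) :=
  ⨅ v : {v // Regular n L c ρ v}, blockKer κ (chainB n L c r ρ a v)

theorem mem_lowerKer (c : Fin ℓ → ℂ) (r : ℕ) (ρ a : ℂ) (κ : ℕ) (ζ : ⨂[ℂ] s, L s) :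
    ζ ∈ lowerKer n L c r ρ a κ ↔
      ∀ v, Regular n L c ρ v → ζ ∈ blockKer κ (chainB n L c r ρ a v) := by
  simp [lowerKer]

theorem chainB_mem_lowerKer (c : Fin ℓ → ℂ) (r : ℕ) (ρ a : ℂ) {κ : ℕ} {ζ : ⨂[ℂ] s, L s}
    (hζ : ζ ∈ lowerKer n L c r ρ a κ) {u : ℂ} (hu : Regular n L c ρ u) {i j : Fin n}
    (hij : (i : ℕ) < κ ↔ (j : ℕ) < κ) :
    chainB n L c r ρ a u i j ζ ∈ lowerKer n L c r ρ a κ := by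
  rw [mem_lowerKer] at hζ ⊢
  intro v hv k l hl hk
  set K : ℂ := Nat.cast (Finset.univ.filter fun c : Fin n => (c : ℕ) < κ).card
  have hfin : ∀ z : ℂ, ∀ᶠ w in 𝓝[≠] v, w ≠ z := by
    intro z
    by_cases hz : z = v
    · subst hz; exact self_mem_nhdsWithin
    · exact (eventually_ne_nhds (Ne.symm hz)).filter_mono nhdsWithin_le_nhds
  -- The points w to avoid are those where u-w or u+w+ρ is zero, or u+w+ρ equals the number of
  -- indices below κ.
  refine chainB_apply_eq_zero n L c r ρ a hv k l _
    ((hfin u).and ((hfin (-u - ρ)).and (hfin (K - u - ρ)))) ?_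
  rintro w hw ⟨h1, h2, h3⟩
  have hy : u + w + ρ ≠ 0 := fun h => h2 (by linear_combination h)
  have hyK : u + w + ρ ≠ K := fun h => h3 (by linear_combination h)
  have e1 := chainB_reflection n L c r ρ a hu hw (Ne.symm h1) hy
  have e2 := chainB_reflection n L c r ρ a hw hu h1 (by rwa [add_comm w])
  rw [add_comm w, ← neg_sub] at e2
  exact reflection_blockKer e1 e2 hy hyK (hζ u hu) (hζ w hw) hij k l hl hk

end Density

/-! ### Operators on vector-valued functions of configurations -/

section SiteOperators

variable {n : ℕ} {S : Type} [DecidableEq S] {M : Type*} [AddCommGroup M] [Module ℂ M]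

/-- The operator `e_{xy} ⊗ α`, with `e_{xy}` acting at the site `s`, on `M`-valued functions of
a configuration. -/
def siteOp (s : S) (x y : Fin n) (α : Module.End ℂ M) : Module.End ℂ ((S → Fin n) → M) where
  toFun f := fun σ => if σ s = x then α (f (Function.update σ s y)) else 0
  map_add' f g := by funext σ; simp only [Pi.add_apply, map_add]; split_ifs <;> simp
  map_smul' c f := by funext σ; simp only [Pi.smul_apply, map_smul]; split_ifs <;> simp

/-- The operator `1 ⊗ α`. -/
def constOp (S : Type) (n : ℕ) (α : Module.End ℂ M) : Module.End ℂ ((S → Fin n) → M) where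
  toFun f := fun σ => α (f σ)
  map_add' f g := by funext σ; simp
  map_smul' c f := by funext σ; simp

theorem siteOp_apply (s : S) (x y : Fin n) (α : Module.End ℂ M) (f : (S → Fin n) → M)
    (σ : S → Fin n) :
    siteOp s x y α f σ = if σ s = x then α (f (Function.update σ s y)) else 0 := rfl

theorem constOp_apply (α : Module.End ℂ M) (f : (S → Fin n) → M) (σ : S → Fin n) :
    constOp S n α f σ = α (f σ) := rfl

/-- The restriction of a function to the configurations with value `y` at `s`. -/
def slice (s : S) (y : Fin n) : Module.End ℂ ((S → Fin n) → M) :=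
  LinearMap.funLeft ℂ M fun σ => Function.update σ s y

theorem slice_apply (s : S) (y : Fin n) (f : (S → Fin n) → M) (σ : S → Fin n) :
    slice s y f σ = f (Function.update σ s y) := rfl

/-- A map of configurations that does not touch the site `s`. -/
structure Avoids (g : (S → Fin n) → S → Fin n) (s : S) : Prop where
  apply : ∀ σ, g σ s = σ s
  update : ∀ σ y, g (Function.update σ s y) = Function.update (g σ) s y

theorem avoids_update {s t : S} (h : s ≠ t) (y : Fin n) :
    Avoids (fun σ : S → Fin n => Function.update σ t y) s :=
  ⟨fun σ => Function.update_of_ne h _ _, fun σ y' => Function.update_comm h _ _ _⟩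

theorem Avoids.commute_siteOp {g : (S → Fin n) → S → Fin n} {s : S} (h : Avoids g s) (x y : Fin n)
    (α : Module.End ℂ M) : Commute (LinearMap.funLeft ℂ M g) (siteOp s x y α) := by
  ext1 f
  funext σ
  simp only [Module.End.mul_apply, LinearMap.funLeft_apply, siteOp_apply, h.apply, h.update]

theorem commute_funLeft_constOp (g : (S → Fin n) → S → Fin n) (α : Module.End ℂ M) :
    Commute (LinearMap.funLeft ℂ M g) (constOp S n α) := rfl

theorem commute_siteOp_siteOp {s t : S} (h : s ≠ t) (x y x' y' : Fin n) (α : Module.End ℂ M) :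
    Commute (siteOp s x y 1) (siteOp t x' y' α) := by
  ext1 f
  funext σ
  simp only [Module.End.mul_apply, siteOp_apply, Module.End.one_apply,
    Function.update_of_ne h, Function.update_of_ne h.symm, Function.update_comm h]
  split_ifs <;> simp

theorem commute_siteOp_constOp (s : S) (x y : Fin n) (α : Module.End ℂ M) :
    Commute (siteOp s x y 1) (constOp S n α) := by
  ext1 f
  funext σ
  simp only [Module.End.mul_apply, siteOp_apply, Module.End.one_apply, constOp_apply]
  split_ifs <;> simp

theorem siteOp_siteOp (s : S) (x y x' y' : Fin n) (f : (S → Fin n) → M) :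
    siteOp s x y 1 (siteOp s x' y' 1 f) = if y = x' then siteOp s x y' 1 f else 0 := by
  funext σ
  simp only [siteOp_apply, Function.update_self, Function.update_idem, Module.End.one_apply]
  split_ifs <;> simp [siteOp_apply, *]

/-- The functions that vanish outside the configurations with `σ s ∈ C s` for all `s`. -/
def supp (M : Type*) [AddCommGroup M] [Module ℂ M] (C : S → Set (Fin n)) :
    Submodule ℂ ((S → Fin n) → M) where
  carrier := {f | ∀ σ s, σ s ∉ C s → f σ = 0}
  add_mem' h h' σ s hs := by rw [Pi.add_apply, h σ s hs, h' σ s hs, add_zero]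
  zero_mem' σ s _ := rfl
  smul_mem' c f h σ s hs := by rw [Pi.smul_apply, h σ s hs, smul_zero]

theorem supp_mono {C C' : S → Set (Fin n)} (h : ∀ s, C s ⊆ C' s) : supp M C ≤ supp M C' :=
  fun _ hf σ s hs => hf σ s fun h' => hs (h s h')

theorem siteOp_mem_supp {C : S → Set (Fin n)} {f : (S → Fin n) → M} (hf : f ∈ supp M C) {s : S}
    {x y : Fin n} (hx : x ∈ C s) (α : Module.End ℂ M) : siteOp s x y α f ∈ supp M C := by
  intro σ t ht
  rw [siteOp_apply]
  split_ifs with h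
  · rw [hf _ t, map_zero]
    rcases eq_or_ne t s with rfl | hts
    · exact absurd (h ▸ hx) ht
    · rwa [Function.update_of_ne hts]
  · rfl

theorem siteOp_eq_zero {C : S → Set (Fin n)} {f : (S → Fin n) → M} (hf : f ∈ supp M C) {s : S}
    {y : Fin n} (hy : y ∉ C s) (x : Fin n) (α : Module.End ℂ M) : siteOp s x y α f = 0 := by
  funext σ
  rw [siteOp_apply, hf _ s (by rwa [Function.update_self]), map_zero, ite_self]
  rfl

theorem siteOp_self {C : S → Set (Fin n)} {f : (S → Fin n) → M} (hf : f ∈ supp M C) {s : S}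
    {h : Fin n} (hC : C s ⊆ {h}) : siteOp s h h 1 f = f := by
  funext σ
  rw [siteOp_apply]
  split_ifs with hσ
  · rw [← hσ, Function.update_eq_self]; rfl
  · exact (hf σ s fun h' => hσ (hC h')).symm

theorem constOp_mem_supp {C : S → Set (Fin n)} {f : (S → Fin n) → M} (hf : f ∈ supp M C)
    (α : Module.End ℂ M) : constOp S n α f ∈ supp M C := by
  intro σ t ht
  rw [constOp_apply, hf σ t ht, map_zero]

/-- The functions with values in `N`. -/
def valuedIn (S : Type) (n : ℕ) (N : Submodule ℂ M) : Submodule ℂ ((S → Fin n) → M) :=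
  Submodule.pi Set.univ fun _ => N

theorem mem_valuedIn {N : Submodule ℂ M} {f : (S → Fin n) → M} :
    f ∈ valuedIn S n N ↔ ∀ σ, f σ ∈ N := by simp [valuedIn, Submodule.mem_pi]

theorem siteOp_mem_valuedIn {N : Submodule ℂ M} {f : (S → Fin n) → M} (hf : f ∈ valuedIn S n N)
    (s : S) (x y : Fin n) : siteOp s x y 1 f ∈ valuedIn S n N := by
  rw [mem_valuedIn] at *
  intro σ
  rw [siteOp_apply]
  split_ifs
  · exact hf _
  · exact N.zero_mem

end SiteOperators

/-! ### Dressing by R-matrices and its effect on the vacuum -/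

section Dressing

variable {n : ℕ} {S : Type} [DecidableEq S] {M : Type*} [AddCommGroup M] [Module ℂ M] {k : ℕ}

/-- The normalised `R`-matrix `z/(z-1) (1 - z⁻¹ P)` between the auxiliary space `V^{(k)}` and the
site `s`. -/
def siteR (M : Type*) [AddCommGroup M] [Module ℂ M] (k : ℕ) (s : S) (z : ℂ) :
    Matrix (Idx n k) (Idx n k) (Module.End ℂ ((S → Fin n) → M)) :=
  (z / (z - 1)) • (1 - z⁻¹ • Matrix.of fun x y => siteOp s y.1 x.1 1)

/-- The matrix `D` dressed by `R`-matrices at the sites of `l`. -/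
def dressed (l : List S) (z z' : S → ℂ) (D : Matrix (Idx n k) (Idx n k) (Module.End ℂ M)) :
    Matrix (Idx n k) (Idx n k) (Module.End ℂ ((S → Fin n) → M)) :=
  (l.map fun s => siteR M k s (z s)).prod * D.map (constOp S n)
    * (l.map fun s => siteR M k s (z' s)).reverse.prod

theorem dressed_nil (z z' : S → ℂ) (D : Matrix (Idx n k) (Idx n k) (Module.End ℂ M)) :
    dressed [] z z' D = D.map (constOp S n) := by simp [dressed]

theorem dressed_cons (s : S) (l : List S) (z z' : S → ℂ)
    (D : Matrix (Idx n k) (Idx n k) (Module.End ℂ M)) :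
    dressed (s :: l) z z' D = siteR M k s (z s) * dressed l z z' D * siteR M k s (z' s) := by
  simp [dressed, mul_assoc]

theorem siteR_apply (s : S) (z : ℂ) (x y : Idx n k) :
    siteR M k s z x y = (z / (z - 1)) • ((if x = y then 1 else 0) - z⁻¹ • siteOp s y.1 x.1 1) := by
  simp [siteR, Matrix.one_apply]

theorem commute_siteR {T : Module.End ℂ ((S → Fin n) → M)} {s : S}
    (h : ∀ x y : Fin n, k ≤ (x : ℕ) + 1 → k ≤ (y : ℕ) + 1 → Commute T (siteOp s x y 1)) (z : ℂ)
    (x y : Idx n k) : Commute T (siteR M k s z x y) := by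
  rw [siteR_apply]
  refine Commute.smul_right (Commute.sub_right ?_ ((h _ _ y.2 x.2).smul_right _)) _
  split_ifs
  · exact Commute.one_right _
  · exact Commute.zero_right _

theorem commute_dressed {T : Module.End ℂ ((S → Fin n) → M)} {l : List S}
    (h : ∀ s ∈ l, ∀ x y : Fin n, Commute T (siteOp s x y 1))
    (h' : ∀ α, Commute T (constOp S n α)) (z z' : S → ℂ)
    (D : Matrix (Idx n k) (Idx n k) (Module.End ℂ M)) (x y : Idx n k) :
    Commute T (dressed l z z' D x y) := by
  induction l generalizing x y with
  | nil => rw [dressed_nil]; exact h' _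
  | cons s l ih =>
    rw [dressed_cons]
    simp only [Matrix.mul_apply]
    refine Commute.sum_right _ _ _ fun b _ => Commute.mul_right
      (Commute.sum_right _ _ _ fun a _ => Commute.mul_right ?_ ?_) ?_
    · exact commute_siteR (fun _ _ _ _ => h s (by simp) _ _) _ _ _
    · exact ih (fun t ht => h t (by simp [ht])) _ _
    · exact commute_siteR (fun _ _ _ _ => h s (by simp) _ _) _ _ _

/-- Submodules that are stable under the site operators are stable under dressed matrices. -/
theorem dressed_mem {l : List S} {z z' : S → ℂ} {W : Submodule ℂ ((S → Fin n) → M)}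
    {D : Matrix (Idx n k) (Idx n k) (Module.End ℂ M)}
    (hR : ∀ s ∈ l, ∀ x y : Idx n k, ∀ f ∈ W, siteOp s x.1 y.1 1 f ∈ W)
    (hD : ∀ x y, ∀ f ∈ W, constOp S n (D x y) f ∈ W) (x y : Idx n k)
    {f : (S → Fin n) → M} (hf : f ∈ W) : dressed l z z' D x y f ∈ W := by
  induction l generalizing x y f with
  | nil => rw [dressed_nil]; exact hD _ _ _ hf
  | cons s l ih =>
    have hs : ∀ (w : ℂ) (x y : Idx n k), ∀ f ∈ W, siteR M k s w x y f ∈ W := by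
      intro w x y f hf
      rw [siteR_apply]
      refine W.smul_mem _ (W.sub_mem ?_ (W.smul_mem _ (hR s (by simp) _ _ _ hf)))
      split_ifs
      · exact hf
      · exact W.zero_mem
    rw [dressed_cons]
    simp only [Matrix.mul_apply, LinearMap.sum_apply, Module.End.mul_apply]
    exact W.sum_mem fun b _ => W.sum_mem fun a _ =>
      hs _ _ _ _ (ih (fun t ht => hR t (by simp [ht])) _ _ (hs _ _ _ _ hf))

section Vacuum

variable {C : S → Set (Fin n)} {s : S} {h : Idx n k} {f : (S → Fin n) → M} (hf : f ∈ supp M C)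
  (hC : C s ⊆ {h.1})
include hf hC

/-- The permutation part would have to absorb e_i with i ≠ h at a site that carries e_h. -/
theorem siteR_vacuum_row (z : ℂ) {i : Idx n k} (hi : i ≠ h) (x : Idx n k) :
    siteR M k s z i x f = if i = x then (z / (z - 1)) • f else 0 := by
  have : siteOp s x.1 i.1 1 f = 0 :=
    siteOp_eq_zero hf (fun h' => hi (Subtype.ext (hC h'))) _ _
  rw [siteR_apply, LinearMap.smul_apply, LinearMap.sub_apply, LinearMap.smul_apply, this]
  split_ifs <;> simp

/-- The normalisation z/(z-1) cancels the eigenvalue 1 - z⁻¹ on equal basis vectors. -/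
theorem siteR_vacuum_col {z : ℂ} (h0 : z ≠ 0) (h1 : z ≠ 1) (y : Idx n k) :
    siteR M k s z y h f = if y = h then f else 0 := by
  by_cases hy : y = h
  · subst hy
    have h1' : z - 1 ≠ 0 := sub_ne_zero.2 h1
    rw [siteR_apply, LinearMap.smul_apply, LinearMap.sub_apply, LinearMap.smul_apply,
      siteOp_self hf hC, if_pos rfl, if_pos rfl, Module.End.one_apply]
    match_scalars
    field_simp
  · rw [siteR_vacuum_row hf hC z hy, if_neg hy, if_neg hy]

end Vacuum

theorem siteR_off_diag {s : S} {z : ℂ} (h0 : z ≠ 0) {x y : Idx n k} (hxy : x ≠ y)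
    (f : (S → Fin n) → M) :
    siteR M k s z x y f = -((z - 1)⁻¹ • siteOp s y.1 x.1 1 f) := by
  rw [siteR_apply, if_neg hxy, zero_sub, LinearMap.smul_apply, LinearMap.neg_apply,
    LinearMap.smul_apply, smul_neg, smul_smul]
  congr 2
  field_simp

/-- Induction on the sites. A new site multiplies the old (i,j) entry by zz'/((z-1)(z'-1)). The only
other contribution passes through h: the right R-matrix turns e_h at the site into e_j, the left one
returns it to e_h, which forces i = j and gives D_{hh}/((z-1)(z'-1)). The coefficient (β-1)/t
reproduces itself because zz' - (z-1)(z'-1) = z+z'-1 = t, the same t for all sites. -/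
theorem dressed_vacuum {l : List S} (hl : l.Nodup) {z z' : S → ℂ} {t : ℂ} (ht : t ≠ 0)
    (hz : ∀ s ∈ l, z s + z' s = t + 1) (hz0 : ∀ s ∈ l, z s ≠ 0 ∧ z s ≠ 1)
    (hz0' : ∀ s ∈ l, z' s ≠ 0 ∧ z' s ≠ 1)
    {D : Matrix (Idx n k) (Idx n k) (Module.End ℂ M)} {C : S → Set (Fin n)} {h : Idx n k}
    {f : (S → Fin n) → M} (hf : f ∈ supp M C) (hC : ∀ s ∈ l, C s ⊆ {h.1})
    (hD : ∀ x, x ≠ h → ∀ σ, D x h (f σ) = 0) :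
    (∀ i, dressed l z z' D i h f = if i = h then constOp S n (D h h) f else 0) ∧
    ∀ i j, i ≠ h → j ≠ h → dressed l z z' D i j f
      = (l.map fun s => z s / (z s - 1) * (z' s / (z' s - 1))).prod • constOp S n (D i j) f
        + if i = j then (((l.map fun s => z s / (z s - 1) * (z' s / (z' s - 1))).prod - 1) / t)
          • constOp S n (D h h) f else 0 := by
  induction l with
  | nil =>
    rw [dressed_nil]
    refine ⟨fun i => ?_, fun i j _ _ => by simp⟩
    split_ifs with hi
    · subst hi; rfl
    · funext σ; exact hD i hi σ
  | cons s l ih =>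
    rw [List.nodup_cons] at hl
    obtain ⟨ih1, ih2⟩ := ih hl.2 (fun s hs => hz s (by simp [hs])) (fun s hs => hz0 s (by simp [hs]))
      (fun s hs => hz0' s (by simp [hs])) (fun s hs => hC s (by simp [hs]))
    have hCs := hC s (by simp)
    obtain ⟨a0, a1⟩ := hz0 s (by simp)
    obtain ⟨b0, b1⟩ := hz0' s (by simp)
    have hst := hz s (by simp)
    have comm : ∀ x y : Fin n, ∀ i j, Commute (siteOp s x y 1) (dressed l z z' D i j) := by
      intro x y i j
      refine commute_dressed (fun r hr x' y' => commute_siteOp_siteOp ?_ _ _ _ _ _)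
        (fun α => commute_siteOp_constOp _ _ _ _) _ _ _ _ _
      rintro rfl; exact hl.1 hr
    have hg : ∀ α, constOp S n α f ∈ supp M C := fun α => constOp_mem_supp hf α
    rw [dressed_cons]
    constructor
    · intro i
      rw [mul_assoc]
      simp only [Matrix.mul_apply, LinearMap.sum_apply, Module.End.mul_apply,
        siteR_vacuum_col hf hCs b0 b1, apply_ite (dressed l z z' D _ _), map_zero, ih1,
        Finset.sum_ite_eq', Finset.mem_univ, if_true,
        apply_ite (siteR M k s (z s) _ _), siteR_vacuum_col (hg (D h h)) hCs a0 a1]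
    · intro i j hi hj
      have hrow : ∀ x : Idx n k, siteR M k s (z s) i x (dressed l z z' D x j f)
          = if i = x then (z s / (z s - 1)) • dressed l z z' D x j f else 0 := by
        intro x
        rw [siteR_apply, LinearMap.smul_apply, LinearMap.sub_apply, LinearMap.smul_apply,
          ← Module.End.mul_apply (siteOp s _ _ _), (comm _ _ _ _).eq, Module.End.mul_apply,
          siteOp_eq_zero hf (fun h' => hi (Subtype.ext (hCs h')))]
        split_ifs <;> simp
      rw [mul_assoc]
      simp only [Matrix.mul_apply, LinearMap.sum_apply, Module.End.mul_apply]
      have hin : ∀ x, ∑ y, dressed l z z' D x y (siteR M k s (z' s) y j f)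
          = (z' s / (z' s - 1)) • dressed l z z' D x j f
            - (z' s - 1)⁻¹ • if x = h then siteOp s j.1 h.1 1 (constOp S n (D h h) f) else 0 := by
        intro x
        -- Column j of the right R-matrix has just two nonzero entries on the vacuum: the diagonal
        -- one, and the one in row h that changes the site from e_h to e_j.
        have hy : ∀ y, siteR M k s (z' s) y j f
            = (if y = j then (z' s / (z' s - 1)) • f else 0)
              + if y = h then -((z' s - 1)⁻¹ • siteOp s j.1 h.1 1 f) else 0 := by
          intro y
          by_cases hyh : y = h
          · subst hyh
            rw [siteR_off_diag b0 (Ne.symm hj), if_neg (Ne.symm hj), if_pos rfl, zero_add]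
          · rw [siteR_vacuum_row hf hCs _ hyh, if_neg hyh, add_zero]
        simp only [hy, map_add, apply_ite (dressed l z z' D _ _), map_zero, Finset.sum_add_distrib,
          Finset.sum_ite_eq', Finset.mem_univ, if_true, map_smul, map_neg]
        rw [← Module.End.mul_apply (dressed l z z' D x h), ← (comm _ _ _ _).eq,
          Module.End.mul_apply, ih1, apply_ite (siteOp s _ _ _), map_zero]
        exact (sub_eq_add_neg _ _).symm
      simp only [hin, map_sub, map_smul, hrow, Finset.sum_sub_distrib, smul_ite, smul_zero,
        Finset.sum_ite_eq, apply_ite (siteR M k s (z s) _ _), map_zero, Finset.sum_ite_eq',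
        Finset.mem_univ, if_true]
      -- The two site operators e_{hi} and e_{jh} compose to δ_{ij} e_{hh}, and e_{hh} is the
      -- identity on the vacuum.
      rw [siteR_off_diag a0 hi, siteOp_siteOp, ih2 i j hi hj]
      have a1' : z s - 1 ≠ 0 := sub_ne_zero.2 a1
      have b1' : z' s - 1 ≠ 0 := sub_ne_zero.2 b1
      have ht' : t = z s + z' s - 1 := by rw [hst]; ring
      simp only [List.map_cons, List.prod_cons]
      generalize (l.map fun s => z s / (z s - 1) * (z' s / (z' s - 1))).prod = β
      by_cases hij : i = j
      · subst hij
        simp only [if_true]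
        rw [siteOp_self (hg _) hCs]
        generalize constOp S n (D i i) f = g1
        generalize constOp S n (D h h) f = g2
        match_scalars
        · field_simp
        · rw [ht'] at ht ⊢
          field_simp
          ring
      · have hij' : i.1 ≠ j.1 := fun h' => hij (Subtype.ext h')
        simp only [if_neg hij, if_neg hij']
        module

end Dressing

/-! ### Matrix operators applied to vectors -/

section Act

variable {R S T : Type} [Fintype S] [Fintype T] {M : Type*} [AddCommGroup M] [Module ℂ M]

theorem act_mul (X : Matrix R S (Module.End ℂ M)) (Y : Matrix S T (Module.End ℂ M)) (f : T → M) :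
    act (X * Y) f = act X (act Y f) := by
  funext r
  simp only [act, Matrix.mul_apply, LinearMap.sum_apply, Module.End.mul_apply, map_sum]
  exact Finset.sum_comm

theorem act_one [DecidableEq T] (f : T → M) : act (1 : Matrix T T (Module.End ℂ M)) f = f := by
  funext t
  simp only [act, Matrix.one_apply]
  rw [Finset.sum_eq_single t] <;> simp +contextual [eq_comm]

theorem act_add (X Y : Matrix R T (Module.End ℂ M)) (f : T → M) :
    act (X + Y) f = act X f + act Y f := by
  funext r
  simp [act, Finset.sum_add_distrib]

theorem act_sub (X Y : Matrix R T (Module.End ℂ M)) (f : T → M) :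
    act (X - Y) f = act X f - act Y f := by
  funext r
  simp [act]

theorem act_smul (c : ℂ) (X : Matrix R T (Module.End ℂ M)) (f : T → M) :
    act (c • X) f = c • act X f := by
  funext r
  simp [act, Finset.smul_sum]

theorem act_zero (f : T → M) : act (0 : Matrix R T (Module.End ℂ M)) f = 0 := by
  funext r
  simp [act]

theorem act_sum {K : Type*} (s : Finset K) (X : K → Matrix R T (Module.End ℂ M)) (f : T → M) :
    act (∑ a ∈ s, X a) f = ∑ a ∈ s, act (X a) f := by
  classical
  induction s using Finset.induction_on with
  | empty => simp [act_zero]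
  | insert a s ha ih => rw [Finset.sum_insert ha, Finset.sum_insert ha, act_add, ih]

end Act

/-! ### Extension by zero from reduced tensor products -/

section ZeroExtension

variable {n : ℕ} {ι : Type} [Fintype ι] [DecidableEq ι] {k : ι → ℕ} {S : Type} [DecidableEq S]
  {M : Type*} [AddCommGroup M] [Module ℂ M]

/-- The extension by zero of a function on a reduced tensor product to all configurations. -/
def zext (j : ι → S) : (Conf n k → M) →ₗ[ℂ] ((S → Fin n) → M) where
  toFun f := fun σ => if h : ∀ p, k p ≤ (σ (j p) : ℕ) + 1 then f fun p => ⟨σ (j p), h p⟩ else 0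
  map_add' f g := by funext σ; simp only [Pi.add_apply]; split_ifs <;> simp
  map_smul' c f := by funext σ; simp only [Pi.smul_apply]; split_ifs <;> simp

theorem zext_of_valid (j : ι → S) (f : Conf n k → M) {σ : S → Fin n}
    (h : ∀ p, k p ≤ (σ (j p) : ℕ) + 1) : zext j f σ = f fun p => ⟨σ (j p), h p⟩ := dif_pos h

theorem zext_of_not_valid (j : ι → S) (f : Conf n k → M) {σ : S → Fin n}
    (h : ¬ ∀ p, k p ≤ (σ (j p) : ℕ) + 1) : zext j f σ = 0 := dif_neg h

/-- The operators `X` and `X'` correspond to each other under extension by zero. -/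
def Intertwines (j : ι → S) (X : Matrix (Conf n k) (Conf n k) (Module.End ℂ M))
    (X' : Module.End ℂ ((S → Fin n) → M)) : Prop :=
  ∀ f, zext j (act X f) = X' (zext j f)

variable {j : ι → S} {X Y : Matrix (Conf n k) (Conf n k) (Module.End ℂ M)}
  {X' Y' : Module.End ℂ ((S → Fin n) → M)}

theorem Intertwines.mul (h : Intertwines j X X') (h' : Intertwines j Y Y') :
    Intertwines j (X * Y) (X' * Y') := fun f => by
  rw [act_mul, h, h', Module.End.mul_apply]

theorem Intertwines.one :
    Intertwines j (1 : Matrix (Conf n k) (Conf n k) (Module.End ℂ M)) 1 := fun f => by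
  rw [act_one, Module.End.one_apply]

theorem Intertwines.zero :
    Intertwines j (0 : Matrix (Conf n k) (Conf n k) (Module.End ℂ M)) 0 := fun f => by
  rw [act_zero, map_zero, LinearMap.zero_apply]

theorem Intertwines.sub (h : Intertwines j X X') (h' : Intertwines j Y Y') :
    Intertwines j (X - Y) (X' - Y') := fun f => by
  rw [act_sub, map_sub, h, h', LinearMap.sub_apply]

theorem Intertwines.smul (c : ℂ) (h : Intertwines j X X') :
    Intertwines j (c • X) (c • X') := fun f => by
  rw [act_smul, map_smul, h, LinearMap.smul_apply]

theorem Intertwines.sum {K : Type*} {s : Finset K}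
    {X : K → Matrix (Conf n k) (Conf n k) (Module.End ℂ M)}
    {X' : K → Module.End ℂ ((S → Fin n) → M)} (h : ∀ a ∈ s, Intertwines j (X a) (X' a)) :
    Intertwines j (∑ a ∈ s, X a) (∑ a ∈ s, X' a) := fun f => by
  rw [act_sum, map_sum, LinearMap.sum_apply]
  exact Finset.sum_congr rfl fun a ha => h a ha f

theorem Intertwines.list_prod {K : Type*} {l : List K}
    {X : K → Matrix (Conf n k) (Conf n k) (Module.End ℂ M)}
    {X' : K → Module.End ℂ ((S → Fin n) → M)} (h : ∀ a ∈ l, Intertwines j (X a) (X' a)) :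
    Intertwines j (l.map X).prod (l.map X').prod := by
  induction l with
  | nil => exact Intertwines.one
  | cons a l ih =>
    simp only [List.map_cons, List.prod_cons]
    exact (h a (by simp)).mul (ih fun b hb => h b (by simp [hb]))

theorem Intertwines.list_prod_apply {Q K : Type*} [Fintype Q] [DecidableEq Q] {l : List K}
    {X : K → Matrix Q Q (Matrix (Conf n k) (Conf n k) (Module.End ℂ M))}
    {X' : K → Matrix Q Q (Module.End ℂ ((S → Fin n) → M))}
    (h : ∀ a ∈ l, ∀ x y, Intertwines j (X a x y) (X' a x y)) (x y : Q) :
    Intertwines j ((l.map X).prod x y) ((l.map X').prod x y) := by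
  induction l generalizing x y with
  | nil =>
    simp only [List.map_nil, List.prod_nil, Matrix.one_apply]
    split_ifs
    · exact Intertwines.one
    · exact Intertwines.zero
  | cons a l ih =>
    simp only [List.map_cons, List.prod_cons, Matrix.mul_apply]
    exact Intertwines.sum fun b _ => (h a (by simp) x b).mul (ih (fun c hc => h c (by simp [hc])) b y)

theorem act_siteElt (p : ι) (x y : Fin n) (hy : k p ≤ (y : ℕ) + 1) (α : Module.End ℂ M)
    (f : Conf n k → M) (s : Conf n k) :
    act (siteElt p x y α) f s = if (s p).1 = x then α (f (Function.update s p ⟨y, hy⟩)) else 0 := by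
  simp only [act, siteElt, Matrix.of_apply]
  rw [Finset.sum_eq_single (Function.update s p ⟨y, hy⟩)]
  · by_cases h : (s p).1 = x
    · rw [if_pos h, if_pos]
      exact ⟨h, by simp, fun z hz => (Function.update_of_ne hz _ _).symm⟩
    · rw [if_neg h, if_neg (fun h' => h h'.1), LinearMap.zero_apply]
  · intro t _ ht
    rw [if_neg, LinearMap.zero_apply]
    rintro ⟨-, h2, h3⟩
    apply ht
    funext z
    rcases eq_or_ne z p with rfl | hz
    · rw [Function.update_self]; exact Subtype.ext h2
    · rw [Function.update_of_ne hz, h3 z hz]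
  · simp

/-- The bounds on x and y say that the matrix unit acts inside the reduced factor. The one on x
keeps the image supported on reduced configurations; the one on y makes its argument a reduced basis
vector. -/
theorem intertwines_siteElt (hj : Function.Injective j) (p : ι) (x y : Fin n)
    (hx : k p ≤ (x : ℕ) + 1) (hy : k p ≤ (y : ℕ) + 1) (α : Module.End ℂ M) :
    Intertwines j (siteElt (k := k) p x y α) (siteOp (j p) x y α) := by
  intro f
  funext σ
  rw [siteOp_apply]
  by_cases h : ∀ q, k q ≤ (σ (j q) : ℕ) + 1
  · rw [zext_of_valid j _ h, act_siteElt p x y hy]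
    have h' : ∀ q, k q ≤ (Function.update σ (j p) y (j q) : ℕ) + 1 := by
      intro q
      rcases eq_or_ne q p with rfl | hq
      · rwa [Function.update_self]
      · rw [Function.update_of_ne (hj.ne hq)]; exact h q
    rw [zext_of_valid j _ h']
    congr 3
    funext q
    rcases eq_or_ne q p with rfl | hq
    · rw [Function.update_self]; exact Subtype.ext (by simp)
    · rw [Function.update_of_ne hq]; exact Subtype.ext (by simp [Function.update_of_ne (hj.ne hq)])
  · rw [zext_of_not_valid j _ h]
    split_ifs with hσ
    · rw [zext_of_not_valid, map_zero]
      intro h'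
      apply h
      intro q
      rcases eq_or_ne q p with rfl | hq
      · rwa [hσ]
      · have := h' q
        rwa [Function.update_of_ne (hj.ne hq)] at this
    · rfl

end ZeroExtension

/-! ### Splitting off the labels of the top level -/

section Monodromy

/-- The labels of all levels. -/
abbrev Site (m : ℕ → ℕ) : Type := (b : ℕ) × Fin (m b)

variable {n : ℕ} {m : ℕ → ℕ} {M : Type*} [AddCommGroup M] [Module ℂ M]

/-- A label of the levels `1, …, d`, as a label. -/
def Lab.site {d : ℕ} (p : Lab m d) : Site m := ⟨p.1.1, p.2⟩

theorem Lab.site_injective {d : ℕ} : Function.Injective (Lab.site : Lab m d → Site m) := by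
  rintro ⟨⟨b, hb⟩, c⟩ ⟨⟨b', hb'⟩, c'⟩ h
  simp only [Lab.site, Sigma.mk.injEq] at h
  obtain ⟨rfl, h⟩ := h
  obtain rfl := eq_of_heq h
  rfl

/-- A basis vector of the tensor product over the labels of levels `1, …, d + 1`, assembled from
its components. -/
def WConf.join {d : ℕ} (w : WConf n m d) (t : Fin (m (d + 1)) → Idx n (d + 2)) :
    WConf n m (d + 1)
  | ⟨⟨b, hb⟩, c⟩ =>
    if h : b = d + 1 then by subst h; exact t c
    else w ⟨⟨b, by rw [Finset.mem_Icc] at *; omega⟩, c⟩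

theorem WConf.lower_join {d : ℕ} (w : WConf n m d) (t : Fin (m (d + 1)) → Idx n (d + 2)) :
    (w.join t).lower = w := by
  funext ⟨⟨b, hb⟩, c⟩
  have : b ≠ d + 1 := by rw [Finset.mem_Icc] at hb; omega
  simp [WConf.lower, WConf.join, this]

theorem WConf.top_join {d : ℕ} (w : WConf n m d) (t : Fin (m (d + 1)) → Idx n (d + 2)) :
    (w.join t).top = t := by
  funext c
  simp [WConf.top, WConf.join, lab]

theorem WConf.join_lower_top {d : ℕ} (s : WConf n m (d + 1)) : s.lower.join s.top = s := by
  funext ⟨⟨b, hb⟩, c⟩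
  simp only [WConf.join]
  split_ifs with h
  · subst h; rfl
  · rfl

/-- Splitting off the components of level `d + 1`. -/
def WConf.splitEquiv (n : ℕ) (m : ℕ → ℕ) (d : ℕ) :
    (Fin (m (d + 1)) → Idx n (d + 2)) × WConf n m d ≃ WConf n m (d + 1) where
  toFun q := q.2.join q.1
  invFun s := (s.top, s.lower)
  left_inv q := Prod.ext (WConf.top_join _ _) (WConf.lower_join _ _)
  right_inv s := s.join_lower_top

theorem sum_wconf {d : ℕ} {E : Type*} [AddCommMonoid E] (F : WConf n m (d + 1) → E) :
    ∑ s, F s = ∑ t : Fin (m (d + 1)) → Idx n (d + 2), ∑ w : WConf n m d, F (w.join t) := by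
  rw [← (WConf.splitEquiv n m d).sum_comp, Fintype.sum_prod_type]
  rfl

theorem act_extend {d : ℕ} (Z : Matrix (WConf n m d) (WConf n m d) (Module.End ℂ M))
    (f : WConf n m (d + 1) → M) (s : WConf n m (d + 1)) :
    act (extend Z) f s = act Z (fun w => f (w.join s.top)) s.lower := by
  simp only [act, extend, Matrix.of_apply, sum_wconf, WConf.lower_join, WConf.top_join]
  rw [Finset.sum_eq_single s.top]
  · simp
  · intro t _ ht
    simp [Ne.symm ht]
  · simp

/-- The components at level `d + 1` of a configuration. -/
def topConf {d : ℕ} (σ : Site m → Fin n) (h : ∀ c, d + 2 ≤ (σ ⟨d + 1, c⟩ : ℕ) + 1) :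
    Fin (m (d + 1)) → Idx n (d + 2) := fun c => ⟨σ ⟨d + 1, c⟩, h c⟩

theorem valid_succ_iff {d : ℕ} (σ : Site m → Fin n) :
    (∀ p : Lab m (d + 1), (p.1 : ℕ) + 1 ≤ (σ p.site : ℕ) + 1) ↔
      (∀ c, d + 2 ≤ (σ ⟨d + 1, c⟩ : ℕ) + 1) ∧
        ∀ p : Lab m d, (p.1 : ℕ) + 1 ≤ (σ p.site : ℕ) + 1 := by
  constructor
  · intro h
    exact ⟨fun c => h (lab (d + 1) ⟨by omega, le_rfl⟩ c),
      fun p => h ⟨⟨p.1, Finset.Icc_subset_Icc_right (Nat.le_succ d) p.1.2⟩, p.2⟩⟩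
  · rintro ⟨h1, h2⟩ ⟨⟨b, hb⟩, c⟩
    rcases eq_or_ne b (d + 1) with rfl | hbd
    · exact h1 c
    · exact h2 ⟨⟨b, by rw [Finset.mem_Icc] at *; omega⟩, c⟩

theorem zext_succ_of_valid {d : ℕ} (f : WConf n m (d + 1) → M) {σ : Site m → Fin n}
    (h : ∀ c, d + 2 ≤ (σ ⟨d + 1, c⟩ : ℕ) + 1) :
    zext Lab.site f σ
      = zext (Lab.site : Lab m d → Site m) (fun w : WConf n m d => f (w.join (topConf σ h))) σ := by
  by_cases h' : ∀ p : Lab m d, (p.1 : ℕ) + 1 ≤ (σ p.site : ℕ) + 1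
  · rw [zext_of_valid _ _ h', zext_of_valid _ _ ((valid_succ_iff σ).2 ⟨h, h'⟩)]
    rw [← WConf.join_lower_top (d := d) (fun p : Lab m (d + 1) => ⟨σ p.site, _⟩)]
    rfl
  · rw [zext_of_not_valid _ _ h', zext_of_not_valid]
    exact fun h'' => h' ((valid_succ_iff σ).1 h'').2

theorem zext_succ_of_not_valid {d : ℕ} (f : WConf n m (d + 1) → M) {σ : Site m → Fin n}
    (h : ¬ ∀ c, d + 2 ≤ (σ ⟨d + 1, c⟩ : ℕ) + 1) : zext Lab.site f σ = 0 :=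
  zext_of_not_valid _ _ fun h' => h ((valid_succ_iff σ).1 h').1

/-- The configuration with the components `t` at level `d`. -/
def setLevel (d : ℕ) (t : Fin (m d) → Fin n) (σ : Site m → Fin n) : Site m → Fin n :=
  fun s => if h : s.1 = d then t (h ▸ s.2) else σ s

theorem setLevel_self (d : ℕ) (t : Fin (m d) → Fin n) (σ : Site m → Fin n) (c : Fin (m d)) :
    setLevel d t σ ⟨d, c⟩ = t c := by simp [setLevel]

theorem setLevel_of_ne {d : ℕ} (t : Fin (m d) → Fin n) (σ : Site m → Fin n) {s : Site m}
    (h : s.1 ≠ d) : setLevel d t σ s = σ s := by simp [setLevel, h]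

theorem zext_congr {d : ℕ} (f : WConf n m d → M) {σ τ : Site m → Fin n}
    (h : ∀ s : Site m, s.1 ≤ d → σ s = τ s) : zext Lab.site f σ = zext Lab.site f τ := by
  have e : ∀ p : Lab m d, σ p.site = τ p.site := fun p => h _ (Finset.mem_Icc.1 p.1.2).2
  simp only [zext, LinearMap.coe_mk, AddHom.coe_mk, e]

/-- The component of a function at a basis vector of the labels of level `d + 1`. -/
theorem zext_join {d : ℕ} (f : WConf n m (d + 1) → M) (t : Fin (m (d + 1)) → Idx n (d + 2))
    (σ : Site m → Fin n) :
    zext (Lab.site : Lab m d → Site m) (fun w : WConf n m d => f (w.join t)) σ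
      = zext Lab.site f (setLevel (d + 1) (fun c => (t c).1) σ) := by
  have h : ∀ c, d + 2 ≤ (setLevel (d + 1) (fun c => (t c).1) σ ⟨d + 1, c⟩ : ℕ) + 1 := by
    intro c; rw [setLevel_self]; exact (t c).2
  rw [zext_succ_of_valid f h]
  have ht : topConf _ h = t := by
    funext c; exact Subtype.ext (setLevel_self (d + 1) (fun c => (t c).1) σ c)
  rw [ht]
  exact zext_congr _ fun s hs => (setLevel_of_ne _ _ (by omega)).symm

end Monodromy

/-! ### Collapse of the recursion for the nested monodromy matrices -/

section Nesting

variable {n : ℕ} {m : ℕ → ℕ} {M : Type*} [AddCommGroup M] [Module ℂ M]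

/-- A decreasing family of spaces on which the nesting procedure works: `N d` is stable under the
entries of `B` with indices `≥ d` and the diagonal entries, and the entries of column `d` below
the diagonal vanish on `N (d + 1)`. -/
structure NestedKernels (B : ℂ → Matrix (Fin n) (Fin n) (Module.End ℂ M)) (Reg : ℂ → Prop)
    (N : ℕ → Submodule ℂ M) : Prop where
  anti : ∀ d, N (d + 1) ≤ N d
  map : ∀ d v i j ζ, Reg v → (d ≤ i.1 ∧ d ≤ j.1 ∨ i = j) → ζ ∈ N d → B v i j ζ ∈ N d
  lower : ∀ v i j ζ, Reg v → j < i → ζ ∈ N (j.1 + 1) → B v i j ζ = 0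

/-- The values `v` at which the level-`(d+1)` monodromy matrix can be evaluated. -/
structure Admissible (Reg : ℂ → Prop) (ρ : ℂ) (u : (k : ℕ) → Fin (m k) → ℂ) (d : ℕ) (v : ℂ) :
    Prop where
  reg : Reg (v + d / 2)
  shift : ∀ q < d, 2 * v + q + ρ ≠ 0
  plus : ∀ b, 1 ≤ b → b ≤ d → ∀ c : Fin (m b),
    v + u b c + ρ + ((d : ℂ) - b) / 2 ≠ 0 ∧ v + u b c + ρ + ((d : ℂ) - b) / 2 ≠ 1
  minus : ∀ b, 1 ≤ b → b ≤ d → ∀ c : Fin (m b),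
    v - u b c + ((d : ℂ) - b) / 2 ≠ 0 ∧ v - u b c + ((d : ℂ) - b) / 2 ≠ 1

theorem Admissible.pred {Reg : ℂ → Prop} {ρ : ℂ} {u : (k : ℕ) → Fin (m k) → ℂ} {d : ℕ} {v : ℂ}
    (h : Admissible Reg ρ u (d + 1) v) : Admissible Reg ρ u d (v + 1 / 2) where
  reg := by convert h.reg using 1; push_cast; ring
  shift q hq := by
    convert h.shift (q + 1) (by omega) using 1; push_cast; ring
  plus b hb hb' c := by
    have e : v + 1 / 2 + u b c + ρ + ((d : ℂ) - b) / 2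
        = v + u b c + ρ + (((d + 1 : ℕ) : ℂ) - b) / 2 := by push_cast; ring
    rw [e]
    exact h.plus b hb (by omega) c
  minus b hb hb' c := by
    have e : v + 1 / 2 - u b c + ((d : ℂ) - b) / 2
        = v - u b c + (((d + 1 : ℕ) : ℂ) - b) / 2 := by push_cast; ring
    rw [e]
    exact h.minus b hb (by omega) c

/-- The labels of level `d ≥ 1`. -/
def sites (m : ℕ → ℕ) : ℕ → List (Site m)
  | 0 => []
  | d + 1 => List.ofFn fun c : Fin (m (d + 1)) => ⟨d + 1, c⟩

theorem mem_sites {d : ℕ} {s : Site m} : s ∈ sites m d ↔ 1 ≤ d ∧ s.1 = d := by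
  cases d with
  | zero => simp [sites]
  | succ d =>
    obtain ⟨b, c⟩ := s
    simp only [sites, List.mem_ofFn]
    constructor
    · rintro ⟨c', h⟩
      rw [Sigma.mk.injEq] at h
      exact ⟨by omega, h.1.symm⟩
    · rintro ⟨-, h⟩
      obtain rfl : b = d + 1 := h
      exact ⟨c, rfl⟩

theorem nodup_sites (d : ℕ) : (sites m d).Nodup := by
  cases d with
  | zero => exact List.nodup_nil
  | succ d =>
    refine List.nodup_ofFn.2 fun c c' h => ?_
    simpa using h

variable (B : ℂ → Matrix (Fin n) (Fin n) (Module.End ℂ M)) (ρ : ℂ)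
  (u : (k : ℕ) → Fin (m k) → ℂ)

/-- The contribution of the labels of the levels `1, …, d - 1`, which are in the vacuum state, to
the level-`(d+1)` monodromy matrix. -/
def vacuumFactor (d : ℕ) (v : ℂ) : ℂ :=
  ∏ b ∈ Finset.Ico 1 d, ∏ c : Fin (m b),
    ((v + u b c + ρ + ((d : ℂ) - b) / 2) / (v + u b c + ρ + ((d : ℂ) - b) / 2 - 1)
      * ((v - u b c + ((d : ℂ) - b) / 2) / (v - u b c + ((d : ℂ) - b) / 2 - 1)))

/-- The action of the level-`(d+1)` monodromy matrix on vectors that are in the vacuum state at the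
labels of the levels `1, …, d - 1`. -/
def levelMonodromy (d : ℕ) (v : ℂ) :
    Matrix (Idx n (d + 1)) (Idx n (d + 1)) (Module.End ℂ ((Site m → Fin n) → M)) :=
  dressed (sites m d) (fun s => v + u s.1 s.2 + ρ) (fun s => v - u s.1 s.2)
    (vacuumFactor ρ u d v • Dhat B ρ (d + 1) v)

theorem vacuumFactor_succ (d : ℕ) (v : ℂ) :
    vacuumFactor ρ u (d + 1) v = ((sites m d).map fun s =>
      (v + 1 / 2 + u s.1 s.2 + ρ) / (v + 1 / 2 + u s.1 s.2 + ρ - 1)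
        * ((v + 1 / 2 - u s.1 s.2) / (v + 1 / 2 - u s.1 s.2 - 1))).prod
      * vacuumFactor ρ u d (v + 1 / 2) := by
  cases d with
  | zero => simp [vacuumFactor, sites]
  | succ d =>
    rw [vacuumFactor, Finset.prod_Ico_succ_top (by omega), mul_comm, vacuumFactor]
    congr 1
    · simp only [sites, List.map_ofFn, List.prod_ofFn]
      refine Finset.prod_congr rfl fun c _ => ?_
      have e1 : v + u (d + 1) c + ρ + (((d + 1 + 1 : ℕ) : ℂ) - (d + 1 : ℕ)) / 2
          = v + 1 / 2 + u (d + 1) c + ρ := by push_cast; ring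
      have e2 : v - u (d + 1) c + (((d + 1 + 1 : ℕ) : ℂ) - (d + 1 : ℕ)) / 2
          = v + 1 / 2 - u (d + 1) c := by push_cast; ring
      rw [e1, e2]; rfl
    · refine Finset.prod_congr rfl fun b _ => Finset.prod_congr rfl fun c _ => ?_
      have e1 : v + u b c + ρ + (((d + 1 + 1 : ℕ) : ℂ) - b) / 2
          = v + 1 / 2 + u b c + ρ + (((d + 1 : ℕ) : ℂ) - b) / 2 := by push_cast; ring
      have e2 : v - u b c + (((d + 1 + 1 : ℕ) : ℂ) - b) / 2
          = v + 1 / 2 - u b c + (((d + 1 : ℕ) : ℂ) - b) / 2 := by push_cast; ring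
      rw [e1, e2]

theorem Dhat_apply {A : Type*} [Ring A] [Algebra ℂ A] (B : ℂ → Matrix (Fin n) (Fin n) A) (d : ℕ)
    (v : ℂ) (i j : Idx n (d + 1)) :
    Dhat B ρ (d + 1) v i j = B (v + d / 2) i.1 j.1 + if i = j then
      (2 * v + ρ)⁻¹ • ∑ l ∈ Finset.univ.filter (fun l : Fin n => (l : ℕ) < d), B (v + d / 2) l l
      else 0 := by
  have h : (((d + 1 : ℕ) : ℂ) - 1) / 2 = d / 2 := by push_cast; ring
  simp only [Dhat, Matrix.of_apply, h]
  congr 3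
  rw [← Finset.sum_subtype_eq_sum_filter, Finset.subtype_univ]
  refine (Fintype.sum_equiv (Equiv.subtypeEquivRight fun l => ?_) _ _ fun l => ?_)
  · simp
  · rfl

/-- `Dhat` without dressing satisfies the same recursion as the monodromy matrices. The coefficients
of the earlier diagonal entries match because 1/(2v+ρ) = 1/(2v+1+ρ) + 1/((2v+ρ)(2v+1+ρ)). -/
theorem Dhat_succ {A : Type*} [Ring A] [Algebra ℂ A] (B : ℂ → Matrix (Fin n) (Fin n) A) {d : ℕ}
    {v : ℂ} (h0 : 2 * v + ρ ≠ 0) (h1 : 1 ≤ d → 2 * v + 1 + ρ ≠ 0) (i j : Idx n (d + 2)) :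
    Dhat B ρ (d + 2) v i j = Dhat B ρ (d + 1) (v + 1 / 2) i.up j.up
      + if i = j then (2 * v + ρ)⁻¹ • Dhat B ρ (d + 1) (v + 1 / 2) i.head i.head else 0 := by
  have e : v + ((d + 1 : ℕ) : ℂ) / 2 = v + 1 / 2 + d / 2 := by push_cast; ring
  have hup : (i.up = j.up) ↔ i = j := by
    simp only [Idx.up, Subtype.mk.injEq]; exact Subtype.ext_iff.symm
  rw [Dhat_apply, Dhat_apply, Dhat_apply, e, if_pos rfl]
  have hup' : ∀ i : Idx n (d + 2), i.up.1 = i.1 := fun _ => rfl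
  simp only [hup, hup']
  by_cases hij : i = j
  · simp only [if_pos hij]
    have hs : Finset.univ.filter (fun l : Fin n => (l : ℕ) < d + 1)
        = insert i.head.1 (Finset.univ.filter (fun l : Fin n => (l : ℕ) < d)) := by
      ext l
      simp only [Finset.mem_filter, Finset.mem_univ, true_and, Finset.mem_insert, Idx.head,
        Fin.ext_iff]
      omega
    rw [hs, Finset.sum_insert (by simp [Idx.head])]
    -- For d = 0 there are no earlier diagonal entries, so 2v+1+ρ need not be nonzero.
    have hscal : ∀ s : A, (d = 0 → s = 0) → (2 * v + ρ)⁻¹ • s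
        = (2 * (v + 1 / 2) + ρ)⁻¹ • s + ((2 * v + ρ)⁻¹ * (2 * (v + 1 / 2) + ρ)⁻¹) • s := by
      intro s hs
      rcases Nat.eq_zero_or_pos d with hd | hd
      · simp [hs hd]
      · have h2 : 2 * (v + 1 / 2) + ρ = 2 * v + 1 + ρ := by ring
        have h3 := h1 hd
        rw [← add_smul, h2]
        congr 1
        field_simp
        ring
    rw [smul_add (2 * v + ρ)⁻¹, hscal (∑ l ∈ Finset.univ.filter (fun l : Fin n => (l : ℕ) < d), _)]
    · rw [smul_add (2 * v + ρ)⁻¹, smul_smul]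
      abel
    · rintro rfl; simp
  · simp [hij]

variable {B ρ u} {Reg : ℂ → Prop} {N : ℕ → Submodule ℂ M}

theorem NestedKernels.Dhat_mem (hN : NestedKernels B Reg N) {d : ℕ} {v : ℂ} (hv : Reg (v + d / 2))
    (i j : Idx n (d + 1)) {ζ : M} (hζ : ζ ∈ N d) : Dhat B ρ (d + 1) v i j ζ ∈ N d := by
  rw [Dhat_apply, LinearMap.add_apply]
  refine (N d).add_mem (hN.map _ _ _ _ _ hv (Or.inl ⟨?_, ?_⟩) hζ) ?_
  · have := i.2; omega
  · have := j.2; omega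
  split_ifs
  · rw [LinearMap.smul_apply, LinearMap.sum_apply]
    exact (N d).smul_mem _ ((N d).sum_mem fun l _ => hN.map _ _ _ _ _ hv (Or.inr rfl) hζ)
  · exact (N d).zero_mem

/-- The values allowed at the labels of the levels `1, …, d` by the level-`(d+1)` nested vectors. -/
def levelSet (n : ℕ) (m : ℕ → ℕ) (d : ℕ) (s : Site m) : Set (Fin n) :=
  {i | (1 ≤ s.1 → s.1 < d → (i : ℕ) = s.1) ∧ (s.1 = d → d ≤ i)}

/-- The vectors of level `d + 1` that are in the vacuum state at the labels of the levels
`1, …, d - 1`. -/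
def levelSpace (m : ℕ → ℕ) (N : ℕ → Submodule ℂ M) (d : ℕ) :
    Submodule ℂ ((Site m → Fin n) → M) :=
  supp M (levelSet n m d) ⊓ valuedIn _ _ (N d)

theorem siteOp_mem_levelSpace {d : ℕ} {s : Site m} (hs : s ∈ sites m d) (x : Idx n (d + 1))
    (y : Fin n) {f : (Site m → Fin n) → M} (hf : f ∈ levelSpace m N d) :
    siteOp s x.1 y 1 f ∈ levelSpace m N d := by
  refine ⟨siteOp_mem_supp hf.1 ⟨?_, ?_⟩ _, siteOp_mem_valuedIn hf.2 _ _ _⟩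
  · intro _ h
    rw [(mem_sites.1 hs).2] at h
    exact absurd h (lt_irrefl _)
  · intro _; have := x.2; omega

theorem constOp_mem_levelSpace (hN : NestedKernels B Reg N) {d : ℕ} {v : ℂ}
    (hv : Reg (v + d / 2)) (a : ℂ) (x y : Idx n (d + 1)) {f : (Site m → Fin n) → M}
    (hf : f ∈ levelSpace m N d) :
    constOp _ n ((a • Dhat B ρ (d + 1) v) x y) f ∈ levelSpace m N d := by
  refine ⟨constOp_mem_supp hf.1 _, mem_valuedIn.2 fun σ => ?_⟩
  exact (N d).smul_mem _ (hN.Dhat_mem hv x y (mem_valuedIn.1 hf.2 σ))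

theorem levelMonodromy_mem (hN : NestedKernels B Reg N) {d : ℕ} {v : ℂ}
    (hv : Reg (v + d / 2)) (x y : Idx n (d + 1)) {f : (Site m → Fin n) → M}
    (hf : f ∈ levelSpace m N d) : levelMonodromy B ρ u d v x y f ∈ levelSpace m N d :=
  dressed_mem (fun _ hs x _ _ hf => siteOp_mem_levelSpace hs x _ hf)
    (fun _ _ _ hf => constOp_mem_levelSpace hN hv _ _ _ hf) x y hf

theorem list_prod_apply_mem {Q K E : Type*} [Fintype Q] [DecidableEq Q] [AddCommGroup E]
    [Module ℂ E] {W : Submodule ℂ E} {l : List K} {X : K → Matrix Q Q (Module.End ℂ E)}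
    (h : ∀ a ∈ l, ∀ x y, ∀ f ∈ W, X a x y f ∈ W) (x y : Q) {f : E} (hf : f ∈ W) :
    (l.map X).prod x y f ∈ W := by
  induction l generalizing x y f with
  | nil =>
    simp only [List.map_nil, List.prod_nil, Matrix.one_apply]
    split_ifs
    · exact hf
    · exact W.zero_mem
  | cons a l ih =>
    simp only [List.map_cons, List.prod_cons, Matrix.mul_apply, LinearMap.sum_apply,
      Module.End.mul_apply]
    exact W.sum_mem fun b _ => h a (by simp) _ _ _ (ih (fun c hc => h c (by simp [hc])) _ _ hf)

theorem siteR_mem_levelSpace {d : ℕ} {s : Site m} (hs : s ∈ sites m d) (z : ℂ)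
    (x y : Idx n (d + 1)) {f : (Site m → Fin n) → M} (hf : f ∈ levelSpace m N d) :
    siteR M (d + 1) s z x y f ∈ levelSpace m N d := by
  rw [siteR_apply]
  refine Submodule.smul_mem _ _ (Submodule.sub_mem _ ?_
    (Submodule.smul_mem _ _ (siteOp_mem_levelSpace hs _ _ hf)))
  split_ifs
  · exact hf
  · exact Submodule.zero_mem _

theorem intertwines_Raux {d : ℕ} (c : Fin (m (d + 1))) (z : ℂ) (x y : Idx n (d + 2)) :
    Intertwines (M := M) Lab.site (Raux (m := m) (d + 2) (lab (d + 1) ⟨by omega, le_rfl⟩ c) z x y)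
      (siteR M (d + 2) (⟨d + 1, c⟩ : Site m) z x y) := by
  rw [siteR_apply]
  simp only [Raux, Matrix.smul_apply, Matrix.sub_apply, Matrix.of_apply, Matrix.one_apply]
  refine Intertwines.smul _ (Intertwines.sub ?_ (Intertwines.smul _ ?_))
  · split_ifs
    · exact Intertwines.one
    · exact Intertwines.zero
  · exact intertwines_siteElt Lab.site_injective (lab (d + 1) ⟨by omega, le_rfl⟩ c) y.1 x.1 y.2 x.2 1

/-- The components at level `d + 1` of a vector of level `d + 2` are vectors of level `d + 1`. -/
theorem zext_join_mem (hN : NestedKernels B Reg N) {d : ℕ} {f : WConf n m (d + 1) → M}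
    (hf : zext Lab.site f ∈ levelSpace m N (d + 1)) (t : Fin (m (d + 1)) → Idx n (d + 2)) :
    zext (Lab.site : Lab m d → Site m) (fun w : WConf n m d => f (w.join t)) ∈ levelSpace m N d ∧
    zext (Lab.site : Lab m d → Site m) (fun w : WConf n m d => f (w.join t)) ∈ supp M
      (fun s => {i | 1 ≤ s.1 → s.1 < d + 1 → (i : ℕ) = s.1}) ∧
    ∀ σ, zext (Lab.site : Lab m d → Site m) (fun w : WConf n m d => f (w.join t)) σ
      ∈ N (d + 1) := by
  have h2 : zext (Lab.site : Lab m d → Site m) (fun w : WConf n m d => f (w.join t)) ∈ supp M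
      (fun s => {i | 1 ≤ s.1 → s.1 < d + 1 → (i : ℕ) = s.1}) := by
    intro σ s hs
    rw [zext_join]
    simp only [Set.mem_ofPred_eq, not_forall] at hs
    obtain ⟨h1, h2, h3⟩ := hs
    refine hf.1 _ s fun h => h3 ?_
    rw [← h.1 h1 h2, setLevel_of_ne _ _ (by omega)]
  have h3 : ∀ σ, zext (Lab.site : Lab m d → Site m) (fun w : WConf n m d => f (w.join t)) σ
      ∈ N (d + 1) := by
    intro σ
    rw [zext_join]
    exact mem_valuedIn.1 hf.2 _
  refine ⟨⟨supp_mono (C' := levelSet n m d)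
    (fun s i (hi : 1 ≤ s.1 → s.1 < d + 1 → (i : ℕ) = s.1) => ⟨fun h1 h2 => hi h1 (by omega), fun h => ?_⟩) h2,
    mem_valuedIn.2 fun σ => hN.anti d (h3 σ)⟩, h2, h3⟩
  rcases Nat.eq_zero_or_pos d with hd | hd
  · omega
  · have := hi (by omega) (by omega); omega

/-- Induction on the level. With the components at level d+1 fixed, a vector of `levelSpace` at d+1
is in the vacuum state at level d as well and has values in N_{d+1}. So the dressing by level d in
the inner monodromy matrix is evaluated by `dressed_vacuum`, and only the outer R-matrices of level
d+1 survive. -/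
theorem zext_monodromy (hN : NestedKernels B Reg N) {d : ℕ} {v : ℂ}
    (hv : Admissible Reg ρ u d v) (x y : Idx n (d + 1)) {f : WConf n m d → M}
    (hf : zext Lab.site f ∈ levelSpace m N d) :
    zext Lab.site (act (monodromy B ρ m u d v x y) f)
      = levelMonodromy B ρ u d v x y (zext Lab.site f) := by
  induction d generalizing v with
  | zero =>
    have hD : Dhat B ρ 1 v x y = B v x.1 y.1 := by
      rw [Dhat_apply]; simp
    have hact : act (monodromy B ρ m u 0 v x y) f = fun t => B v x.1 y.1 (f t) := by
      funext t
      simp only [act, monodromy, Matrix.of_apply]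
      rw [Finset.sum_eq_single t]
      · rw [Matrix.diagonal_apply_eq]
      · intro t' _ ht'
        rw [Matrix.diagonal_apply_ne _ (Ne.symm ht'), LinearMap.zero_apply]
      · simp
    rw [hact]
    have hG : levelMonodromy B ρ u 0 v x y = constOp _ n (B v x.1 y.1) := by
      rw [levelMonodromy, sites, dressed_nil, Matrix.map_apply, Matrix.smul_apply, hD]
      simp [vacuumFactor]
    rw [hG]
    funext σ
    rw [constOp_apply]
    by_cases h : ∀ p : Lab m 0, (p.1 : ℕ) + 1 ≤ (σ p.site : ℕ) + 1
    · rw [zext_of_valid _ _ h, zext_of_valid _ _ h]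
    · rw [zext_of_not_valid _ _ h, zext_of_not_valid _ _ h, map_zero]
  | succ d ih =>
    have hv' := hv.pred
    have h0 : 2 * v + ρ ≠ 0 := by simpa using hv.shift 0 (by omega)
    have h1 : 1 ≤ d → 2 * v + 1 + ρ ≠ 0 := fun hd => by
      simpa using hv.shift 1 (by omega)
    -- The matrix between the outer R-matrices does not touch the labels of level d+1, and on this
    -- space it reduces to a scalar multiple of `Dhat`.
    have hmid : ∀ (i j : Idx n (d + 2)) (g : WConf n m (d + 1) → M),
        zext Lab.site g ∈ levelSpace m N (d + 1) →
        zext Lab.site (act (extend (monodromy B ρ m u d (v + 1 / 2) i.up j.up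
            + if i = j then (2 * v + ρ)⁻¹ • monodromy B ρ m u d (v + 1 / 2) i.head i.head
              else 0)) g)
          = constOp _ n ((vacuumFactor ρ u (d + 1) v • Dhat B ρ (d + 2) v) i j)
            (zext Lab.site g) := by
      intro i j g hg
      funext σ
      rw [constOp_apply]
      by_cases hσ : ∀ c, d + 2 ≤ (σ ⟨d + 1, c⟩ : ℕ) + 1
      · obtain ⟨k1, k2, k3⟩ := zext_join_mem hN hg (topConf σ hσ)
        have hup : ∀ i : Idx n (d + 2), i.up ≠ i.head := by
          intro i h
          have h' := congrArg (fun z : Idx n (d + 1) => (z.1 : ℕ)) h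
          have := i.2
          simp only [Idx.up, Idx.head] at h'
          omega
        have hji : j.head = i.head := rfl
        have huu : (i.up = j.up) ↔ i = j := by
          simp only [Idx.up, Subtype.mk.injEq]; exact Subtype.ext_iff.symm
        -- The arguments of the two R-matrices at a site add up to 2v+ρ+1, so t is the denominator
        -- 2v+ρ of the recursion. The terms (β-1)/t and 1/t then add to β/t.
        have hvac := dressed_vacuum (nodup_sites d) (z := fun s => v + 1 / 2 + u s.1 s.2 + ρ)
          (z' := fun s => v + 1 / 2 - u s.1 s.2) (t := 2 * v + ρ) h0 (fun s _ => by ring)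
          (fun s hs => by
            obtain ⟨hd, hs⟩ := mem_sites.1 hs
            have := hv'.plus s.1 (by omega) (by omega) s.2
            simpa [hs] using this)
          (fun s hs => by
            obtain ⟨hd, hs⟩ := mem_sites.1 hs
            have := hv'.minus s.1 (by omega) (by omega) s.2
            simpa [hs] using this)
          (D := vacuumFactor ρ u d (v + 1 / 2) • Dhat B ρ (d + 1) (v + 1 / 2)) k2
          (h := i.head) (fun s hs i' hi' => by
            obtain ⟨hd, hs⟩ := mem_sites.1 hs
            refine Set.mem_singleton_iff.2 (Fin.ext ?_)
            rw [hi' (by omega) (by omega), hs]; rfl)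
          (fun x hx τ => by
            rw [Matrix.smul_apply, LinearMap.smul_apply, Dhat_apply, if_neg hx, add_zero,
              hN.lower _ _ _ _ hv'.reg _ (k3 τ), smul_zero]
            have := x.2
            rw [Fin.lt_def]
            rcases Nat.lt_or_ge d x.1 with h | h
            · exact h
            · exact absurd (Subtype.ext (Fin.ext (by simp only [Idx.head]; omega))) hx)
        rw [zext_succ_of_valid _ hσ, zext_succ_of_valid _ hσ]
        have hact : (fun w : WConf n m d => act (extend (monodromy B ρ m u d (v + 1 / 2) i.up j.up
            + if i = j then (2 * v + ρ)⁻¹ • monodromy B ρ m u d (v + 1 / 2) i.head i.head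
              else 0)) g (w.join (topConf σ hσ)))
            = act (monodromy B ρ m u d (v + 1 / 2) i.up j.up)
                (fun w : WConf n m d => g (w.join (topConf σ hσ)))
              + if i = j then (2 * v + ρ)⁻¹ • act (monodromy B ρ m u d (v + 1 / 2) i.head i.head)
                (fun w : WConf n m d => g (w.join (topConf σ hσ))) else 0 := by
          funext w
          rw [act_extend, WConf.lower_join, WConf.top_join, act_add]
          split_ifs
          · rw [act_smul]
          · rw [act_zero]
        rw [hact, map_add, ih hv' _ _ k1, apply_ite (zext _), map_zero, map_smul, ih hv' _ _ k1,
          levelMonodromy, hvac.2 _ _ (hup i) (hup j), hvac.1, if_pos rfl,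
          vacuumFactor_succ]
        simp only [huu, Matrix.smul_apply]
        rw [Dhat_succ ρ B h0 h1]
        generalize ((sites m d).map fun s =>
          (v + 1 / 2 + u s.1 s.2 + ρ) / (v + 1 / 2 + u s.1 s.2 + ρ - 1)
            * ((v + 1 / 2 - u s.1 s.2) / (v + 1 / 2 - u s.1 s.2 - 1))).prod = β
        by_cases hij : i = j
        · simp only [if_pos hij]
          simp only [Pi.add_apply, Pi.smul_apply, constOp_apply, LinearMap.smul_apply,
            LinearMap.add_apply]
          module
        · simp only [if_neg hij, add_zero, Pi.smul_apply, constOp_apply, LinearMap.smul_apply]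
          module
      · rw [zext_succ_of_not_valid _ hσ, zext_succ_of_not_valid _ hσ, map_zero]
    have hL : ∀ (w : Fin (m (d + 1)) → ℂ) (w' : Site m → ℂ)
        (hw : ∀ c, w' ⟨d + 1, c⟩ = w c) (a b : Idx n (d + 2)),
        Intertwines (M := M) Lab.site ((List.ofFn fun c : Fin (m (d + 1)) =>
          Raux (m := m) (d + 2) (lab (d + 1) ⟨by omega, le_rfl⟩ c) (w c)).prod a b)
          (((sites m (d + 1)).map fun s => siteR M (d + 2) s (w' s)).prod a b) := by
      intro w w' hw a b
      rw [sites, List.ofFn_eq_map, List.ofFn_eq_map, List.map_map]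
      refine Intertwines.list_prod_apply (fun c _ x y => ?_) a b
      simp only [Function.comp_apply, hw]
      exact intertwines_Raux c _ x y
    have hR : ∀ (w : Fin (m (d + 1)) → ℂ) (w' : Site m → ℂ)
        (hw : ∀ c, w' ⟨d + 1, c⟩ = w c) (a b : Idx n (d + 2)),
        Intertwines (M := M) Lab.site ((List.ofFn fun c : Fin (m (d + 1)) =>
          Raux (m := m) (d + 2) (lab (d + 1) ⟨by omega, le_rfl⟩ c) (w c)).reverse.prod a b)
          (((sites m (d + 1)).map fun s => siteR M (d + 2) s (w' s)).reverse.prod a b) := by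
      intro w w' hw a b
      rw [sites, List.ofFn_eq_map, List.ofFn_eq_map, List.map_map, ← List.map_reverse,
        ← List.map_reverse]
      refine Intertwines.list_prod_apply (fun c _ x y => ?_) a b
      simp only [Function.comp_apply, hw]
      exact intertwines_Raux c _ x y
    simp only [monodromy, levelMonodromy, dressed, Matrix.mul_apply, act_sum, act_mul, map_sum,
      LinearMap.sum_apply, Module.End.mul_apply, Matrix.of_apply, Matrix.map_apply]
    refine Finset.sum_congr rfl fun b _ => Finset.sum_congr rfl fun a _ => ?_
    have e1 := hR (fun c => v - u (d + 1) c) (fun s => v - u s.1 s.2) (fun _ => rfl) b y f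
    rw [hL (fun c => v + u (d + 1) c + ρ) (fun s => v + u s.1 s.2 + ρ) (fun _ => rfl) x a, hmid,
      e1]
    -- It remains to see that the right-hand R-matrices of level d+1 do not leave `levelSpace`, as
    -- `hmid` requires.
    rw [e1, ← List.map_reverse]
    refine list_prod_apply_mem (fun s hs x y f hf => ?_) b y hf
    exact siteR_mem_levelSpace (List.mem_reverse.1 hs) _ _ _ hf

end Nesting

/-! ### Creation operators as products of one operator per label -/

section Creation

variable {n : ℕ} {m : ℕ → ℕ} {M : Type*} [AddCommGroup M] [Module ℂ M]
  {B : ℂ → Matrix (Fin n) (Fin n) (Module.End ℂ M)} {ρ : ℂ} {u : (k : ℕ) → Fin (m k) → ℂ}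
  {Reg : ℂ → Prop} {N : ℕ → Submodule ℂ M}

/-- A product of sums, expanded, if the second factors can be moved to the right. -/
theorem sum_prod_mul_prod {Y E : Type*} [Fintype Y] [Ring E] {k : ℕ} (A T : Fin k → Y → E)
    (h : ∀ c y c' y', Commute (T c y) (A c' y')) :
    ∑ t : Fin k → Y, (List.ofFn fun c => A c (t c)).prod * (List.ofFn fun c => T c (t c)).prod
      = (List.ofFn fun c => ∑ y, A c y * T c y).prod := by
  induction k with
  | zero => simp
  | succ k ih =>
    rw [← (Fin.consEquiv fun _ : Fin (k + 1) => Y).sum_comp, Fintype.sum_prod_type]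
    simp only [Fin.consEquiv_apply, List.ofFn_succ, List.prod_cons, Fin.cons_zero, Fin.cons_succ]
    rw [← ih (fun c => A c.succ) (fun c => T c.succ) fun c y c' y' => h _ _ _ _, Finset.sum_mul]
    refine Finset.sum_congr rfl fun y _ => ?_
    rw [Finset.mul_sum]
    refine Finset.sum_congr rfl fun t _ => ?_
    have hc : Commute (T 0 y) (List.ofFn fun c : Fin k => A c.succ (t c)).prod :=
      Commute.list_prod_right _ _ fun x hx => by
        obtain ⟨c, rfl⟩ := List.mem_ofFn.1 hx
        exact h _ _ _ _
    rw [mul_assoc, ← mul_assoc _ (T 0 y), ← hc.eq]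
    simp only [mul_assoc]

theorem list_slice_apply {S : Type} [DecidableEq S] (l : List S) (t : S → Fin n)
    (f : (S → Fin n) → M) (σ : S → Fin n) :
    (l.map fun s => slice s (t s)).prod f σ = f fun s => if s ∈ l then t s else σ s := by
  induction l generalizing σ with
  | nil => simp
  | cons a l ih =>
    simp only [List.map_cons, List.prod_cons, Module.End.mul_apply, slice_apply, ih]
    congr 1
    funext s
    by_cases hs : s ∈ l
    · simp [hs]
    · rcases eq_or_ne s a with rfl | hsa
      · simp [hs]
      · simp [hs, hsa]

theorem prod_slice_apply {d : ℕ} (t : Fin (m (d + 1)) → Fin n) (f : (Site m → Fin n) → M)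
    (σ : Site m → Fin n) :
    (List.ofFn fun c => slice (⟨d + 1, c⟩ : Site m) (t c)).prod f σ
      = f (setLevel (d + 1) t σ) := by
  have h : (List.ofFn fun c => slice (M := M) (⟨d + 1, c⟩ : Site m) (t c))
      = (sites m (d + 1)).map fun s => slice s (setLevel (d + 1) t σ s) := by
    simp only [sites, List.map_ofFn, Function.comp_def, setLevel_self]
  rw [h, list_slice_apply]
  congr 1
  funext s
  split_ifs with hs
  · rfl
  · rw [setLevel_of_ne]
    exact fun h' => hs (mem_sites.2 ⟨by omega, h'⟩)

variable (B ρ u) in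
/-- The creation operator of level `d + 1` that belongs to one label of that level. -/
def creationOp (d : ℕ) (c : Fin (m (d + 1))) : Module.End ℂ ((Site m → Fin n) → M) :=
  ∑ y : Idx n (d + 2),
    levelMonodromy B ρ u d (u (d + 1) c + 1 / 2) y.head y.up * slice ⟨d + 1, c⟩ y.1

theorem commute_slice_levelMonodromy {d : ℕ} {s : Site m} (hs : s.1 ≠ d) (y : Fin n) (v : ℂ)
    (i j : Idx n (d + 1)) : Commute (slice s y) (levelMonodromy B ρ u d v i j) :=
  commute_dressed (fun r hr x' y' => (avoids_update (fun h => hs (by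
      rw [← h, (mem_sites.1 hr).2])) y).commute_siteOp x' y' 1)
    (fun α => commute_funLeft_constOp _ α) _ _ _ _ _

/-- The row vector pairs each monodromy entry with a component of f at level d+1. Taking that
component commutes with the level-(d+1) monodromy, which involves only the labels of level d, so the
sum over all components factorises by `sum_prod_mul_prod`. -/
theorem zext_creation (hN : NestedKernels B Reg N) {d : ℕ}
    (hv : ∀ c, Admissible Reg ρ u d (u (d + 1) c + 1 / 2)) {f : WConf n m (d + 1) → M}
    (hf : zext Lab.site f ∈ levelSpace m N (d + 1)) :
    zext Lab.site (act (creation B ρ m u d) f)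
        = (List.ofFn fun c => creationOp B ρ u d c).prod (zext Lab.site f) ∧
      zext Lab.site (act (creation B ρ m u d) f) ∈ levelSpace m N d := by
  have hprod : ∀ (l : List (Fin (m (d + 1)))) (t : Fin (m (d + 1)) → Idx n (d + 2))
      (g : WConf n m d → M), zext Lab.site g ∈ levelSpace m N d →
      zext Lab.site (act (l.map fun c =>
          monodromy B ρ m u d (u (d + 1) c + 1 / 2) (t c).head (t c).up).prod g)
        = (l.map fun c => levelMonodromy B ρ u d (u (d + 1) c + 1 / 2) (t c).head (t c).up).prod
          (zext Lab.site g) ∧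
      (l.map fun c => levelMonodromy B ρ u d (u (d + 1) c + 1 / 2) (t c).head (t c).up).prod
          (zext Lab.site g) ∈ levelSpace m N d := by
    intro l t g hg
    induction l with
    | nil => exact ⟨by simp [act_one], by simpa using hg⟩
    | cons c l ih =>
      simp only [List.map_cons, List.prod_cons, act_mul, Module.End.mul_apply]
      rw [zext_monodromy hN (hv c) _ _ (by rw [ih.1]; exact ih.2), ih.1]
      exact ⟨rfl, levelMonodromy_mem hN (hv c).reg _ _ ih.2⟩
  have hact : act (creation B ρ m u d) f = ∑ t : Fin (m (d + 1)) → Idx n (d + 2),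
      act ((List.finRange _).map fun c =>
          monodromy B ρ m u d (u (d + 1) c + 1 / 2) (t c).head (t c).up).prod
        (fun w : WConf n m d => f (w.join t)) := by
    funext s
    simp only [act, creation, Matrix.of_apply, sum_wconf, WConf.top_join, WConf.lower_join,
      List.ofFn_eq_map, Finset.sum_apply]
  have hjoin : ∀ t : Fin (m (d + 1)) → Idx n (d + 2),
      zext (Lab.site : Lab m d → Site m) (fun w : WConf n m d => f (w.join t))
        = (List.ofFn fun c => slice (⟨d + 1, c⟩ : Site m) (t c).1).prod (zext Lab.site f) := by
    intro t
    funext σ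
    rw [zext_join, prod_slice_apply]
  have key := fun t => hprod (List.finRange _) t _ (zext_join_mem hN hf t).1
  rw [hact, map_sum]
  constructor
  · simp only [creationOp]
    rw [← sum_prod_mul_prod (fun c (y : Idx n (d + 2)) =>
        levelMonodromy B ρ u d (u (d + 1) c + 1 / 2) y.head y.up)
      (fun c (y : Idx n (d + 2)) => slice (⟨d + 1, c⟩ : Site m) y.1)
      (fun c y c' y' => commute_slice_levelMonodromy (by simp) _ _ _ _), LinearMap.sum_apply]
    refine Finset.sum_congr rfl fun t _ => ?_
    rw [(key t).1, Module.End.mul_apply, hjoin, List.ofFn_eq_map, List.ofFn_eq_map]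
  · refine Submodule.sum_mem _ fun t _ => ?_
    rw [(key t).1]
    exact (key t).2

end Creation

/-! ### R-matrices between two labels, with one label as auxiliary space -/

section Exchange

variable {n : ℕ} {S : Type} [DecidableEq S] {M : Type*} [AddCommGroup M] [Module ℂ M]

/-- The exchange of the components of a configuration at two sites. -/
def exchange (p q : S) (σ : S → Fin n) : S → Fin n :=
  Function.update (Function.update σ p (σ q)) q (σ p)

/-- Yang's `R`-matrix on functions of a configuration. -/
def siteYang (M : Type*) [AddCommGroup M] [Module ℂ M] (n : ℕ) (p q : S) (x : ℂ) :
    Module.End ℂ ((S → Fin n) → M) :=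
  1 - x⁻¹ • ∑ i : Fin n, ∑ j : Fin n, siteOp p i j 1 * siteOp q j i 1

/-- The normalised reduced `R`-matrix on functions of a configuration. -/
def siteReducedR (M : Type*) [AddCommGroup M] [Module ℂ M] (n k l : ℕ) (p q : S) (x : ℂ) :
    Module.End ℂ ((S → Fin n) → M) :=
  (x / (x - 1)) •
    ((∑ i : Idx n k, ∑ j : Idx n l, siteOp p i.1 i.1 1 * siteOp q j.1 j.1 1)
      - x⁻¹ • ∑ i : Idx n (max k l), ∑ j : Idx n (max k l),
          siteOp p i.1 j.1 1 * siteOp q j.1 i.1 1)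

/-- The matrix `D` acting at the site `p`, on functions of a configuration. -/
def siteMatrix {k : ℕ} (p : S) (D : Matrix (Idx n k) (Idx n k) (Module.End ℂ M)) :
    Module.End ℂ ((S → Fin n) → M) :=
  ∑ c : Idx n k, ∑ d : Idx n k, siteOp p c.1 d.1 (D c d)

theorem siteOp_mul_siteOp_apply {p q : S} (h : p ≠ q) (i i' j j' : Fin n)
    (f : (S → Fin n) → M) (σ : S → Fin n) :
    (siteOp p i i' 1 * siteOp q j j' 1 : Module.End ℂ ((S → Fin n) → M)) f σ = if σ p = i ∧ σ q = j then
      f (Function.update (Function.update σ p i') q j') else 0 := by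
  rw [Module.End.mul_apply, siteOp_apply]
  simp only [siteOp_apply, Function.update_of_ne h.symm, Module.End.one_apply]
  split_ifs <;> simp_all

theorem sum_idx_eq {E : Type*} [AddCommMonoid E] {k : ℕ} (x : Fin n) (F : Fin n → E) :
    (∑ i : Idx n k, if x = i.1 then F i.1 else 0) = if k ≤ (x : ℕ) + 1 then F x else 0 := by
  by_cases h : k ≤ (x : ℕ) + 1
  · rw [if_pos h, Finset.sum_eq_single ⟨x, h⟩]
    · simp
    · rintro i - hi
      rw [if_neg]
      rintro rfl
      exact hi rfl
    · simp
  · rw [if_neg h]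
    refine Finset.sum_eq_zero fun i _ => if_neg ?_
    rintro rfl
    exact h i.2

theorem sum_siteOp_diag_apply {p q : S} (h : p ≠ q) (k l : ℕ) (f : (S → Fin n) → M)
    (σ : S → Fin n) :
    (∑ i : Idx n k, ∑ j : Idx n l, siteOp p i.1 i.1 1 * siteOp q j.1 j.1 1
       : Module.End ℂ ((S → Fin n) → M)) f σ
      = if k ≤ (σ p : ℕ) + 1 ∧ l ≤ (σ q : ℕ) + 1 then f σ else 0 := by
  simp only [LinearMap.sum_apply, Finset.sum_apply, siteOp_mul_siteOp_apply h, ite_and]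
  have : ∀ i : Idx n k, (∑ j : Idx n l, if σ p = i.1 then if σ q = j.1 then
        f (Function.update (Function.update σ p i.1) q j.1) else 0 else 0)
      = if σ p = i.1 then (fun x : Fin n => if l ≤ (σ q : ℕ) + 1 then
        f (Function.update (Function.update σ p x) q (σ q)) else 0) i.1 else 0 := by
    intro i
    split_ifs with hi h2
    · exact (sum_idx_eq (σ q) fun y => f (Function.update (Function.update σ p i.1) q y)).trans
        (if_pos h2)
    · exact (sum_idx_eq (σ q) fun y => f (Function.update (Function.update σ p i.1) q y)).trans
        (if_neg h2)
    · simp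
  rw [Finset.sum_congr rfl fun i _ => this i]
  refine (sum_idx_eq (σ p) fun x : Fin n => if l ≤ (σ q : ℕ) + 1 then
    f (Function.update (Function.update σ p x) q (σ q)) else 0).trans ?_
  simp

theorem sum_siteOp_exchange_apply {p q : S} (h : p ≠ q) (k : ℕ) (f : (S → Fin n) → M)
    (σ : S → Fin n) :
    (∑ i : Idx n k, ∑ j : Idx n k, siteOp p i.1 j.1 1 * siteOp q j.1 i.1 1
       : Module.End ℂ ((S → Fin n) → M)) f σ
      = if k ≤ (σ p : ℕ) + 1 ∧ k ≤ (σ q : ℕ) + 1 then f (exchange p q σ) else 0 := by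
  simp only [LinearMap.sum_apply, Finset.sum_apply, siteOp_mul_siteOp_apply h, ite_and]
  have : ∀ i : Idx n k, (∑ j : Idx n k, if σ p = i.1 then if σ q = j.1 then
        f (Function.update (Function.update σ p j.1) q i.1) else 0 else 0)
      = if σ p = i.1 then (fun x : Fin n => if k ≤ (σ q : ℕ) + 1 then
        f (Function.update (Function.update σ p (σ q)) q x) else 0) i.1 else 0 := by
    intro i
    split_ifs with hi h2
    · exact (sum_idx_eq (σ q) fun y => f (Function.update (Function.update σ p y) q i.1)).trans
        (if_pos h2)
    · exact (sum_idx_eq (σ q) fun y => f (Function.update (Function.update σ p y) q i.1)).trans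
        (if_neg h2)
    · simp
  rw [Finset.sum_congr rfl fun i _ => this i]
  exact sum_idx_eq (σ p) fun x : Fin n => if k ≤ (σ q : ℕ) + 1 then
    f (Function.update (Function.update σ p (σ q)) q x) else 0

theorem siteReducedR_apply {p q : S} (h : p ≠ q) (k l : ℕ) (x : ℂ) (f : (S → Fin n) → M)
    (σ : S → Fin n) :
    siteReducedR M n k l p q x f σ = (x / (x - 1)) •
      ((if k ≤ (σ p : ℕ) + 1 ∧ l ≤ (σ q : ℕ) + 1 then f σ else 0)
        - x⁻¹ • if max k l ≤ (σ p : ℕ) + 1 ∧ max k l ≤ (σ q : ℕ) + 1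
          then f (exchange p q σ) else 0) := by
  rw [siteReducedR, LinearMap.smul_apply, LinearMap.sub_apply, LinearMap.smul_apply, Pi.smul_apply,
    Pi.sub_apply, Pi.smul_apply, sum_siteOp_diag_apply h, sum_siteOp_exchange_apply h]

theorem siteYang_apply {p q : S} (h : p ≠ q) (x : ℂ) (f : (S → Fin n) → M) (σ : S → Fin n) :
    siteYang M n p q x f σ = f σ - x⁻¹ • f (exchange p q σ) := by
  have e : (∑ i : Fin n, ∑ j : Fin n, siteOp p i j 1 * siteOp q j i 1
       : Module.End ℂ ((S → Fin n) → M)) f σ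
      = f (exchange p q σ) := by
    simp only [LinearMap.sum_apply, Finset.sum_apply, siteOp_mul_siteOp_apply h]
    rw [Finset.sum_eq_single (σ p), Finset.sum_eq_single (σ q)]
    · rw [if_pos ⟨rfl, rfl⟩]; rfl
    · intro j _ hj
      rw [if_neg fun h' => hj h'.2.symm]
    · simp
    · intro i _ hi
      exact Finset.sum_eq_zero fun j _ => if_neg fun h' => hi h'.1.symm
    · simp
  rw [siteYang, LinearMap.sub_apply, LinearMap.smul_apply, Pi.sub_apply, Pi.smul_apply, e,
    Module.End.one_apply]

theorem siteMatrix_slice {k : ℕ} (p : S) (D : Matrix (Idx n k) (Idx n k) (Module.End ℂ M))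
    (f : (S → Fin n) → M) (x : Idx n k) :
    slice p x.1 (siteMatrix p D f) = ∑ y, constOp S n (D x y) (slice p y.1 f) := by
  funext σ
  simp only [siteMatrix, slice_apply, LinearMap.sum_apply, Finset.sum_apply, siteOp_apply,
    constOp_apply, Function.update_self, Function.update_idem]
  rw [Finset.sum_eq_single x]
  · simp
  · intro c _ hc
    exact Finset.sum_eq_zero fun d _ => if_neg fun h => hc (Subtype.ext h.symm)
  · simp

/-- Exchanging the first site with sites `< j` in the low state does not contribute. -/
theorem list_siteYang_apply {K : Type*} {p : S} {Low : Fin n → Prop} (l : List K) (q : K → S)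
    (x : K → ℂ) (hq : (l.map q).Nodup) (hp : ∀ a ∈ l, p ≠ q a) {f : (S → Fin n) → M} {T : Set S}
    (hT : ∀ a ∈ l, q a ∈ T) (hpT : p ∉ T) (hf : ∀ σ, ∀ t ∈ T, Low (σ t) → f σ = 0)
    (σ : S → Fin n) :
    (Low (σ p) → (l.map fun a => siteYang M n p (q a) (x a)).prod f σ = f σ) ∧
    (∀ t ∈ T, t ∉ l.map q → Low (σ t) →
      (l.map fun a => siteYang M n p (q a) (x a)).prod f σ = 0) := by
  induction l generalizing σ with
  | nil => exact ⟨fun _ => rfl, fun t ht _ h => hf σ t ht h⟩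
  | cons a l ih =>
    have hpa := hp a (by simp)
    rw [List.map_cons, List.nodup_cons] at hq
    have ih' := ih hq.2 (fun b hb => hp b (by simp [hb])) (fun b hb => hT b (by simp [hb]))
    simp only [List.map_cons, List.prod_cons, Module.End.mul_apply]
    rw [siteYang_apply hpa]
    constructor
    · intro hσ
      -- The exchange moves the low value to the site `q a`, which the remaining R-matrices do not
      -- touch and where the vector has no low component.
      rw [(ih' σ).1 hσ, (ih' (exchange p (q a) σ)).2 (q a) (hT a (by simp)) hq.1
        (by simpa [exchange] using hσ), smul_zero, sub_zero]
    · intro t ht htl hσ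
      rw [List.mem_cons, not_or] at htl
      have htp : t ≠ p := fun h => hpT (h ▸ ht)
      rw [(ih' σ).2 t ht htl.2 hσ, (ih' (exchange p (q a) σ)).2 t ht htl.2
        (by rwa [exchange, Function.update_of_ne htl.1, Function.update_of_ne htp]), smul_zero,
        sub_zero]

/-- The operator `Y` is given by the matrix `X` with respect to the site `p`. -/
def Realizes {k : ℕ} (p : S) (C : S → Set (Fin n)) (Y : Module.End ℂ ((S → Fin n) → M))
    (X : Matrix (Idx n k) (Idx n k) (Module.End ℂ ((S → Fin n) → M))) : Prop :=
  ∀ f ∈ supp M C, Y f ∈ supp M C ∧ ∀ x, slice p x.1 (Y f) = ∑ y, X x y (slice p y.1 f)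

section

variable {k : ℕ} {p : S} {C : S → Set (Fin n)} {Y Y' : Module.End ℂ ((S → Fin n) → M)}
  {X X' : Matrix (Idx n k) (Idx n k) (Module.End ℂ ((S → Fin n) → M))}

theorem Realizes.mul (h : Realizes p C Y X) (h' : Realizes p C Y' X') :
    Realizes p C (Y * Y') (X * X') := fun f hf => by
  obtain ⟨h1, h2⟩ := h' f hf
  obtain ⟨h3, h4⟩ := h _ h1
  refine ⟨h3, fun x => ?_⟩
  rw [Module.End.mul_apply, h4]
  simp only [h2, map_sum, Matrix.mul_apply, LinearMap.sum_apply, Module.End.mul_apply]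
  exact Finset.sum_comm

theorem realizes_smul_one {c : ℂ} (h : ∀ f ∈ supp M C, Y f = c • f) :
    Realizes (k := k) p C Y (c • 1) := fun f hf => by
  rw [h f hf]
  refine ⟨Submodule.smul_mem _ _ hf, fun x => ?_⟩
  rw [Finset.sum_eq_single x]
  · simp
  · intro y _ hy
    simp [Matrix.one_apply_ne (Ne.symm hy)]
  · simp

theorem Realizes.list_prod {K : Type*} {l : List K} {Y : K → Module.End ℂ ((S → Fin n) → M)}
    {X : K → Matrix (Idx n k) (Idx n k) (Module.End ℂ ((S → Fin n) → M))}
    (h : ∀ a ∈ l, Realizes p C (Y a) (X a)) :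
    Realizes p C (l.map Y).prod (l.map X).prod := by
  induction l with
  | nil =>
    have := realizes_smul_one (k := k) (p := p) (C := C) (Y := (1 : Module.End ℂ ((S → Fin n) → M)))
      (c := 1) (fun f _ => by simp)
    simpa using this
  | cons a l ih =>
    simp only [List.map_cons, List.prod_cons]
    exact (h a (by simp)).mul (ih fun b hb => h b (by simp [hb]))

theorem list_prod_apply_smul {K : Type*} {l : List K} {Y : K → Module.End ℂ ((S → Fin n) → M)}
    {c : K → ℂ} {f : (S → Fin n) → M} (h : ∀ a ∈ l, Y a f = c a • f) :
    (l.map Y).prod f = (l.map c).prod • f := by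
  induction l with
  | nil => simp
  | cons a l ih =>
    simp only [List.map_cons, List.prod_cons, Module.End.mul_apply]
    rw [ih fun b hb => h b (by simp [hb]), map_smul, h a (by simp), smul_smul, mul_comm]

theorem realizes_siteMatrix (D : Matrix (Idx n k) (Idx n k) (Module.End ℂ M))
    (hC : ∀ i : Idx n k, i.1 ∈ C p) : Realizes p C (siteMatrix p D) (D.map (constOp S n)) :=
  fun f hf => by
    refine ⟨?_, fun x => siteMatrix_slice p D f x⟩
    simp only [siteMatrix, LinearMap.sum_apply]
    exact Submodule.sum_mem _ fun c _ => Submodule.sum_mem _ fun d _ =>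
      siteOp_mem_supp hf (hC c) _

/-- This turns a trace-side R-matrix, in which p and q are on the same footing, into one with p
auxiliary, as in the nested monodromy matrices. Both sites must carry V^{(k)} exactly, so that
exchanging their components preserves the support. -/
theorem realizes_siteReducedR {q : S} (hpq : p ≠ q) (hp : C p = {i : Fin n | k ≤ (i : ℕ) + 1})
    (hq : C q = {i : Fin n | k ≤ (i : ℕ) + 1}) (z : ℂ) :
    Realizes p C (siteReducedR M n k k p q z) (siteR M k q z) := fun f hf => by
  constructor
  · intro σ s hs
    rw [siteReducedR_apply hpq, hf σ s hs, max_self]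
    split_ifs with h1
    · rw [hf (exchange p q σ) s, smul_zero, sub_zero, smul_zero]
      unfold exchange
      rcases eq_or_ne s q with rfl | hsq
      · rw [hq] at hs; exact absurd h1.2 hs
      · rcases eq_or_ne s p with rfl | hsp
        · rw [hp] at hs; exact absurd h1.1 hs
        · rwa [Function.update_of_ne hsq, Function.update_of_ne hsp]
    · simp
  · intro x
    funext σ
    have hx := x.2
    simp only [slice_apply, siteReducedR_apply hpq, max_self, Function.update_self,
      Function.update_of_ne hpq.symm, Finset.sum_apply, siteR_apply, LinearMap.smul_apply,
      LinearMap.sub_apply, Pi.smul_apply, Pi.sub_apply, siteOp_apply, Module.End.one_apply]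
    rw [← Finset.smul_sum, Finset.sum_sub_distrib, ← Finset.smul_sum]
    congr 2
    · rw [Finset.sum_eq_single x]
      · rw [if_pos rfl, Module.End.one_apply, slice_apply]
        split_ifs with h
        · rfl
        · refine (hf _ q ?_).symm
          rw [Function.update_of_ne hpq.symm, hq]
          exact fun h' => h ⟨hx, h'⟩
      · intro y _ hy
        rw [if_neg (Ne.symm hy)]; rfl
      · simp
    · rw [sum_idx_eq (σ q) fun y => f (Function.update (Function.update σ q x.1) p y)]
      simp only [hx, true_and]
      congr 2
      unfold exchange
      rw [Function.update_self, Function.update_of_ne hpq.symm, Function.update_idem,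
        Function.update_comm hpq]

/-- The permutation exchanges only components e_i with i ≥ k, and q carries e_l with l < k; only the
normalising factor is left. -/
theorem siteReducedR_vacuum {q : S} (hpq : p ≠ q) {l : ℕ} (hlk : l < k)
    (hp : C p ⊆ {i : Fin n | k ≤ (i : ℕ) + 1}) (hq : C q ⊆ {i : Fin n | (i : ℕ) + 1 = l}) (z : ℂ)
    {f : (S → Fin n) → M} (hf : f ∈ supp M C) :
    siteReducedR M n k l p q z f = (z / (z - 1)) • f := by
  funext σ
  rw [siteReducedR_apply hpq, Pi.smul_apply, max_eq_left hlk.le]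
  congr 1
  have h2 : (if k ≤ (σ p : ℕ) + 1 ∧ k ≤ (σ q : ℕ) + 1 then f (exchange p q σ) else 0) = 0 := by
    split_ifs with h
    · refine hf _ q fun h' => ?_
      have := hq h'
      rw [exchange, Function.update_self] at this
      have : (σ p : ℕ) + 1 = l := this
      omega
    · rfl
  rw [h2, smul_zero, sub_zero]
  split_ifs with h
  · rfl
  · rw [not_and_or] at h
    rcases h with h | h
    · exact (hf σ p fun h' => h (hp h')).symm
    · refine (hf σ q fun h' => h ?_).symm
      have : (σ q : ℕ) + 1 = l := hq h'
      omega

end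

end Exchange

/-! ### The factors of the trace formula as nested monodromy matrices -/

section TraceFactors

variable {n : ℕ} {m : ℕ → ℕ} {M : Type*} [AddCommGroup M] [Module ℂ M]
  (B : ℂ → Matrix (Fin n) (Fin n) (Module.End ℂ M)) (ρ : ℂ) (u : (k : ℕ) → Fin (m k) → ℂ)

/-- The factor of the ordered product that belongs to a label of level `d + 1`, without the Yang
`R`-matrices, on functions of a configuration. -/
def coreOp (d : ℕ) (j : Fin (m (d + 1))) : Module.End ℂ ((Site m → Fin n) → M) :=
  (List.ofFn fun b : Fin d => (List.ofFn fun c : Fin (m (b + 1)) =>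
      siteReducedR M n (d + 1) (b + 1 + 1) (⟨d + 1, j⟩ : Site m) ⟨b + 1, c⟩
        (u (d + 1) j + u (b + 1) c + ρ + (((d + 1 : ℕ) : ℂ) - ((b + 1 : ℕ) : ℂ)) / 2)).prod).reverse.prod
    * siteMatrix (⟨d + 1, j⟩ : Site m) (Dhat B ρ (d + 1) (u (d + 1) j + 1 / 2))
    * (List.ofFn fun b : Fin d => (List.ofFn fun c : Fin (m (b + 1)) =>
      siteReducedR M n (d + 1) (b + 1 + 1) (⟨d + 1, j⟩ : Site m) ⟨b + 1, c⟩
        (u (d + 1) j - u (b + 1) c + (((d + 1 : ℕ) : ℂ) - ((b + 1 : ℕ) : ℂ)) / 2)).reverse.prod).prod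

/-- The Yang `R`-matrices of the factor that belongs to a label of level `d + 1`. -/
def yangOp (M : Type*) [AddCommGroup M] [Module ℂ M] (n : ℕ) (d : ℕ) (j : Fin (m (d + 1))) :
    Module.End ℂ ((Site m → Fin n) → M) :=
  (List.ofFn fun k : Fin j =>
      siteYang M n (⟨d + 1, j⟩ : Site m) ⟨d + 1, k.castLE j.2.le⟩
        (u (d + 1) j + u (d + 1) (k.castLE j.2.le) + ρ + 1)).prod

theorem Intertwines.ofFn_prod {ι : Type} [Fintype ι] [DecidableEq ι] {k : ι → ℕ} {S : Type}
    [DecidableEq S] {j : ι → S} {N : ℕ} {X : Fin N → Matrix (Conf n k) (Conf n k) (Module.End ℂ M)}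
    {X' : Fin N → Module.End ℂ ((S → Fin n) → M)} (h : ∀ a, Intertwines j (X a) (X' a)) :
    Intertwines j (List.ofFn X).prod (List.ofFn X').prod ∧
      Intertwines j (List.ofFn X).reverse.prod (List.ofFn X').reverse.prod := by
  simp only [List.ofFn_eq_map, ← List.map_reverse]
  exact ⟨Intertwines.list_prod fun a _ => h a, Intertwines.list_prod fun a _ => h a⟩

theorem intertwines_reducedR (k l : ℕ) (p q : Lab m (n - 1)) (x : ℂ) :
    Intertwines (M := M) Lab.site (reducedR k l p q x) (siteReducedR M n k l p.site q.site x) := by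
  have h : ∀ (p : Lab m (n - 1)) (i j : Fin n) (α : Module.End ℂ M), Intertwines Lab.site
      (siteElt (k := fun _ => 1) p i j α) (siteOp p.site i j α) := fun p i j α =>
    intertwines_siteElt Lab.site_injective p i j (by omega) (by omega) α
  exact Intertwines.smul _ (Intertwines.sub
    (Intertwines.sum fun i _ => Intertwines.sum fun j _ => (h _ _ _ _).mul (h _ _ _ _))
    (Intertwines.smul _
      (Intertwines.sum fun i _ => Intertwines.sum fun j _ => (h _ _ _ _).mul (h _ _ _ _))))

theorem intertwines_yangR (p q : Lab m (n - 1)) (x : ℂ) :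
    Intertwines (M := M) Lab.site (yangR p q x) (siteYang M n p.site q.site x) := by
  have h : ∀ (p : Lab m (n - 1)) (i j : Fin n) (α : Module.End ℂ M), Intertwines Lab.site
      (siteElt (k := fun _ => 1) p i j α) (siteOp p.site i j α) := fun p i j α =>
    intertwines_siteElt Lab.site_injective p i j (by omega) (by omega) α
  exact Intertwines.sub Intertwines.one (Intertwines.smul _
      (Intertwines.sum fun i _ => Intertwines.sum fun j _ => (h _ _ _ _).mul (h _ _ _ _)))

theorem intertwines_Dtilde (i : ℕ) (p : Lab m (n - 1)) (v : ℂ) :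
    Intertwines (M := M) Lab.site (Dtilde B ρ i p v) (siteMatrix p.site (Dhat B ρ i v)) :=
  Intertwines.sum fun c _ => Intertwines.sum fun d _ =>
    intertwines_siteElt Lab.site_injective p _ _ (by omega) (by omega) _

theorem intertwines_traceFactor {d : ℕ} (hd : 1 ≤ d + 1 ∧ d + 1 ≤ n - 1) (j : Fin (m (d + 1))) :
    Intertwines Lab.site (traceFactor B ρ m u (d + 1) hd j)
      (yangOp ρ u M n d j * coreOp B ρ u d j) := by
  rw [coreOp, ← mul_assoc, ← mul_assoc]
  refine Intertwines.mul (Intertwines.mul (Intertwines.mul ?_ ?_) ?_) ?_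
  · exact (Intertwines.ofFn_prod fun k => intertwines_yangR _ _ _).1
  · exact (Intertwines.ofFn_prod fun b => (Intertwines.ofFn_prod fun c =>
      intertwines_reducedR _ _ (lab (d + 1) hd j) (lab (b + 1) (by omega) c) _).1).2
  · exact intertwines_Dtilde B ρ (d + 1) (lab (d + 1) hd j) _
  · exact (Intertwines.ofFn_prod fun b => (Intertwines.ofFn_prod fun c =>
      intertwines_reducedR _ _ (lab (d + 1) hd j) (lab (b + 1) (by omega) c) _).2).1

theorem ofFn_prod_apply_smul {S : Type} [DecidableEq S] {N : ℕ} {Y : Fin N → Module.End ℂ ((S → Fin n) → M)}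
    {c : Fin N → ℂ} {f : (S → Fin n) → M} (h : ∀ a, Y a f = c a • f) :
    (List.ofFn Y).prod f = (∏ a, c a) • f ∧ (List.ofFn Y).reverse.prod f = (∏ a, c a) • f := by
  rw [← List.prod_ofFn]
  constructor
  · rw [List.ofFn_eq_map, List.ofFn_eq_map, list_prod_apply_smul fun a _ => h a]
  · rw [List.ofFn_eq_map, List.ofFn_eq_map, ← List.map_reverse, list_prod_apply_smul fun a _ => h a,
      ((List.reverse_perm _).map c).prod_eq]

theorem Realizes.ofFn_prod {S : Type} [DecidableEq S] {k N : ℕ} {p : S} {C : S → Set (Fin n)}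
    {Y : Fin N → Module.End ℂ ((S → Fin n) → M)}
    {X : Fin N → Matrix (Idx n k) (Idx n k) (Module.End ℂ ((S → Fin n) → M))}
    (h : ∀ a, Realizes p C (Y a) (X a)) :
    Realizes p C (List.ofFn Y).prod (List.ofFn X).prod ∧
      Realizes p C (List.ofFn Y).reverse.prod (List.ofFn X).reverse.prod := by
  simp only [List.ofFn_eq_map, ← List.map_reverse]
  exact ⟨Realizes.list_prod fun a _ => h a, Realizes.list_prod fun a _ => h a⟩

/-- The levels below d are in the vacuum state, so their R-matrices on the two sides of `Dhat` give
scalars whose product is `vacuumFactor`. The R-matrices with level d become the dressing. The shifts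
by half the level difference in the trace formula are what remains of the shifts v + 1/2 in the
recursion. -/
theorem realizes_coreOp {d : ℕ} (j : Fin (m (d + 1))) {C : Site m → Set (Fin n)}
    (hp : C ⟨d + 1, j⟩ = {i : Fin n | d + 1 ≤ (i : ℕ) + 1})
    (hC : ∀ s : Site m, 1 ≤ s.1 → s.1 ≤ d → C s = levelSet n m d s) :
    Realizes ⟨d + 1, j⟩ C (coreOp B ρ u d j) (levelMonodromy B ρ u d (u (d + 1) j + 1 / 2)) := by
  have hD := realizes_siteMatrix (C := C) (p := (⟨d + 1, j⟩ : Site m))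
    (Dhat B ρ (d + 1) (u (d + 1) j + 1 / 2)) (fun i => by rw [hp]; exact i.2)
  cases d with
  | zero => simpa [coreOp, levelMonodromy, sites, dressed_nil, vacuumFactor] using hD
  | succ d =>
    have hlow : ∀ (b : Fin d) (c : Fin (m (b + 1))) (z : ℂ) (f), f ∈ supp M C →
        siteReducedR M n (d + 1 + 1) (b + 1 + 1) (⟨d + 1 + 1, j⟩ : Site m) ⟨b + 1, c⟩ z f
          = (z / (z - 1)) • f := by
      intro b c z f hf
      refine siteReducedR_vacuum (by simp; omega) (by omega) hp.le ?_ z hf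
      rw [hC _ (by simp) (by simp)]
      intro i hi
      have := hi.1 (by simp) (by simp)
      simpa using this
    have htop : ∀ (c : Fin (m (d + 1))) (z : ℂ), Realizes (⟨d + 1 + 1, j⟩ : Site m) C
        (siteReducedR M n (d + 1 + 1) (d + 1 + 1) (⟨d + 1 + 1, j⟩ : Site m) ⟨d + 1, c⟩ z)
        (siteR M (d + 1 + 1) ⟨d + 1, c⟩ z) := by
      intro c z
      refine realizes_siteReducedR (by simp) hp ?_ z
      rw [hC _ (by simp) (by simp)]
      ext i
      simp [levelSet]
    have key := (((Realizes.ofFn_prod fun c => htop c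
        (u (d + 1 + 1) j + 1 / 2 + u (d + 1) c + ρ)).1.mul (realizes_smul_one
          (c := ∏ b : Fin d, ∏ c : Fin (m (b + 1)), (u (d + 1 + 1) j + u (b + 1) c + ρ + (((d + 1 + 1 : ℕ) : ℂ) - ((b + 1 : ℕ) : ℂ)) / 2) /
            (u (d + 1 + 1) j + u (b + 1) c + ρ + (((d + 1 + 1 : ℕ) : ℂ) - ((b + 1 : ℕ) : ℂ)) / 2 - 1)) fun f hf =>
          (ofFn_prod_apply_smul fun b => (ofFn_prod_apply_smul fun c => hlow b c _ f hf).1).2)).mul hD).mul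
      ((realizes_smul_one
          (c := ∏ b : Fin d, ∏ c : Fin (m (b + 1)), (u (d + 1 + 1) j - u (b + 1) c + (((d + 1 + 1 : ℕ) : ℂ) - ((b + 1 : ℕ) : ℂ)) / 2) /
            (u (d + 1 + 1) j - u (b + 1) c + (((d + 1 + 1 : ℕ) : ℂ) - ((b + 1 : ℕ) : ℂ)) / 2 - 1)) fun f hf =>
          (ofFn_prod_apply_smul fun b => (ofFn_prod_apply_smul fun c => hlow b c _ f hf).2).1).mul
        (Realizes.ofFn_prod fun c => htop c (u (d + 1 + 1) j + 1 / 2 - u (d + 1) c)).2)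
    convert key using 1
    · have e : ∀ z w : ℂ, z + w + ρ + (((d + 1 + 1 : ℕ) : ℂ) - ((d + 1 : ℕ) : ℂ)) / 2
          = z + 1 / 2 + w + ρ := by intro z w; push_cast; ring
      have e' : ∀ z w : ℂ, z - w + (((d + 1 + 1 : ℕ) : ℂ) - ((d + 1 : ℕ) : ℂ)) / 2
          = z + 1 / 2 - w := by intro z w; push_cast; ring
      -- Level d+1, the last one below that of the label, is split off. It comes first in the
      -- decreasing left product and last in the increasing right one.
      rw [coreOp, List.ofFn_succ', List.ofFn_succ']
      simp only [List.concat_eq_append, List.reverse_append, List.reverse_singleton,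
        List.prod_append, List.prod_nil, mul_one, Fin.val_last, Fin.val_castSucc, List.singleton_append,
        List.prod_cons, e, e', mul_assoc]
    · have hv : vacuumFactor ρ u (d + 1) (u (d + 1 + 1) j + 1 / 2)
          = (∏ b : Fin d, ∏ c : Fin (m (b + 1)), (u (d + 1 + 1) j + u (b + 1) c + ρ + (((d + 1 + 1 : ℕ) : ℂ) - ((b + 1 : ℕ) : ℂ)) / 2) /
            (u (d + 1 + 1) j + u (b + 1) c + ρ + (((d + 1 + 1 : ℕ) : ℂ) - ((b + 1 : ℕ) : ℂ)) / 2 - 1)) *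
          ∏ b : Fin d, ∏ c : Fin (m (b + 1)), (u (d + 1 + 1) j - u (b + 1) c + (((d + 1 + 1 : ℕ) : ℂ) - ((b + 1 : ℕ) : ℂ)) / 2) /
            (u (d + 1 + 1) j - u (b + 1) c + (((d + 1 + 1 : ℕ) : ℂ) - ((b + 1 : ℕ) : ℂ)) / 2 - 1) := by
        rw [vacuumFactor, Finset.prod_Ico_eq_prod_range, ← Finset.prod_mul_distrib]
        simp only [← Finset.prod_mul_distrib]
        rw [Nat.add_sub_cancel, Finset.prod_range]
        refine Finset.prod_congr rfl fun b _ => ?_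
        rw [add_comm 1 (b : ℕ)]
        refine Finset.prod_congr rfl fun c _ => ?_
        have e : u (d + 1 + 1) j + 1 / 2 + u (b + 1) c + ρ + (((d + 1 : ℕ) : ℂ) - ((b + 1 : ℕ) : ℂ)) / 2
          = u (d + 1 + 1) j + u (b + 1) c + ρ + (((d + 1 + 1 : ℕ) : ℂ) - ((b + 1 : ℕ) : ℂ)) / 2 := by
          push_cast; ring
        have e' : u (d + 1 + 1) j + 1 / 2 - u (b + 1) c + (((d + 1 : ℕ) : ℂ) - ((b + 1 : ℕ) : ℂ)) / 2
          = u (d + 1 + 1) j - u (b + 1) c + (((d + 1 + 1 : ℕ) : ℂ) - ((b + 1 : ℕ) : ℂ)) / 2 := by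
          push_cast; ring
        rw [e, e']
      have hmap : ∀ (a : ℂ) (D : Matrix (Idx n (d + 2)) (Idx n (d + 2)) (Module.End ℂ M)),
          (a • D).map (constOp (Site m) n) = a • D.map (constOp (Site m) n) := fun a D => rfl
      rw [levelMonodromy, hv, dressed, hmap, sites, List.map_ofFn, List.map_ofFn]
      simp only [Function.comp_def, mul_smul_comm, smul_mul_assoc, mul_one, one_mul, smul_smul,
        mul_assoc]
      rw [mul_comm]

end TraceFactors

/-! ### Reading off the lowest component at the labels of one level -/

section LowestRow

variable {n : ℕ} {m : ℕ → ℕ} {M : Type*} [AddCommGroup M] [Module ℂ M]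
  (B : ℂ → Matrix (Fin n) (Fin n) (Module.End ℂ M)) (ρ : ℂ) (u : (k : ℕ) → Fin (m k) → ℂ)

/-- The factor of the ordered product that belongs to a label of level `d + 1`, on functions of a
configuration. -/
def factorOp (d : ℕ) (j : Fin (m (d + 1))) : Module.End ℂ ((Site m → Fin n) → M) :=
  yangOp ρ u M n d j * coreOp B ρ u d j

theorem commute_list_ofFn {E : Type*} [Monoid E] {N : ℕ} {a : E} {X : Fin N → E}
    (h : ∀ i, Commute a (X i)) :
    Commute a (List.ofFn X).prod ∧ Commute a (List.ofFn X).reverse.prod := by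
  constructor
  · exact Commute.list_prod_right _ _ (by simpa [List.forall_mem_ofFn_iff] using h)
  · exact Commute.list_prod_right _ _ (by simpa [List.forall_mem_ofFn_iff] using h)

section

variable {S : Type} [DecidableEq S] {g : (S → Fin n) → S → Fin n} {p q : S}

theorem Avoids.commute_siteReducedR (hp : Avoids g p) (hq : Avoids g q) (k l : ℕ) (x : ℂ) :
    Commute (LinearMap.funLeft ℂ M g) (siteReducedR M n k l p q x) :=
  (Commute.sub_right
    (Commute.sum_right _ _ _ fun _ _ => Commute.sum_right _ _ _ fun _ _ =>
      (hp.commute_siteOp _ _ _).mul_right (hq.commute_siteOp _ _ _))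
    ((Commute.sum_right _ _ _ fun _ _ => Commute.sum_right _ _ _ fun _ _ =>
      (hp.commute_siteOp _ _ _).mul_right (hq.commute_siteOp _ _ _)).smul_right _)).smul_right _

theorem Avoids.commute_siteYang (hp : Avoids g p) (hq : Avoids g q) (x : ℂ) :
    Commute (LinearMap.funLeft ℂ M g) (siteYang M n p q x) :=
  Commute.sub_right (Commute.one_right _)
    ((Commute.sum_right _ _ _ fun _ _ => Commute.sum_right _ _ _ fun _ _ =>
      (hp.commute_siteOp _ _ _).mul_right (hq.commute_siteOp _ _ _)).smul_right _)

theorem Avoids.commute_siteMatrix (hp : Avoids g p) {k : ℕ}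
    (D : Matrix (Idx n k) (Idx n k) (Module.End ℂ M)) :
    Commute (LinearMap.funLeft ℂ M g) (siteMatrix p D) :=
  Commute.sum_right _ _ _ fun _ _ => Commute.sum_right _ _ _ fun _ _ => hp.commute_siteOp _ _ _

end

/-- The factor of a label involves only lower levels and labels of the same level up to its own.
Components at later labels can therefore be fixed before it is applied. -/
theorem commute_factorOp {g : (Site m → Fin n) → Site m → Fin n} {d : ℕ} {j : Fin (m (d + 1))}
    (hg : ∀ s : Site m, s.1 ≤ d → Avoids g s)
    (hg' : ∀ k : Fin (m (d + 1)), k ≤ j → Avoids g ⟨d + 1, k⟩) :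
    Commute (LinearMap.funLeft ℂ M g) (factorOp B ρ u d j) := by
  refine Commute.mul_right ?_ (Commute.mul_right (Commute.mul_right ?_ ?_) ?_)
  · exact (commute_list_ofFn fun k => (hg' j le_rfl).commute_siteYang (hg' _ (by
      simp only [Fin.le_def, Fin.val_castLE]; exact k.2.le)) _).1
  · exact (commute_list_ofFn fun b => (commute_list_ofFn fun c =>
      (hg' j le_rfl).commute_siteReducedR (hg _ b.2) _ _ _).1).2
  · exact (hg' j le_rfl).commute_siteMatrix _
  · exact (commute_list_ofFn fun b => (commute_list_ofFn fun c =>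
      (hg' j le_rfl).commute_siteReducedR (hg _ b.2) _ _ _).2).1

/-- The components of a vector to which the factors of the last labels of level `d + 1`, from the
`N`-th one on, have been applied. -/
def partialSet (n : ℕ) (m : ℕ → ℕ) (d N : ℕ) (s : Site m) : Set (Fin n) :=
  {i | (1 ≤ s.1 → s.1 < d → (i : ℕ) = s.1) ∧ (s.1 = d → d ≤ i) ∧
    (s.1 = d + 1 → (s.2 : ℕ) < N → d + 1 ≤ i)}

theorem creationOp_mem_supp {d : ℕ} (j : Fin (m (d + 1))) {f : (Site m → Fin n) → M}
    (hf : f ∈ supp M (partialSet n m d (j + 1))) :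
    creationOp B ρ u d j f ∈ supp M (partialSet n m d j) := by
  rw [creationOp, LinearMap.sum_apply]
  refine Submodule.sum_mem _ fun y _ => ?_
  rw [Module.End.mul_apply]
  refine dressed_mem (fun s hs x y f hf => siteOp_mem_supp hf ?_ _)
    (fun x y f hf => constOp_mem_supp hf _) _ _ ?_
  · have h := mem_sites.1 hs
    refine ⟨fun _ h' => by omega, fun _ => ?_, fun h' => by omega⟩
    have := x.2; omega
  · intro σ s hs
    rw [slice_apply]
    have hsp : s ≠ ⟨d + 1, j⟩ := by
      rintro rfl
      exact hs ⟨fun _ h => by simp at h, fun h => by simp at h, fun _ h => by simp at h⟩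
    refine hf _ s fun h' => hs ?_
    rw [Function.update_of_ne hsp] at h'
    exact ⟨h'.1, h'.2.1, fun h1 h2 => h'.2.2 h1 (by omega)⟩

/-- Reading off e_{d+1} at the label selects the first row of the monodromy matrix. The sum over
columns omits the first one, because f has no e_{d+1} component at this label, and so is the
creation operator. -/
theorem slice_factorOp {d : ℕ} (j : Fin (m (d + 1))) {h : Fin n} (hd : (h : ℕ) = d)
    {f : (Site m → Fin n) → M} (hf : f ∈ supp M (partialSet n m d (j + 1))) :
    slice ⟨d + 1, j⟩ h (factorOp B ρ u d j f) = creationOp B ρ u d j f := by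
  set p : Site m := ⟨d + 1, j⟩ with hpdef
  -- At p itself the support is enlarged from V^{(d+2)} to V^{(d+1)}, as the matrix acting there
  -- also produces e_{d+1}.
  let C : Site m → Set (Fin n) := fun s =>
    if s = p then {i : Fin n | d + 1 ≤ (i : ℕ) + 1} else partialSet n m d (j + 1) s
  have hfC : f ∈ supp M C := by
    refine supp_mono (fun s i hi => ?_) hf
    by_cases hs : s = p
    · subst hs
      have h1 := hi.2.2 rfl (Nat.lt_succ_self _)
      simp only [C, if_true, Set.mem_ofPred_eq]; omega
    · simpa only [C, if_neg hs] using hi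
  obtain ⟨h1, h2⟩ := realizes_coreOp B ρ u j (C := C) (if_pos rfl) (fun s hs hs' => by
    have hsp : s ≠ p := fun h' => by rw [h', hpdef] at hs'; simp at hs'
    simp only [C, if_neg hsp]
    ext i
    simp only [partialSet, levelSet, Set.mem_ofPred_eq]
    constructor
    · exact fun h => ⟨h.1, h.2.1⟩
    · exact fun h => ⟨h.1, h.2, fun h' => by omega⟩) f hfC
  -- The Yang R-matrices exchange p with earlier labels of the level. Those have not been acted on
  -- and lie in V^{(d+2)}, so they cannot supply the component e_{d+1} that an exchange would need.
  have hy : slice p h (factorOp B ρ u d j f) = slice p h (coreOp B ρ u d j f) := by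
    funext σ
    rw [slice_apply, slice_apply, factorOp, Module.End.mul_apply, yangOp, List.ofFn_eq_map]
    refine (list_siteYang_apply (p := p) (Low := fun i : Fin n => (i : ℕ) < d + 1)
      (List.finRange j) (fun k => (⟨d + 1, k.castLE j.2.le⟩ : Site m)) _ ?_ ?_
      (T := {t | t.1 = d + 1 ∧ (t.2 : ℕ) < j}) ?_ ?_ ?_ _).1 ?_
    · refine (List.nodup_finRange _).map fun k k' hk => ?_
      simpa [Fin.ext_iff] using hk
    · intro k _ hk
      have : j = k.castLE j.2.le := by simpa [hpdef] using hk
      have h3 := k.2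
      rw [Fin.ext_iff, Fin.val_castLE] at this
      omega
    · intro k _; exact ⟨rfl, k.2⟩
    · rintro ⟨_, h3⟩; exact absurd h3 (lt_irrefl _)
    · rintro σ ⟨b, t⟩ ⟨h3, h4⟩ h5
      refine h1 σ ⟨b, t⟩ fun h6 => ?_
      have hsp : (⟨b, t⟩ : Site m) ≠ p := by
        rintro h7
        obtain rfl : b = d + 1 := h3
        have : t = j := by simpa [hpdef] using h7
        subst this
        exact absurd h4 (lt_irrefl _)
      simp only [C, if_neg hsp] at h6
      have := h6.2.2 h3 (Nat.lt_succ_of_lt h4)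
      omega
    · rw [Function.update_self]; omega
  rw [hy, h2 ⟨h, by omega⟩, creationOp, LinearMap.sum_apply]
  symm
  refine Fintype.sum_of_injective Idx.up (fun y y' hyy => ?_) _ _ (fun y hyn => ?_) fun y => ?_
  · exact Subtype.ext (by simpa [Idx.up] using hyy)
  · have : slice p y.1 f = 0 := by
      funext σ
      rw [slice_apply]
      refine hf _ p fun h3 => hyn ⟨⟨y.1, ?_⟩, rfl⟩
      have := h3.2.2 rfl (Nat.lt_succ_self _)
      rw [Function.update_self] at this
      omega
    rw [this, map_zero]
  · have : y.head = ⟨h, by omega⟩ := Subtype.ext (Fin.ext hd.symm)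
    rw [Module.End.mul_apply, this]
    rfl

/-- Induction from the last label, whose factor is applied first, down to the first; the components
already read off commute past each new factor. -/
theorem slices_factorOps {d : ℕ} {h : Fin n} (hd : (h : ℕ) = d)
    {f : (Site m → Fin n) → M} (hf : f ∈ supp M (partialSet n m d (m (d + 1)))) :
    (List.ofFn fun j => slice (⟨d + 1, j⟩ : Site m) h).prod
        ((List.ofFn fun j => factorOp B ρ u d j).prod f)
      = (List.ofFn fun j => creationOp B ρ u d j).prod f := by
  have key : ∀ k j, j + k = m (d + 1) →
      (((List.finRange (m (d + 1))).drop j).map fun j => slice (⟨d + 1, j⟩ : Site m) h).prod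
          ((((List.finRange (m (d + 1))).drop j).map fun j => factorOp B ρ u d j).prod f)
        = (((List.finRange (m (d + 1))).drop j).map fun j => creationOp B ρ u d j).prod f ∧
      (((List.finRange (m (d + 1))).drop j).map fun j => creationOp B ρ u d j).prod f
        ∈ supp M (partialSet n m d j) := by
    intro k
    induction k with
    | zero =>
      rintro j rfl
      rw [List.drop_eq_nil_of_le (by simp)]
      exact ⟨rfl, hf⟩
    | succ k ih =>
      intro j hj
      have hlt : j < m (d + 1) := by omega
      have hdrop : (List.finRange (m (d + 1))).drop j
          = ⟨j, hlt⟩ :: (List.finRange (m (d + 1))).drop (j + 1) := by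
        rw [List.drop_eq_getElem_cons (by simpa using hlt)]; simp
      obtain ⟨h1, h2⟩ := ih (j + 1) (by omega)
      have hc : Commute ((((List.finRange (m (d + 1))).drop (j + 1)).map
          fun j => slice (M := M) (⟨d + 1, j⟩ : Site m) h).prod) (factorOp B ρ u d ⟨j, hlt⟩) := by
        refine Commute.list_prod_left _ _ fun x hx => ?_
        obtain ⟨i, hi, rfl⟩ := List.mem_map.1 hx
        have hi' : j < i := by
          obtain ⟨a, ha, rfl⟩ := List.mem_drop_iff_getElem.1 hi
          simp
          omega
        refine commute_factorOp B ρ u (fun s hs => avoids_update ?_ h)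
          fun k hk => avoids_update ?_ h
        · rintro rfl; simp at hs
        · intro h'
          have h3 : k = i := by simpa using h'
          subst h3
          have : (k : ℕ) ≤ j := hk
          omega
      rw [hdrop]
      simp only [List.map_cons, List.prod_cons, Module.End.mul_apply]
      have hc' := LinearMap.congr_fun hc.eq
        ((((List.finRange (m (d + 1))).drop (j + 1)).map fun j => factorOp B ρ u d j).prod f)
      simp only [Module.End.mul_apply] at hc'
      rw [hc', h1]
      exact ⟨slice_factorOp B ρ u _ hd h2, creationOp_mem_supp B ρ u ⟨j, hlt⟩ h2⟩
  simpa [List.ofFn_eq_map] using (key (m (d + 1)) 0 (by omega)).1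

end LowestRow

/-! ### Comparison of the trace with the Bethe vector -/

section TraceOfProduct

variable {n : ℕ} {m : ℕ → ℕ} {M : Type*} [AddCommGroup M] [Module ℂ M]
  {B : ℂ → Matrix (Fin n) (Fin n) (Module.End ℂ M)} {ρ : ℂ} {u : (k : ℕ) → Fin (m k) → ℂ}
  {Reg : ℂ → Prop} {N : ℕ → Submodule ℂ M}

/-- The configuration with the value `e_b` at the labels of the levels `b > d`. -/
def lowestAbove (n d : ℕ) (σ : Site m → Fin n) : Site m → Fin n := fun s =>
  if h : d < s.1 ∧ s.1 ≤ n - 1 then ⟨s.1 - 1, by omega⟩ else σ s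

theorem avoids_lowestAbove {d : ℕ} {s : Site m} (hs : s.1 ≤ d) : Avoids (lowestAbove n d) s where
  apply σ := dif_neg (by omega)
  update σ y := by
    funext t
    by_cases ht : t = s
    · subst ht
      rw [Function.update_self, lowestAbove, dif_neg (by omega), Function.update_self]
    · simp only [lowestAbove, Function.update_of_ne ht]

theorem lowestAbove_setLevel {d : ℕ} (hd : d + 1 ≤ n - 1) (σ : Site m → Fin n) :
    lowestAbove n (d + 1) (setLevel (d + 1) (fun _ => ⟨d, by omega⟩) σ) = lowestAbove n d σ := by
  funext s
  rcases lt_trichotomy s.1 (d + 1) with h | h | h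
  · rw [lowestAbove, dif_neg (by omega), setLevel_of_ne _ _ (by omega), lowestAbove,
      dif_neg (by omega)]
  · rw [lowestAbove, dif_neg (by omega), lowestAbove, dif_pos ⟨by omega, by omega⟩, setLevel,
      dif_pos h]
    exact Fin.ext (by simp only; omega)
  · rw [lowestAbove, lowestAbove]
    by_cases h' : s.1 ≤ n - 1
    · rw [dif_pos ⟨h, h'⟩, dif_pos ⟨by omega, h'⟩]
    · rw [dif_neg (by omega), dif_neg (by omega), setLevel_of_ne _ _ (by omega)]

/-- The vacuum vector as a function of a configuration. -/
def vacuumFun (n : ℕ) (m : ℕ → ℕ) (η : M) : (Site m → Fin n) → M := fun σ =>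
  if ∀ p : Lab m (n - 1), (σ p.site : ℕ) = p.1 then η else 0

theorem zext_vacuum (η : M) :
    zext Lab.site (vacuum (n := n) m η (n - 1)) = vacuumFun n m η := by
  funext σ
  by_cases h : ∀ p : Lab m (n - 1), (p.1 : ℕ) + 1 ≤ (σ p.site : ℕ) + 1
  · rw [zext_of_valid _ _ h]
    simp [vacuum, vacuumFun]
  · rw [zext_of_not_valid _ _ h, vacuumFun, if_neg fun h' => h fun p => by rw [h' p]]

theorem vacuumFun_mem_levelSpace {η : M} (hη : η ∈ N (n - 1)) :
    vacuumFun n m η ∈ levelSpace m N (n - 1) := by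
  constructor
  · intro σ s hs
    rw [vacuumFun, if_neg]
    intro h
    refine hs ⟨fun h1 h2 => ?_, fun h1 => ?_⟩
    · exact h ⟨⟨s.1, Finset.mem_Icc.2 ⟨h1, h2.le⟩⟩, s.2⟩
    · by_cases h2 : 1 ≤ n - 1
      · exact h1.symm.trans_le (h ⟨⟨s.1, Finset.mem_Icc.2 (by omega)⟩, s.2⟩).ge
      · omega
  · refine mem_valuedIn.2 fun σ => ?_
    rw [vacuumFun]
    split_ifs
    · exact hη
    · exact (N _).zero_mem

theorem mem_partialSet_of_levelSpace {d : ℕ} {f : (Site m → Fin n) → M}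
    (hf : f ∈ levelSpace m N (d + 1)) : f ∈ supp M (partialSet n m d (m (d + 1))) := by
  have h : ∀ s, levelSet n m (d + 1) s ⊆ partialSet n m d (m (d + 1)) s := by
    refine fun s i hi => ⟨fun h1 h2 => hi.1 h1 (by omega), fun h => ?_, fun h _ => hi.2 h⟩
    by_cases h1 : 1 ≤ s.1
    · rw [hi.1 h1 (by omega), h]
    · omega
  exact supp_mono h hf.1

/-- Descending induction on the level d. Fixing the components above level d+1 commutes with the
factors of level d+1; `slices_factorOps` then turns the remaining components into creation operators
and `zext_creation` returns to the nested recursion. Membership in `levelSpace` is carried along, as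
both need it. -/
theorem funLeft_prod_eq_zext_betheLevel (hN : NestedKernels B Reg N)
    (hu : ∀ d, d + 1 ≤ n - 1 → ∀ c, Admissible Reg ρ u d (u (d + 1) c + 1 / 2)) {η : M}
    (hη : η ∈ N (n - 1)) (k d : ℕ) (hk : d + k = n - 1) :
    LinearMap.funLeft ℂ M (lowestAbove n d) ((((List.finRange (n - 1)).drop d).map fun i : Fin (n - 1) =>
        (List.ofFn fun j => factorOp B ρ u i j).prod).prod (vacuumFun n m η))
      = zext Lab.site (betheLevel B ρ m u η k d) ∧
    zext Lab.site (betheLevel B ρ m u η k d) ∈ levelSpace m N d := by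
  induction k generalizing d with
  | zero =>
    obtain rfl : d = n - 1 := hk
    rw [List.drop_eq_nil_of_le (by simp), betheLevel, zext_vacuum]
    refine ⟨?_, vacuumFun_mem_levelSpace hη⟩
    have : lowestAbove (m := m) n (n - 1) = id := by
      funext σ s
      exact dif_neg (by omega)
    rw [this]
    rfl
  | succ k ih =>
    have hlt : d < n - 1 := by omega
    obtain ⟨h1, h2⟩ := ih (d + 1) (by omega)
    have hdrop : (List.finRange (n - 1)).drop d
        = ⟨d, hlt⟩ :: (List.finRange (n - 1)).drop (d + 1) := by
      rw [List.drop_eq_getElem_cons (by simpa using hlt)]; simp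
    have hc := LinearMap.congr_fun (commute_list_ofFn fun j => commute_factorOp B ρ u (d := d)
        (j := j) (fun s hs => avoids_lowestAbove (d := d + 1) (by omega))
        fun k _ => avoids_lowestAbove le_rfl).1.eq
      ((((List.finRange (n - 1)).drop (d + 1)).map fun i : Fin (n - 1) =>
        (List.ofFn fun j => factorOp B ρ u i j).prod).prod (vacuumFun n m η))
    simp only [Module.End.mul_apply] at hc
    rw [h1] at hc
    obtain ⟨h3, h4⟩ := zext_creation hN (hu d hlt) h2
    refine ⟨?_, h4⟩
    rw [betheLevel, h3, ← slices_factorOps B ρ u (h := ⟨d, by omega⟩) rfl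
      (mem_partialSet_of_levelSpace h2), ← hc, hdrop]
    funext σ
    rw [prod_slice_apply, LinearMap.funLeft_apply, LinearMap.funLeft_apply,
      lowestAbove_setLevel hlt]
    rfl

/-- The tensor product of the e_{b+1,b} has rank one, so the trace is the entry of A with row e_b
and column e_{b+1} at each label of level b. -/
theorem trace_mul_lowering {A : Matrix (VConf n m) (VConf n m) (Module.End ℂ M)} (η : M) :
    (A * tensorOp fun p : Lab m (n - 1) => lowering n p.1).trace η
      = act A (fun t => if ∀ p, ((t p).1 : ℕ) = p.1 then η else 0)
        fun p => ⟨⟨(p.1 : ℕ) - 1, by have := Finset.mem_Icc.1 p.1.2; omega⟩, Nat.le_add_left 1 _⟩ := by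
  have hT : ∀ s t : VConf n m, ∀ ζ : M,
      (tensorOp (fun p : Lab m (n - 1) => lowering n p.1) : Matrix _ _ (Module.End ℂ M)) t s ζ
        = if (∀ p, ((t p).1 : ℕ) = p.1) ∧ ∀ p, ((s p).1 : ℕ) + 1 = p.1 then ζ else 0 := by
    intro s t ζ
    simp only [tensorOp, Matrix.of_apply, Module.algebraMap_end_apply, lowering, Nat.add_right_cancel_iff]
    rw [Finset.prod_ite_zero]
    simp only [Finset.mem_univ, true_implies, forall_and, Finset.prod_const_one]
    split_ifs <;> simp
  simp only [Matrix.trace, Matrix.diag_apply, Matrix.mul_apply, LinearMap.sum_apply,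
    Module.End.mul_apply, hT, act]
  rw [Finset.sum_eq_single
    (fun p => ⟨⟨(p.1 : ℕ) - 1, by have := Finset.mem_Icc.1 p.1.2; omega⟩, Nat.le_add_left 1 _⟩)]
  · refine Finset.sum_congr rfl fun t _ => ?_
    congr 1
    refine if_congr (and_iff_left fun p => ?_) rfl rfl
    have := Finset.mem_Icc.1 p.1.2
    simp only
    omega
  · intro s _ hs
    refine Finset.sum_eq_zero fun t _ => ?_
    rw [if_neg, map_zero]
    rintro ⟨-, h⟩
    refine hs (funext fun p => Subtype.ext (Fin.ext ?_))
    have := h p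
    simp only
    omega
  · simp

theorem betheVector_eq_trace (hN : NestedKernels B Reg N)
    (hu : ∀ d, d + 1 ≤ n - 1 → ∀ c, Admissible Reg ρ u d (u (d + 1) c + 1 / 2)) {η : M}
    (hη : η ∈ N (n - 1)) : betheVector B ρ m u η = (traceOperator B ρ m u).trace η := by
  rw [traceOperator, trace_mul_lowering]
  rcases Nat.eq_zero_or_pos n with rfl | hn
  · have : IsEmpty (Lab m (0 - 1)) := ⟨fun p => by have := Finset.mem_Icc.1 p.1.2; omega⟩
    simp [betheVector, betheLevel, vacuum, act_one]
  -- Any configuration would do: `lowestAbove n 0` overwrites all labels of the levels 1, …, n-1,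
  -- and no others occur in the formulas.
  · let σ : Site m → Fin n := fun _ => ⟨0, hn⟩
    have h1 := congr_fun (funLeft_prod_eq_zext_betheLevel hN hu hη (n - 1) 0 (by omega)).1 σ
    have hz : zext Lab.site (fun t : VConf n m => if ∀ p, ((t p).1 : ℕ) = p.1 then η else 0)
        = vacuumFun n m η := by
      funext σ
      rw [zext_of_valid _ _ fun p => Nat.le_add_left 1 _]
      rfl
    have hI := (Intertwines.ofFn_prod fun i : Fin (n - 1) => (Intertwines.ofFn_prod fun j =>
      intertwines_traceFactor (d := (i : ℕ)) B ρ u ⟨by omega, by omega⟩ j).1).1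
        (fun t : VConf n m => if ∀ p, ((t p).1 : ℕ) = p.1 then η else 0)
    rw [hz] at hI
    have h2 := congr_fun hI (lowestAbove n 0 σ)
    rw [zext_of_valid _ _ fun p => Nat.le_add_left 1 _] at h2
    rw [LinearMap.funLeft_apply, List.drop_zero, ← List.ofFn_eq_map] at h1
    rw [zext_of_valid _ _ fun p => absurd (Finset.mem_Icc.1 p.1.2) (by omega)] at h1
    have h3 : betheVector B ρ m u η = betheLevel B ρ m u η (n - 1) 0
        fun p => ⟨σ p.site, absurd (Finset.mem_Icc.1 p.1.2) (by omega)⟩ := by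
      rw [betheVector]
      congr 1
      funext p
      exact absurd (Finset.mem_Icc.1 p.1.2) (by omega)
    refine (h3.trans h1.symm).trans (h2.symm.trans ?_)
    congr 1
    funext p
    have := Finset.mem_Icc.1 p.1.2
    refine Subtype.ext (Fin.ext ?_)
    simp only [lowestAbove]
    rw [dif_pos]
    · rfl
    · exact this

end TraceOfProduct

/-! ### The open chain satisfies the hypotheses of the abstract comparison -/

section Chain

variable (n : ℕ) {ℓ : ℕ} (L : Fin ℓ → Type*) [∀ s, AddCommGroup (L s)] [∀ s, Module ℂ (L s)]
  [∀ s, LieRingModule (Matrix (Fin n) (Fin n) ℂ) (L s)]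
  [∀ s, LieModule ℂ (Matrix (Fin n) (Fin n) ℂ) (L s)] [∀ s, FiniteDimensional ℂ (L s)]

/-- Intersecting over κ ≤ d makes the family decreasing. Indices i, j ≥ d lie on the same side of
every such κ, so `chainB_mem_lowerKer` applies; the entries of column j below the diagonal belong to
the block κ = j+1. -/
theorem nestedKernels_chainB (c : Fin ℓ → ℂ) (r : ℕ) (ρ a : ℂ) :
    NestedKernels (chainB n L c r ρ a) (Regular n L c ρ)
      fun d => ⨅ κ : {κ : ℕ // κ ≤ d}, lowerKer n L c r ρ a κ where
  anti d := le_iInf fun κ => iInf_le_of_le ⟨κ.1, κ.2.trans (Nat.le_succ d)⟩ le_rfl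
  map d v i j ζ hv hij hζ := by
    rw [Submodule.mem_iInf] at hζ ⊢
    intro κ
    have := κ.2
    refine chainB_mem_lowerKer n L c r ρ a (hζ κ) hv ?_
    rcases hij with h | rfl
    · omega
    · rfl
  lower v i j ζ hv hij hζ := by
    have h := (Submodule.mem_iInf _).1 hζ ⟨j + 1, le_rfl⟩
    exact (mem_lowerKer n L c r ρ a _ ζ).1 h v hv i j (Nat.lt_succ_self _) hij

variable {n L}

theorem IsLowestVector.mem_lowerKer {c : Fin ℓ → ℂ} {r : ℕ} {ρ a : ℂ} {η : ⨂[ℂ] s, L s}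
    (hη : IsLowestVector n L c r ρ a η) (κ : ℕ) : η ∈ lowerKer n L c r ρ a κ :=
  (OpenChain.mem_lowerKer n L c r ρ a κ η).2 fun v hv i j hj hi =>
    hη.annihilated v hv i j (Fin.lt_def.2 (by omega))

theorem Generic.admissible {c : Fin ℓ → ℂ} {ρ : ℂ} {m : ℕ → ℕ} {u : (k : ℕ) → Fin (m k) → ℂ}
    (hu : Generic n L c ρ m u) {d : ℕ} (hd : d + 1 ≤ n - 1) (j : Fin (m (d + 1))) :
    Admissible (Regular n L c ρ) ρ u d (u (d + 1) j + 1 / 2) where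
  reg := by
    convert hu.regular (d + 1) (by omega) hd j using 1
    push_cast; ring
  shift q hq := by
    convert hu.shift (d + 1) (by omega) hd j (q + 1) (by omega) (by omega) using 1
    push_cast; ring
  plus b hb hb' e := by
    have h : u (d + 1) j + 1 / 2 + u b e + ρ + ((d : ℂ) - b) / 2
        = u (d + 1) j + u b e + ρ + (((d + 1 : ℕ) : ℂ) - b) / 2 := by push_cast; ring
    rw [h]
    exact hu.plus (d + 1) b hb (by omega) hd j e
  minus b hb hb' e := by
    have h : u (d + 1) j + 1 / 2 - u b e + ((d : ℂ) - b) / 2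
        = u (d + 1) j - u b e + (((d + 1 : ℕ) : ℂ) - b) / 2 := by push_cast; ring
    rw [h]
    exact hu.minus (d + 1) b hb (by omega) hd j e

end Chain

end OpenChain

end

theorem theoremT {n ℓ : ℕ} (L : Fin ℓ → Type*) [∀ s, AddCommGroup (L s)] [∀ s, Module ℂ (L s)]
    [∀ s, LieRingModule (Matrix (Fin n) (Fin n) ℂ) (L s)]
    [∀ s, LieModule ℂ (Matrix (Fin n) (Fin n) ℂ) (L s)]
    [∀ s, FiniteDimensional ℂ (L s)]
    [∀ s, LieModule.IsIrreducible ℂ (Matrix (Fin n) (Fin n) ℂ) (L s)]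
    (c : Fin ℓ → ℂ) (r : ℕ) (hr : r ≤ n) (ρ a : ℂ)
    (η : ⨂[ℂ] s, L s) (hη : OpenChain.IsLowestVector n L c r ρ a η)
    (m : ℕ → ℕ) (u : (k : ℕ) → Fin (m k) → ℂ)
    (hu : OpenChain.Generic n L c ρ m u) :
    OpenChain.betheVector (OpenChain.chainB n L c r ρ a) ρ m u η =
      (OpenChain.traceOperator (OpenChain.chainB n L c r ρ a) ρ m u).trace η :=
  OpenChain.betheVector_eq_trace (OpenChain.nestedKernels_chainB n L c r ρ a)
    (fun _ hd j => hu.admissible hd j) ((Submodule.mem_iInf _).2 fun κ => hη.mem_lowerKer κ)
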